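/- Let $d\ge 3$ and let $\mathcal H$ be a homogeneous foliation of degree $d$ on $\mathbb P^2_{\mathbb C}$, defined in affine coordinates $(x,y)$ by $$\omega=A(x,y)\,\mathrm dx+B(x,y)\,\mathrm dy,\qquad A,B\in\mathbb C[x,y]_d,\quad \gcd(A,B)=1 .$$ Let $\mathrm{Leg}\,\mathcal H$ be its dual web, i.e. the $d$-web on the dual plane $\check{\mathbb P}^2_{\mathbb C}$ whose leaves are the tangent lines to the leaves of $\mathcal H$; in the affine chart $(p,q)$ of $\check{\mathbb P}^2_{\mathbb C}$ corresponding to the lines $\{y=px-q\}$ it is given by $A(x,px-q)+p\,B(x,px-q)=0$ with $x=\frac{\mathrm dq}{\mathrm dp}$. Its curvature is the meromorphic $2$-form given, near each point off the discriminant, where the web is the superposition of $d$ pairwise transverse foliations $\omega_i=0$, by $\mathrm d\sum_{r<s<t}\eta_{rst}$; here $\eta_{rst}$ is the unique $1$-form with $\mathrm d(\delta_{st}\omega_r)=\eta_{rst}\wedge\delta_{st}\omega_r$, $\mathrm d(\delta_{tr}\omega_s)=\eta_{rst}\wedge\delta_{tr}\omega_s$ and $\mathrm d(\delta_{rs}\omega_t)=\eta_{rst}\wedge\delta_{rs}\omega_t$,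 where $\omega_i\wedge\omega_j=\delta_{ij}\,\mathrm du\wedge\mathrm dv$ in local coordinates $(u,v)$. Let $\mathcal G_{\mathcal H}$ be the Gauss map, sending a regular point $m$ of $\mathcal H$ to the line tangent at $m$ to the leaf through $m$, and let $\widehat G_{\mathcal H}:\mathbb P^1_{\mathbb C}\to\mathbb P^1_{\mathbb C}$ be the rational map $[y:x]\mapsto[-A(x,y):B(x,y)]$. Assume that the line $T=(ax+by=0)$ is a transverse inflection line of $\mathcal H$ of order $\nu-1\ge 1$ (that is, $T$ is not invariant by $\mathcal H$ and has multiplicity exactly $\nu-1$ in the inflection divisor of $\mathcal H$). Suppose moreover that $[-a:b]$ is the only non-fixed critical point of $\widehat G_{\mathcal H}$ in its fiber $\widehat G_{\mathcal H}^{-1}(\widehat G_{\mathcal H}([-a:b]))$. Then $$P(x,y;a,b):=\frac{\begin{vmatrix}A(x,y)&A(b,-a)\\ B(x,y)&B(b,-a)\end{vmatrix}}{(ax+by)^{\nu}}$$ is a polynomial in $x,y$ and, setting $$Q(x,y;a,b):=(\nu-2)\left(\frac{\partial B}{\partial x}-\frac{\partial A}{\partial y}\right)P(x,y;a,b)+2(\nu+1)\begin{vmatrix}\dfrac{\partial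 P}{\partial x}&A(x,y)\\[2mm] \dfrac{\partial P}{\partial y}&B(x,y)\end{vmatrix},$$ the curvature of $\mathrm{Leg}\,\mathcal H$ is holomorphic on $T'=\mathcal G_{\mathcal H}(T)$ (i.e. it extends holomorphically at all but finitely many points of $T'$) if and only if $Q(b,-a;a,b)=0$. -/

import Mathlib

open MvPolynomial
open scoped LinearAlgebra.Projectivization

/-- The complex projective line, with homogeneous coordinates `[z 0 : z 1]`. -/
abbrev ProjLine : Type := ℙ ℂ (Fin 2 → ℂ)

/-- The dual projective plane: `[u : v : w]` is the line `u x + v y + w = 0` of the projective plane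
(in the affine chart `(x, y)`; the line at infinity is `[0 : 0 : 1]`). -/
abbrev DualPlane : Type := ℙ ℂ (Fin 3 → ℂ)

/-! ### Webs on open subsets of `ℂ²`, their fundamental form and curvature

A `1`-form `α du + β dv` on (an open subset of) `ℂ²` with coordinates `(u, v)` is the function
`m ↦ (α m, β m)`. -/

namespace PlanarWeb

/-- Coefficient of `du ∧ dv` in `(θ.1 du + θ.2 dv) ∧ (τ.1 du + τ.2 dv)`. -/
def wedge (θ τ : ℂ × ℂ) : ℂ := θ.1 * τ.2 - θ.2 * τ.1

/-- Coefficient of `du ∧ dv` in the exterior derivative of a `1`-form, at the point `m`. -/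
noncomputable def extD (θ : ℂ × ℂ → ℂ × ℂ) (m : ℂ × ℂ) : ℂ :=
  fderiv ℂ (fun z => (θ z).2) m (1, 0) - fderiv ℂ (fun z => (θ z).1) m (0, 1)

/-- On `V`, the `1`-form `η` is the fundamental form of the `3`-web defined by `ω₁, ω₂, ω₃`:
`d (δ₂₃ ω₁) = η ∧ δ₂₃ ω₁`, `d (δ₃₁ ω₂) = η ∧ δ₃₁ ω₂`, `d (δ₁₂ ω₃) = η ∧ δ₁₂ ω₃`,
where `ωᵢ ∧ ωⱼ = δᵢⱼ du ∧ dv`. -/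
def IsFundamentalForm3 (V : Set (ℂ × ℂ)) (ω₁ ω₂ ω₃ η : ℂ × ℂ → ℂ × ℂ) : Prop :=
  ∀ m ∈ V,
    extD (fun z => wedge (ω₂ z) (ω₃ z) • ω₁ z) m
      = wedge (η m) (wedge (ω₂ m) (ω₃ m) • ω₁ m) ∧
    extD (fun z => wedge (ω₃ z) (ω₁ z) • ω₂ z) m
      = wedge (η m) (wedge (ω₃ m) (ω₁ m) • ω₂ m) ∧
    extD (fun z => wedge (ω₁ z) (ω₂ z) • ω₃ z) m
      = wedge (η m) (wedge (ω₁ m) (ω₂ m) • ω₃ m)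

/-- The linear forms `θ i` are pairwise linearly independent with product the binary form `f`
of degree `d` (a function of the tangent vector). -/
def Factors {d : ℕ} (f : ℂ × ℂ → ℂ) (θ : Fin d → ℂ × ℂ) : Prop :=
  (∀ i j, i ≠ j → wedge (θ i) (θ j) ≠ 0) ∧
    ∀ ξ : ℂ × ℂ, f ξ = ∏ i, ((θ i).1 * ξ.1 + (θ i).2 * ξ.2)

/-- (The support of) the discriminant of the `d`-web given by the `d`-symmetric `1`-form `W`
(`W m ξ` is its value at the point `m` on the tangent vector `ξ`): the points `m` where `W m` is not
a product of `d` pairwise linearly independent `1`-forms. -/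
def discriminant (d : ℕ) (W : ℂ × ℂ → ℂ × ℂ → ℂ) : Set (ℂ × ℂ) :=
  {m | ¬ ∃ θ : Fin d → ℂ × ℂ, Factors (W m) θ}

/-- Near the point `m` the `d`-web `W` is regular and its curvature is `g du ∧ dv`: on a
neighbourhood `V` of `m`, `W` is the superposition of `d` pairwise transverse holomorphic foliations
`ω i = 0`, and `g du ∧ dv = dη` where `η = ∑_{r<s<t} η_{rst}` and `η_{rst}` is the fundamental form
of the `3`-subweb defined by `ω r, ω s, ω t`. -/
def HasCurvatureNear (d : ℕ) (W : ℂ × ℂ → ℂ × ℂ → ℂ) (g : ℂ × ℂ → ℂ) (m : ℂ × ℂ) : Prop :=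
  ∃ (V : Set (ℂ × ℂ)) (ω : Fin d → ℂ × ℂ → ℂ × ℂ)
    (η : Fin d → Fin d → Fin d → ℂ × ℂ → ℂ × ℂ),
    IsOpen V ∧ m ∈ V ∧
    (∀ i, AnalyticOnNhd ℂ (ω i) V) ∧
    (∀ z ∈ V, Factors (W z) (fun i => ω i z)) ∧
    (∀ r s t, r < s → s < t →
      AnalyticOnNhd ℂ (η r s t) V ∧ IsFundamentalForm3 V (ω r) (ω s) (ω t) (η r s t)) ∧
    ∀ z ∈ V,
      g z = extD (fun z' => ∑ r, ∑ s, ∑ t, if r < s ∧ s < t then η r s t z' else 0) z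

/-- The curvature of the `d`-web `W`, a holomorphic `2`-form off the discriminant, extends
holomorphically to a neighbourhood of `m`. -/
def CurvatureHolomorphicAt (d : ℕ) (W : ℂ × ℂ → ℂ × ℂ → ℂ) (m : ℂ × ℂ) : Prop :=
  ∃ (N : Set (ℂ × ℂ)) (g : ℂ × ℂ → ℂ), IsOpen N ∧ m ∈ N ∧ AnalyticOnNhd ℂ g N ∧
    ∀ z ∈ N, z ∉ discriminant d W → HasCurvatureNear d W g z

end PlanarWeb

/-- The line `{y = p x - q}`, where `m = (p, q)`, as a point of the dual plane. -/
noncomputable def dualChart₁ (m : ℂ × ℂ) : DualPlane :=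
  Projectivization.mk ℂ ![m.1, -1, -m.2] (fun h => by simpa using congrFun h 1)

/-- The line `{x = p y - q}`, where `m = (p, q)`, as a point of the dual plane. -/
noncomputable def dualChart₂ (m : ℂ × ℂ) : DualPlane :=
  Projectivization.mk ℂ ![-1, m.1, -m.2] (fun h => by simpa using congrFun h 0)

/-- A homogeneous foliation of degree `d` on the projective plane, defined in the affine chart
`(x, y)` by the `1`-form `A dx + B dy`, with `A`, `B` homogeneous of degree `d`, `gcd (A, B) = 1`.
The variables `x`, `y` are `X 0`, `X 1`. -/
structure HomogeneousFoliation (d : ℕ) where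
  A : MvPolynomial (Fin 2) ℂ
  B : MvPolynomial (Fin 2) ℂ
  homogeneous_A : A.IsHomogeneous d
  homogeneous_B : B.IsHomogeneous d
  gcd_eq_one : IsRelPrime A B

/-- The linear form `a x + b y`. -/
noncomputable def linForm (a b : ℂ) : MvPolynomial (Fin 2) ℂ := C a * X 0 + C b * X 1

namespace HomogeneousFoliation

variable {d : ℕ} (H : HomogeneousFoliation d)

/-! #### The inflection divisor -/

/-- The derivation `Z = B ∂/∂x - A ∂/∂y`: the vector field tangent to the foliation. -/
noncomputable def tangentField (f : MvPolynomial (Fin 2) ℂ) : MvPolynomial (Fin 2) ℂ :=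
  H.B * pderiv 0 f - H.A * pderiv 1 f

/-- Equation in the affine chart `(x, y)` of the inflection divisor of the foliation:
`Z(x) Z(Z(y)) - Z(y) Z(Z(x))`. -/
noncomputable def inflectionPoly : MvPolynomial (Fin 2) ℂ :=
  H.tangentField (X 0) * H.tangentField (H.tangentField (X 1))
    - H.tangentField (X 1) * H.tangentField (H.tangentField (X 0))

/-- The line `a x + b y = 0` is invariant by the foliation: `a x + b y` divides
`(a dx + b dy) ∧ (A dx + B dy)`. -/
def IsInvariantLine (a b : ℂ) : Prop := linForm a b ∣ C a * H.B - C b * H.A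

/-- The line `a x + b y = 0` is a transverse inflection line of order `n ≥ 1`: it is not invariant,
and it is a component of multiplicity `n` of the inflection divisor. -/
def IsTransverseInflectionLine (a b : ℂ) (n : ℕ) : Prop :=
  ¬ H.IsInvariantLine a b ∧ 1 ≤ n ∧ emultiplicity (linForm a b) H.inflectionPoly = n

/-! #### The rational map of the projective line -/

/-- The homogeneous lift `(y, x) ↦ (-A(x, y), B(x, y))`. -/
noncomputable def gaussLift (z : Fin 2 → ℂ) : Fin 2 → ℂ :=
  ![-(eval ![z 1, z 0] H.A), eval ![z 1, z 0] H.B]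

theorem linForm_dvd {f : MvPolynomial (Fin 2) ℂ} (hf : f.IsHomogeneous d) {x y : ℂ}
    (hv : ![x, y] ≠ 0) (h0 : eval ![x, y] f = 0) : linForm y (-x) ∣ f := by
  obtain ⟨i, hi⟩ : ∃ i, ![x, y] i ≠ 0 := by
    by_contra! hcon
    exact hv (funext hcon)
  set c : ℂ := ![x, y] i with hc
  let I : Ideal (MvPolynomial (Fin 2) ℂ) := Ideal.span {linForm y (-x)}
  have key : ∀ j, Ideal.Quotient.mk I (C c * X j) =
      Ideal.Quotient.mk I (C (![x, y] j) * X i) := by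
    intro j
    rw [Ideal.Quotient.eq, Ideal.mem_span_singleton]
    fin_cases i <;> fin_cases j
    · simp [hc]
    · refine ⟨-1, ?_⟩
      simp [linForm, hc]
      ring
    · refine ⟨1, ?_⟩
      simp [linForm, hc]
      ring
    · simp [hc]
  have e1 : ∀ (k : Fin 2 → MvPolynomial (Fin 2) ℂ) (s : MvPolynomial (Fin 2) ℂ),
      ∑ m ∈ f.support, C (f.coeff m) * ∏ j, (s * k j) ^ m j =
        s ^ d * ∑ m ∈ f.support, C (f.coeff m) * ∏ j, k j ^ m j := by
    intro k s
    rw [Finset.mul_sum]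
    refine Finset.sum_congr rfl fun m hm => ?_
    have hd : ∑ j, m j = d := by
      have := hf (MvPolynomial.mem_support_iff.mp hm)
      rw [← this, Finsupp.weight_apply, Finsupp.sum_fintype _ _ (by simp)]
      simp
    simp_rw [mul_pow]
    rw [Finset.prod_mul_distrib, Finset.prod_pow_eq_pow_sum, hd]
    ring
  have e2 : ∑ m ∈ f.support, C (f.coeff m) * ∏ j, (X j : MvPolynomial (Fin 2) ℂ) ^ m j = f := by
    conv_rhs => rw [← MvPolynomial.support_sum_monomial_coeff f]
    refine Finset.sum_congr rfl fun m _ => ?_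
    rw [MvPolynomial.monomial_eq, Finsupp.prod_fintype _ _ (by simp)]
  have e3 : ∑ m ∈ f.support, C (f.coeff m) *
      ∏ j, (C (![x, y] j) : MvPolynomial (Fin 2) ℂ) ^ m j = 0 := by
    rw [← map_zero C, ← h0, MvPolynomial.eval_eq', map_sum]
    refine Finset.sum_congr rfl fun m _ => ?_
    simp only [map_mul, map_prod, map_pow]
  have h1 := e1 X (C c)
  have h2 := e1 (fun j => C (![x, y] j)) (X i)
  rw [e2] at h1
  rw [e3, mul_zero] at h2
  have h3 : Ideal.Quotient.mk I (C c ^ d * f) = 0 := by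
    rw [← h1, ← map_zero (Ideal.Quotient.mk I), ← h2, map_sum, map_sum]
    refine Finset.sum_congr rfl fun m _ => ?_
    rw [map_mul, map_mul, map_prod, map_prod]
    congr 1
    refine Finset.prod_congr rfl fun j _ => ?_
    rw [map_pow, map_pow, key j, mul_comm (X i)]
  rw [Ideal.Quotient.eq_zero_iff_mem, Ideal.mem_span_singleton] at h3
  have hu : IsUnit (C c ^ d : MvPolynomial (Fin 2) ℂ) :=
    ((isUnit_iff_ne_zero.mpr hi).map (C : ℂ →+* MvPolynomial (Fin 2) ℂ)).pow d
  exact (hu.dvd_mul_left).mp h3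

theorem not_isUnit_linForm (a b : ℂ) : ¬ IsUnit (linForm a b) := by
  intro h
  have := h.map (eval (0 : Fin 2 → ℂ))
  simp [linForm] at this

theorem gaussLift_ne_zero {z : Fin 2 → ℂ} (hz : z ≠ 0) : H.gaussLift z ≠ 0 := by
  intro h
  have hA : eval ![z 1, z 0] H.A = 0 := by simpa [gaussLift] using congrFun h 0
  have hB : eval ![z 1, z 0] H.B = 0 := by simpa [gaussLift] using congrFun h 1
  have hv : ![z 1, z 0] ≠ 0 := by
    intro h'
    apply hz
    funext i
    fin_cases i
    · simpa using congrFun h' 1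
    · simpa using congrFun h' 0
  exact not_isUnit_linForm _ _
    (H.gcd_eq_one (linForm_dvd H.homogeneous_A hv hA) (linForm_dvd H.homogeneous_B hv hB))

/-- The rational map `[y : x] ↦ [-A(x, y) : B(x, y)]` of the projective line to itself. -/
noncomputable def gaussMap (z : ProjLine) : ProjLine :=
  Projectivization.mk ℂ (H.gaussLift z.rep) (H.gaussLift_ne_zero z.rep_nonzero)

/-- `z = [y : x]` is a critical point of `gaussMap`: the differential of the map vanishes at `z`,
that is, the differential of the lift `(y, x) ↦ (-A(x, y), B(x, y))` sends every vector `(t, s)`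
to a multiple of `(-A(x, y), B(x, y))` (the tangent space of the projective line at `[u]` being
`ℂ² / ℂ u`). -/
def IsCriticalPoint (z : ProjLine) : Prop :=
  ∀ s t : ℂ,
    ![-(s * eval ![z.rep 1, z.rep 0] (pderiv 0 H.A) + t * eval ![z.rep 1, z.rep 0] (pderiv 1 H.A)),
      s * eval ![z.rep 1, z.rep 0] (pderiv 0 H.B) + t * eval ![z.rep 1, z.rep 0] (pderiv 1 H.B)]
      ∈ Submodule.span ℂ {H.gaussLift z.rep}

/-- The non-fixed critical points of `gaussMap` in the fibre of `gaussMap` through `z₀`. -/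
def nonFixedCriticalPointsInFiber (z₀ : ProjLine) : Set ProjLine :=
  {z | H.gaussMap z = H.gaussMap z₀ ∧ H.IsCriticalPoint z ∧ H.gaussMap z ≠ z}

/-! #### The Gauss map and the dual web -/

/-- The image under the Gauss map `m ↦ T_m` of the line `a x + b y = 0`: the set of tangent lines
`A(m) (X - x) + B(m) (Y - y) = 0` at the regular points `m = (x, y)` of that line. -/
def gaussImageOfLine (a b : ℂ) : Set DualPlane :=
  {ℓ | ∃ (x y : ℂ)
      (h : ![eval ![x, y] H.A, eval ![x, y] H.B,
        -(x * eval ![x, y] H.A + y * eval ![x, y] H.B)] ≠ 0),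
      a * x + b * y = 0 ∧ ℓ = Projectivization.mk ℂ _ h}

/-- The dual web in the chart of the lines `y = p x - q`: the `d`-symmetric `1`-form obtained by
multiplying `A(x, p x - q) + p B(x, p x - q)`, `x = dq/dp`, by `(dp)^d`. Here `m = (p, q)` and
`ξ = (dp, dq)`. -/
noncomputable def leg₁ (m ξ : ℂ × ℂ) : ℂ :=
  eval ![ξ.2, m.1 * ξ.2 - m.2 * ξ.1] H.A + m.1 * eval ![ξ.2, m.1 * ξ.2 - m.2 * ξ.1] H.B

/-- The dual web in the chart of the lines `x = p y - q`: likewise with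
`p A(p y - q, y) + B(p y - q, y)`, `y = dq/dp`. -/
noncomputable def leg₂ (m ξ : ℂ × ℂ) : ℂ :=
  m.1 * eval ![m.1 * ξ.2 - m.2 * ξ.1, ξ.2] H.A + eval ![m.1 * ξ.2 - m.2 * ξ.1, ξ.2] H.B

/-- The equation of the dual web in the first chart. -/
theorem leg₁_eq (p q x : ℂ) :
    H.leg₁ (p, q) (1, x) = eval ![x, p * x - q] H.A + p * eval ![x, p * x - q] H.B := by
  simp [leg₁]

/-- The curvature of the dual web is holomorphic at the point `ℓ` of the dual plane. The two charts
cover the dual plane except the point `[0 : 0 : 1]`. -/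
def LegCurvatureHolomorphicAt (ℓ : DualPlane) : Prop :=
  (∀ m, dualChart₁ m = ℓ → PlanarWeb.CurvatureHolomorphicAt d H.leg₁ m) ∧
    (∀ m, dualChart₂ m = ℓ → PlanarWeb.CurvatureHolomorphicAt d H.leg₂ m)

/-- The curvature of the dual web is holomorphic on the irreducible curve with generic part `D`:
it is holomorphic at all but finitely many points of `D`. -/
def LegCurvatureHolomorphicOn (D : Set DualPlane) : Prop :=
  {ℓ ∈ D | ¬ H.LegCurvatureHolomorphicAt ℓ}.Finite

/-! #### The polynomial of the criterion -/

/-- The determinant with rows `A(x, y), A(b, -a)` and `B(x, y), B(b, -a)`. -/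
noncomputable def fiberPoly (a b : ℂ) : MvPolynomial (Fin 2) ℂ :=
  H.A * C (eval ![b, -a] H.B) - C (eval ![b, -a] H.A) * H.B

/-- `(ν - 2) (∂B/∂x - ∂A/∂y) P + 2 (ν + 1) (∂P/∂x B - A ∂P/∂y)`. -/
noncomputable def criterionPoly (ν : ℕ) (P : MvPolynomial (Fin 2) ℂ) : MvPolynomial (Fin 2) ℂ :=
  C ((ν : ℂ) - 2) * (pderiv 0 H.B - pderiv 1 H.A) * P
    + C (2 * ((ν : ℂ) + 1)) * (pderiv 0 P * H.B - H.A * pderiv 1 P)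

end HomogeneousFoliation

/-! Fix `p₀` and put `π = p - p₀`. The line `y = p x - q` meets the line through the origin of
direction `(μ, p₀ μ - 1)` at the point of abscissa `q μ / (1 + π μ)`, so that in terms of `μ` the
leaves of the dual web through `(p, q)` correspond to the roots of a member `F + π b` of a pencil of
polynomials, independently of `q`. The curvature is therefore, up to sign,
`S'(π) / q dp ∧ dq`, where `S(π)` is a sum of rational expressions over the roots of `F + π b`,
and it extends holomorphically across `π = 0` if and only if `π S(π) → 0` as `π → 0`.

When `p₀` is the slope along `T`, the polynomial `F` has a root `μ₀` of multiplicity `ν`, the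
direction of `T`, and its only other possible multiple root, a fixed critical point, lies at
infinity. Substituting `π = -F(μ) / b(μ)` turns the terms of `π S(π)` into the values, at the roots
of `F + π b`, of one rational function of `μ`. Remove its polar part at `μ₀`: what remains tends to
`0` at every root of `F` and, if `F` has a root there, at infinity, while the sum of what has been
removed is evaluated by partial fractions. Hence `π S(π)` tends to the coefficient of `1 / (μ - μ₀)`
in that polar part, a nonzero multiple of the value of `Q` at the direction of `T`. -/

namespace PlanarWeb

open Filter Topology Bornology
open scoped Polynomial
open Polynomial (derivative)

/-! ### Fundamental forms of three-webs -/

section ExteriorDerivative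

theorem wedge_smul_left (c : ℂ) (θ τ : ℂ × ℂ) : wedge (c • θ) τ = c * wedge θ τ := by
  simp only [wedge, Prod.smul_fst, Prod.smul_snd, smul_eq_mul]
  ring

theorem wedge_smul_right (c : ℂ) (θ τ : ℂ × ℂ) : wedge θ (c • τ) = c * wedge θ τ := by
  simp only [wedge, Prod.smul_fst, Prod.smul_snd, smul_eq_mul]
  ring

theorem eq_of_wedge_eq {η η' θ τ : ℂ × ℂ} (h : wedge θ τ ≠ 0) (hθ : wedge η θ = wedge η' θ)
    (hτ : wedge η τ = wedge η' τ) : η = η' := by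
  simp only [wedge] at *
  ext
  · apply mul_right_cancel₀ h
    linear_combination θ.1 * hτ - τ.1 * hθ
  · apply mul_right_cancel₀ h
    linear_combination θ.2 * hτ - τ.2 * hθ

variable {f : ℂ × ℂ → ℂ} {θ τ : ℂ × ℂ → ℂ × ℂ} {z : ℂ × ℂ}

theorem fderiv_apply_one_zero (hf : DifferentiableAt ℂ f z) :
    fderiv ℂ f z (1, 0) = deriv (fun t => f (t, z.2)) z.1 :=
  (hf.hasFDerivAt.comp_hasDerivAt (f := fun t : ℂ => (t, z.2)) z.1
    ((hasDerivAt_id z.1).prodMk (hasDerivAt_const _ _))).deriv.symm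

theorem fderiv_apply_zero_one (hf : DifferentiableAt ℂ f z) :
    fderiv ℂ f z (0, 1) = deriv (fun t => f (z.1, t)) z.2 :=
  (hf.hasFDerivAt.comp_hasDerivAt (f := fun t : ℂ => (z.1, t)) z.2
    ((hasDerivAt_const _ _).prodMk (hasDerivAt_id z.2))).deriv.symm

theorem differentiableAt_wedge (hθ : DifferentiableAt ℂ θ z) (hτ : DifferentiableAt ℂ τ z) :
    DifferentiableAt ℂ (fun w => wedge (θ w) (τ w)) z := by
  unfold wedge
  fun_prop

theorem extD_congr (h : θ =ᶠ[𝓝 z] τ) : extD θ z = extD τ z := by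
  have hsnd : (fun w => (θ w).2) =ᶠ[𝓝 z] fun w => (τ w).2 := h.fun_comp Prod.snd
  have hfst : (fun w => (θ w).1) =ᶠ[𝓝 z] fun w => (τ w).1 := h.fun_comp Prod.fst
  simp only [extD, hsnd.fderiv_eq, hfst.fderiv_eq]

theorem extD_add (hθ : DifferentiableAt ℂ θ z) (hτ : DifferentiableAt ℂ τ z) :
    extD (fun w => θ w + τ w) z = extD θ z + extD τ z := by
  simp only [extD, Prod.snd_add, Prod.fst_add, fderiv_fun_add hθ.snd hτ.snd,
    fderiv_fun_add hθ.fst hτ.fst, add_apply]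
  ring

theorem extD_sum {ι : Type*} (s : Finset ι) {θ : ι → ℂ × ℂ → ℂ × ℂ}
    (h : ∀ i ∈ s, DifferentiableAt ℂ (θ i) z) :
    extD (fun w => ∑ i ∈ s, θ i w) z = ∑ i ∈ s, extD (θ i) z := by
  simp only [extD, Prod.snd_sum, Prod.fst_sum, fderiv_fun_sum fun i hi => (h i hi).snd,
    fderiv_fun_sum fun i hi => (h i hi).fst, sum_apply,
    Finset.sum_sub_distrib]

/-- The logarithmic differential `df / f`. -/
noncomputable def dlog (f : ℂ × ℂ → ℂ) (z : ℂ × ℂ) : ℂ × ℂ :=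
  (fderiv ℂ f z (1, 0) / f z, fderiv ℂ f z (0, 1) / f z)

theorem extD_smul_eq_wedge {η : ℂ × ℂ} (hf : DifferentiableAt ℂ f z) (hf0 : f z ≠ 0)
    (hθ : DifferentiableAt ℂ θ z) (hη : extD θ z = wedge η (θ z)) :
    extD (fun w => f w • θ w) z = wedge (η + dlog f z) (f z • θ z) := by
  have hmul : extD (fun w => f w • θ w) z =
      f z * extD θ z + wedge (fderiv ℂ f z (1, 0), fderiv ℂ f z (0, 1)) (θ z) := by
    simp only [extD, wedge, Prod.smul_snd, Prod.smul_fst, smul_eq_mul,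
      fderiv_fun_mul hf hθ.snd, fderiv_fun_mul hf hθ.fst, add_apply, smul_apply]
    ring
  rw [hmul, hη]
  simp only [wedge, dlog, Prod.smul_fst, Prod.smul_snd, Prod.fst_add, Prod.snd_add, smul_eq_mul]
  field_simp
  ring

theorem analyticAt_fderiv_div (hf : AnalyticAt ℂ f z) (h0 : f z ≠ 0) (u : ℂ × ℂ) :
    AnalyticAt ℂ (fun w => fderiv ℂ f w u / f w) z :=
  (((ContinuousLinearMap.apply ℂ ℂ u).analyticAt _).comp hf.fderiv).div hf h0

theorem analyticAt_dlog (hf : AnalyticAt ℂ f z) (h0 : f z ≠ 0) : AnalyticAt ℂ (dlog f) z :=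
  (analyticAt_fderiv_div hf h0 _).prod (analyticAt_fderiv_div hf h0 _)

theorem fderiv_fderiv_div (hf : AnalyticAt ℂ f z) (h0 : f z ≠ 0) (u v : ℂ × ℂ) :
    fderiv ℂ (fun w => fderiv ℂ f w u / f w) z v =
      (fderiv ℂ (fderiv ℂ f) z v u * f z - fderiv ℂ f z u * fderiv ℂ f z v) / f z ^ 2 := by
  have hu : HasFDerivAt (fun w => fderiv ℂ f w u) ((fderiv ℂ (fderiv ℂ f) z).flip u) z := by
    simpa using hf.fderiv.differentiableAt.hasFDerivAt.clm_apply (hasFDerivAt_const u z)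
  have hprod : (fun w => fderiv ℂ f w u / f w * f w) =ᶠ[𝓝 z] fun w => fderiv ℂ f w u :=
    (hf.continuousAt.eventually_ne h0).mono fun w hw => div_mul_cancel₀ _ hw
  have hleibniz := DFunLike.congr_fun (hprod.fderiv_eq (𝕜 := ℂ)) v
  rw [hu.fderiv, fderiv_fun_mul (analyticAt_fderiv_div hf h0 u).differentiableAt
    hf.differentiableAt] at hleibniz
  simp only [add_apply, smul_apply, smul_eq_mul, ContinuousLinearMap.flip_apply] at hleibniz
  rw [← hleibniz]
  field_simp
  ring

theorem extD_dlog (hf : AnalyticAt ℂ f z) (h0 : f z ≠ 0) : extD (dlog f) z = 0 := by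
  have hsymm : IsSymmSndFDerivAt ℂ f z := ContDiffAt.isSymmSndFDerivAt_of_omega hf.contDiffAt
  simp only [extD, dlog]
  rw [fderiv_fderiv_div hf h0, fderiv_fderiv_div hf h0, hsymm.eq (1, 0) (0, 1)]
  ring

end ExteriorDerivative

section FundamentalForm

variable {V : Set (ℂ × ℂ)} {ω₁ ω₂ ω₃ ω₁' ω₂' ω₃' η η' : ℂ × ℂ → ℂ × ℂ}

theorem IsFundamentalForm3.congr (h : IsFundamentalForm3 V ω₁ ω₂ ω₃ η)
    (h₁ : ∀ z ∈ V, ω₁' =ᶠ[𝓝 z] ω₁) (h₂ : ∀ z ∈ V, ω₂' =ᶠ[𝓝 z] ω₂)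
    (h₃ : ∀ z ∈ V, ω₃' =ᶠ[𝓝 z] ω₃) : IsFundamentalForm3 V ω₁' ω₂' ω₃' η := by
  have hform {z} {α β γ α' β' γ' : ℂ × ℂ → ℂ × ℂ} (hα : α' =ᶠ[𝓝 z] α) (hβ : β' =ᶠ[𝓝 z] β)
      (hγ : γ' =ᶠ[𝓝 z] γ) :
      (fun w => wedge (β' w) (γ' w) • α' w) =ᶠ[𝓝 z] fun w => wedge (β w) (γ w) • α w := by
    filter_upwards [hα, hβ, hγ] with w hα hβ hγ
    rw [hα, hβ, hγ]
  intro z hz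
  have h₁z := h₁ z hz
  have h₂z := h₂ z hz
  have h₃z := h₃ z hz
  rw [extD_congr (hform h₁z h₂z h₃z), extD_congr (hform h₂z h₃z h₁z),
    extD_congr (hform h₃z h₁z h₂z), h₁z.self_of_nhds, h₂z.self_of_nhds, h₃z.self_of_nhds]
  exact h z hz

theorem IsFundamentalForm3.unique (h : IsFundamentalForm3 V ω₁ ω₂ ω₃ η)
    (h' : IsFundamentalForm3 V ω₁ ω₂ ω₃ η') {z : ℂ × ℂ} (hz : z ∈ V)
    (h₁₂ : wedge (ω₁ z) (ω₂ z) ≠ 0) (h₂₃ : wedge (ω₂ z) (ω₃ z) ≠ 0)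
    (h₃₁ : wedge (ω₃ z) (ω₁ z) ≠ 0) : η z = η' z := by
  obtain ⟨e₁, e₂, -⟩ := h z hz
  obtain ⟨e₁', e₂', -⟩ := h' z hz
  refine eq_of_wedge_eq ?_ (e₁.symm.trans e₁') (e₂.symm.trans e₂')
  rw [wedge_smul_left, wedge_smul_right]
  exact mul_ne_zero h₂₃ (mul_ne_zero h₃₁ h₁₂)

theorem IsFundamentalForm3.smul (h : IsFundamentalForm3 V ω₁ ω₂ ω₃ η)
    (h₁ : ∀ z ∈ V, DifferentiableAt ℂ ω₁ z) (h₂ : ∀ z ∈ V, DifferentiableAt ℂ ω₂ z)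
    (h₃ : ∀ z ∈ V, DifferentiableAt ℂ ω₃ z) {ρ₁ ρ₂ ρ₃ : ℂ × ℂ → ℂ}
    (hρ : ∀ z ∈ V, DifferentiableAt ℂ (fun w => ρ₁ w * ρ₂ w * ρ₃ w) z)
    (hρ0 : ∀ z ∈ V, ρ₁ z * ρ₂ z * ρ₃ z ≠ 0) :
    IsFundamentalForm3 V (fun z => ρ₁ z • ω₁ z) (fun z => ρ₂ z • ω₂ z) (fun z => ρ₃ z • ω₃ z)
      (fun z => η z + dlog (fun w => ρ₁ w * ρ₂ w * ρ₃ w) z) := by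
  have hform (α β γ : ℂ × ℂ) {a b c r : ℂ} (hr : a * b * c = r) :
      wedge (b • β) (c • γ) • a • α = r • wedge β γ • α := by
    rw [wedge_smul_left, wedge_smul_right, smul_smul, smul_smul, ← hr]
    ring_nf
  intro z hz
  obtain ⟨e₁, e₂, e₃⟩ := h z hz
  have d₁ := h₁ z hz
  have d₂ := h₂ z hz
  have d₃ := h₃ z hz
  have hr₂ (w) : ρ₂ w * ρ₃ w * ρ₁ w = ρ₁ w * ρ₂ w * ρ₃ w := by ring
  have hr₃ (w) : ρ₃ w * ρ₁ w * ρ₂ w = ρ₁ w * ρ₂ w * ρ₃ w := by ring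
  simp only [hform (ω₁ _) (ω₂ _) (ω₃ _) rfl, hform _ _ _ (hr₂ _), hform _ _ _ (hr₃ _)]
  exact ⟨extD_smul_eq_wedge (hρ z hz) (hρ0 z hz) ((differentiableAt_wedge d₂ d₃).smul d₁) e₁,
    extD_smul_eq_wedge (hρ z hz) (hρ0 z hz) ((differentiableAt_wedge d₃ d₁).smul d₂) e₂,
    extD_smul_eq_wedge (hρ z hz) (hρ0 z hz) ((differentiableAt_wedge d₁ d₂).smul d₃) e₃⟩

end FundamentalForm

/-! ### Webs of branches -/

section Branches

/-- The branches `m i` of a multivalued function of one variable are holomorphic at `p` and take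
pairwise distinct values there. -/
structure SeparatedAt {ι : Type*} (m : ι → ℂ → ℂ) (p : ℂ) : Prop where
  analyticAt : ∀ i, AnalyticAt ℂ (m i) p
  injective : Function.Injective fun i => m i p

variable {ι : Type*} {m : ι → ℂ → ℂ} {p : ℂ} {i j k : ι}

theorem SeparatedAt.sub_ne_zero (h : SeparatedAt m p) (hij : i ≠ j) : m i p - m j p ≠ 0 :=
  _root_.sub_ne_zero.2 (h.injective.ne hij)

theorem SeparatedAt.eventually [Finite ι] (h : SeparatedAt m p) :
    ∀ᶠ p' in 𝓝 p, SeparatedAt m p' := by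
  have hanalytic : ∀ᶠ p' in 𝓝 p, ∀ i, AnalyticAt ℂ (m i) p' :=
    eventually_all.2 fun i => (h.analyticAt i).eventually_analyticAt
  have hne : ∀ᶠ p' in 𝓝 p, ∀ i j, i ≠ j → m i p' - m j p' ≠ 0 :=
    eventually_all.2 fun i => eventually_all.2 fun j => eventually_imp_distrib_left.2 fun hij =>
      ((h.analyticAt i).sub (h.analyticAt j)).continuousAt.eventually_ne (h.sub_ne_zero hij)
  filter_upwards [hanalytic, hne] with p' ha hn
  exact ⟨ha, fun i j hij => by_contra fun hne => hn i j hne (sub_eq_zero.2 hij)⟩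

/-- The `1`-form `q μ(p) dp - (1 + (p - p₀) μ(p)) dq`. Its leaves are the graphs whose slope
`x = dq / dp` is `q μ / (1 + (p - p₀) μ)`: the line `y = p x - q` is met at the point of direction
`(μ, p₀ μ - 1)`, so that `μ` is a coordinate on the fibre which does not move with `q`. -/
def branchForm (p₀ : ℂ) (μ : ℂ → ℂ) (z : ℂ × ℂ) : ℂ × ℂ :=
  (z.2 * μ z.1, -(1 + (z.1 - p₀) * μ z.1))

theorem wedge_branchForm (p₀ : ℂ) (μ ν : ℂ → ℂ) (z : ℂ × ℂ) :
    wedge (branchForm p₀ μ z) (branchForm p₀ ν z) = z.2 * (ν z.1 - μ z.1) := by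
  simp only [wedge, branchForm]
  ring

theorem analyticAt_branchForm {p₀ : ℂ} {μ : ℂ → ℂ} {z : ℂ × ℂ} (hμ : AnalyticAt ℂ μ z.1) :
    AnalyticAt ℂ (branchForm p₀ μ) z := by
  have hμ' : AnalyticAt ℂ (fun w : ℂ × ℂ => μ w.1) z := hμ.comp analyticAt_fst
  exact (analyticAt_snd.mul hμ').prod
    (analyticAt_const.add ((analyticAt_fst.sub analyticAt_const).mul hμ')).neg

/-- The contribution of the branch `m i` to the `dq / q`-coefficient of the fundamental form of
the `3`-web of the branches `m i`, `m j`, `m k`. -/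
noncomputable def branchTerm (p₀ : ℂ) (m : ι → ℂ → ℂ) (i j k : ι) (p : ℂ) : ℂ :=
  deriv (m i) p * ((1 + (p - p₀) * m j p) / (m i p - m j p)) *
    ((1 + (p - p₀) * m k p) / (m i p - m k p))

/-- The contribution of the branch `m i` to the `dp`-coefficient of the fundamental form of the
`3`-web of the branches `m i`, `m j`, `m k`. -/
noncomputable def branchTermFst (p₀ : ℂ) (m : ι → ℂ → ℂ) (i j k : ι) (p : ℂ) : ℂ :=
  deriv (m i) p * (m i p + (p - p₀) * m j p * m k p) / ((m i p - m j p) * (m i p - m k p))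

/-- The sum of `branchTerm` over the cyclic permutations of `(i, j, k)`. -/
noncomputable def cycBranchTerm (p₀ : ℂ) (m : ι → ℂ → ℂ) (i j k : ι) (p : ℂ) : ℂ :=
  branchTerm p₀ m i j k p + branchTerm p₀ m j k i p + branchTerm p₀ m k i j p

/-- The fundamental form of the `3`-web of the branches `m i`, `m j`, `m k`. -/
noncomputable def branchFundamentalForm (p₀ : ℂ) (m : ι → ℂ → ℂ) (i j k : ι) (z : ℂ × ℂ) : ℂ × ℂ :=
  (branchTermFst p₀ m i j k z.1 + branchTermFst p₀ m j k i z.1 + branchTermFst p₀ m k i j z.1,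
    (3 - cycBranchTerm p₀ m i j k z.1) / z.2)

theorem branchFundamentalForm_rotate (p₀ : ℂ) (m : ι → ℂ → ℂ) (i j k : ι) :
    branchFundamentalForm p₀ m j k i = branchFundamentalForm p₀ m i j k := by
  funext z
  simp only [branchFundamentalForm, cycBranchTerm]
  ext <;> simp only <;> ring

variable {p₀ : ℂ}

theorem analyticAt_cycBranchTerm (h : SeparatedAt m p) (hij : i ≠ j) (hjk : j ≠ k) (hki : k ≠ i) :
    AnalyticAt ℂ (cycBranchTerm p₀ m i j k) p := by
  have hterm {i j k : ι} (hij : i ≠ j) (hik : i ≠ k) : AnalyticAt ℂ (branchTerm p₀ m i j k) p := by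
    have hi := h.analyticAt i
    have hj := h.analyticAt j
    have hk := h.analyticAt k
    have := hi.deriv
    have dij := h.sub_ne_zero hij
    have dik := h.sub_ne_zero hik
    unfold branchTerm
    fun_prop (disch := assumption)
  exact ((hterm hij hki.symm).add (hterm hjk hij.symm)).add (hterm hki hjk.symm)

theorem analyticAt_branchFundamentalForm {z : ℂ × ℂ} (h : SeparatedAt m z.1) (hz : z.2 ≠ 0)
    (hij : i ≠ j) (hjk : j ≠ k) (hki : k ≠ i) :
    AnalyticAt ℂ (branchFundamentalForm p₀ m i j k) z := by
  have hterm {i j k : ι} (hij : i ≠ j) (hik : i ≠ k) :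
      AnalyticAt ℂ (fun w : ℂ × ℂ => branchTermFst p₀ m i j k w.1) z := by
    have hi := h.analyticAt i
    have hj := h.analyticAt j
    have hk := h.analyticAt k
    have := hi.deriv
    have d := mul_ne_zero (h.sub_ne_zero hij) (h.sub_ne_zero hik)
    have : AnalyticAt ℂ (branchTermFst p₀ m i j k) z.1 := by
      unfold branchTermFst
      fun_prop (disch := assumption)
    exact this.comp analyticAt_fst
  have hcyc : AnalyticAt ℂ (fun w : ℂ × ℂ => cycBranchTerm p₀ m i j k w.1) z :=
    (analyticAt_cycBranchTerm h hij hjk hki).comp analyticAt_fst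
  exact (((hterm hij hki.symm).add (hterm hjk hij.symm)).add (hterm hki hjk.symm)).prod
    ((analyticAt_const.sub hcyc).div analyticAt_snd hz)

theorem extD_branchFundamentalForm {z : ℂ × ℂ} (h : SeparatedAt m z.1) (hz : z.2 ≠ 0)
    (hij : i ≠ j) (hjk : j ≠ k) (hki : k ≠ i) :
    extD (branchFundamentalForm p₀ m i j k) z = -(deriv (cycBranchTerm p₀ m i j k) z.1 / z.2) := by
  have hη := (analyticAt_branchFundamentalForm (p₀ := p₀) h hz hij hjk hki).differentiableAt
  unfold extD
  rw [fderiv_apply_one_zero hη.snd, fderiv_apply_zero_one hη.fst]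
  simp only [branchFundamentalForm, deriv_const, sub_zero, deriv_div_const, deriv_const_sub,
    neg_div]

theorem extD_wedge_smul_branchForm {f g h : ℂ → ℂ} {z : ℂ × ℂ} (hf : DifferentiableAt ℂ f z.1)
    (hg : DifferentiableAt ℂ g z.1) (hh : DifferentiableAt ℂ h z.1) :
    extD (fun w => wedge (branchForm p₀ g w) (branchForm p₀ h w) • branchForm p₀ f w) z =
      z.2 * ((deriv h z.1 - deriv g z.1) * -(1 + (z.1 - p₀) * f z.1) +
        (h z.1 - g z.1) * -(f z.1 + (z.1 - p₀) * deriv f z.1)) -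
      2 * z.2 * (h z.1 - g z.1) * f z.1 := by
  have comp_fst {u : ℂ → ℂ} (hu : DifferentiableAt ℂ u z.1) :
      DifferentiableAt ℂ (fun w : ℂ × ℂ => u w.1) z := hu.comp z differentiableAt_fst
  have := comp_fst hf
  have := comp_fst hg
  have := comp_fst hh
  simp only [extD, wedge_branchForm]
  simp only [branchForm, Prod.smul_mk, smul_eq_mul]
  rw [fderiv_apply_one_zero (by fun_prop), fderiv_apply_zero_one (by fun_prop)]
  have hp := ((hh.hasDerivAt.sub hg.hasDerivAt).const_mul z.2).mul
    ((((hasDerivAt_id z.1).sub_const p₀).mul hf.hasDerivAt).const_add 1).neg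
  have hq := ((hasDerivAt_id z.2).mul_const (h z.1 - g z.1)).mul
    ((hasDerivAt_id z.2).mul_const (f z.1))
  refine congrArg₂ (· - ·) (hp.congr_deriv ?_).deriv (hq.congr_deriv ?_).deriv <;>
  · simp only [Pi.sub_apply, Pi.mul_apply, Pi.neg_apply, id_eq]
    ring

theorem isFundamentalForm3_branchForm {V : Set (ℂ × ℂ)} (h : ∀ z ∈ V, SeparatedAt m z.1)
    (hV : ∀ z ∈ V, z.2 ≠ 0) (hij : i ≠ j) (hjk : j ≠ k) (hki : k ≠ i) :
    IsFundamentalForm3 V (branchForm p₀ (m i)) (branchForm p₀ (m j)) (branchForm p₀ (m k))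
      (branchFundamentalForm p₀ m i j k) := by
  have hextD {i j k : ι} {z : ℂ × ℂ} (hz : z ∈ V) (hij : i ≠ j) (hjk : j ≠ k) (hki : k ≠ i) :
      extD (fun w => wedge (branchForm p₀ (m j) w) (branchForm p₀ (m k) w) •
          branchForm p₀ (m i) w) z =
        wedge (branchFundamentalForm p₀ m i j k z)
          (wedge (branchForm p₀ (m j) z) (branchForm p₀ (m k) z) • branchForm p₀ (m i) z) := by
    have hm l := ((h z hz).analyticAt l).differentiableAt
    rw [extD_wedge_smul_branchForm (hm i) (hm j) (hm k), wedge_branchForm]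
    have d₁ := (h z hz).sub_ne_zero hij
    have d₂ := (h z hz).sub_ne_zero hjk
    have d₃ := (h z hz).sub_ne_zero hki
    have hq := hV z hz
    simp only [branchFundamentalForm, cycBranchTerm, branchTerm, branchTermFst, wedge, branchForm,
      Prod.smul_mk, smul_eq_mul]
    rw [← neg_sub (m k z.1) (m i z.1), ← neg_sub (m i z.1) (m j z.1),
      ← neg_sub (m j z.1) (m k z.1)]
    generalize deriv (m i) z.1 = f', deriv (m j) z.1 = g', deriv (m k) z.1 = h', z.1 - p₀ = π,
      m i z.1 = f, m j z.1 = g, m k z.1 = h, z.2 = q at *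
    field_simp
    ring
  intro z hz
  refine ⟨hextD hz hij hjk hki, ?_, ?_⟩
  · rw [← branchFundamentalForm_rotate]
    exact hextD hz hjk hki hij
  · rw [← branchFundamentalForm_rotate, ← branchFundamentalForm_rotate]
    exact hextD hz hki hij hjk

end Branches

section BranchWebs

/-- The triples `(r, s, t)` with `r < s < t`, which index the `3`-subwebs of a `d`-web. -/
def increasingTriples (d : ℕ) : Finset (Fin d × Fin d × Fin d) :=
  {x | x.1 < x.2.1 ∧ x.2.1 < x.2.2}

theorem mem_increasingTriples {d : ℕ} {x : Fin d × Fin d × Fin d} :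
    x ∈ increasingTriples d ↔ x.1 < x.2.1 ∧ x.2.1 < x.2.2 := by
  simp [increasingTriples]

theorem sum_increasing_eq {d : ℕ} {M : Type*} [AddCommMonoid M] (F : Fin d → Fin d → Fin d → M) :
    (∑ r, ∑ s, ∑ t, if r < s ∧ s < t then F r s t else 0) =
      ∑ x ∈ increasingTriples d, F x.1 x.2.1 x.2.2 := by
  simp only [increasingTriples, Finset.sum_filter, Fintype.sum_prod_type]

/-- The sum of the `dq / q`-coefficients of the fundamental forms of the `3`-subwebs, up to sign
and an additive constant. -/
noncomputable def totalBranchTerm {d : ℕ} (p₀ : ℂ) (m : Fin d → ℂ → ℂ) (p : ℂ) : ℂ :=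
  ∑ x ∈ increasingTriples d, cycBranchTerm p₀ m x.1 x.2.1 x.2.2 p

/-- At `z`, the functions `ρ i` are holomorphic and nonzero, and the forms
`ρ i • branchForm p₀ (m i)` define pairwise transverse foliations. -/
structure IsBranchWebAt {d : ℕ} (m : Fin d → ℂ → ℂ) (ρ : Fin d → ℂ × ℂ → ℂ) (z : ℂ × ℂ) :
    Prop where
  separatedAt : SeparatedAt m z.1
  snd_ne_zero : z.2 ≠ 0
  analyticAt : ∀ i, AnalyticAt ℂ (ρ i) z
  ne_zero : ∀ i, ρ i z ≠ 0

/-- The fundamental form of the `3`-web of the forms `ρ l • branchForm p₀ (m l)`, `l = i, j, k`. -/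
noncomputable def scaledFundamentalForm {d : ℕ} (p₀ : ℂ) (m : Fin d → ℂ → ℂ)
    (ρ : Fin d → ℂ × ℂ → ℂ) (i j k : Fin d) (z : ℂ × ℂ) : ℂ × ℂ :=
  branchFundamentalForm p₀ m i j k z + dlog (fun w => ρ i w * ρ j w * ρ k w) z

variable {d : ℕ} {p₀ : ℂ} {m : Fin d → ℂ → ℂ} {ρ : Fin d → ℂ × ℂ → ℂ} {z : ℂ × ℂ} {i j k : Fin d}

theorem analyticAt_totalBranchTerm {p : ℂ} (h : SeparatedAt m p) :
    AnalyticAt ℂ (totalBranchTerm p₀ m) p := by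
  refine Finset.analyticAt_fun_sum _ fun x hx => ?_
  obtain ⟨hrs, hst⟩ := mem_increasingTriples.1 hx
  exact analyticAt_cycBranchTerm h hrs.ne hst.ne (hrs.trans hst).ne'

theorem deriv_totalBranchTerm {p : ℂ} (h : SeparatedAt m p) :
    deriv (totalBranchTerm p₀ m) p =
      ∑ x ∈ increasingTriples d, deriv (cycBranchTerm p₀ m x.1 x.2.1 x.2.2) p := by
  refine deriv_fun_sum fun x hx => ?_
  obtain ⟨hrs, hst⟩ := mem_increasingTriples.1 hx
  exact (analyticAt_cycBranchTerm h hrs.ne hst.ne (hrs.trans hst).ne').differentiableAt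

namespace IsBranchWebAt

theorem eventually (h : IsBranchWebAt m ρ z) : ∀ᶠ w in 𝓝 z, IsBranchWebAt m ρ w := by
  filter_upwards [continuous_fst.continuousAt.eventually h.separatedAt.eventually,
    continuous_snd.continuousAt.eventually_ne h.snd_ne_zero,
    eventually_all.2 fun i => (h.analyticAt i).eventually_analyticAt,
    eventually_all.2 fun i => (h.analyticAt i).continuousAt.eventually_ne (h.ne_zero i)]
    with w hm hw hρ hρ0
  exact ⟨hm, hw, hρ, hρ0⟩

theorem wedge_ne_zero (h : IsBranchWebAt m ρ z) (hij : i ≠ j) :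
    wedge (ρ i z • branchForm p₀ (m i) z) (ρ j z • branchForm p₀ (m j) z) ≠ 0 := by
  rw [wedge_smul_left, wedge_smul_right, wedge_branchForm]
  exact mul_ne_zero (h.ne_zero i) (mul_ne_zero (h.ne_zero j)
    (mul_ne_zero h.snd_ne_zero (h.separatedAt.sub_ne_zero hij.symm)))

theorem analyticAt_smul (h : IsBranchWebAt m ρ z) (i : Fin d) :
    AnalyticAt ℂ (fun w => ρ i w • branchForm p₀ (m i) w) z :=
  (h.analyticAt i).smul (analyticAt_branchForm (h.separatedAt.analyticAt i))

theorem analyticAt_mul_mul (h : IsBranchWebAt m ρ z) (i j k : Fin d) :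
    AnalyticAt ℂ (fun w => ρ i w * ρ j w * ρ k w) z :=
  ((h.analyticAt i).mul (h.analyticAt j)).mul (h.analyticAt k)

theorem mul_mul_ne_zero (h : IsBranchWebAt m ρ z) (i j k : Fin d) : ρ i z * ρ j z * ρ k z ≠ 0 :=
  mul_ne_zero (mul_ne_zero (h.ne_zero i) (h.ne_zero j)) (h.ne_zero k)

theorem analyticAt_scaledFundamentalForm (h : IsBranchWebAt m ρ z) (hij : i ≠ j) (hjk : j ≠ k)
    (hki : k ≠ i) : AnalyticAt ℂ (scaledFundamentalForm p₀ m ρ i j k) z :=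
  (analyticAt_branchFundamentalForm h.separatedAt h.snd_ne_zero hij hjk hki).add
    (analyticAt_dlog (h.analyticAt_mul_mul i j k) (h.mul_mul_ne_zero i j k))

theorem isFundamentalForm3 {V : Set (ℂ × ℂ)} (h : ∀ z ∈ V, IsBranchWebAt m ρ z) (hij : i ≠ j)
    (hjk : j ≠ k) (hki : k ≠ i) :
    IsFundamentalForm3 V (fun w => ρ i w • branchForm p₀ (m i) w)
      (fun w => ρ j w • branchForm p₀ (m j) w) (fun w => ρ k w • branchForm p₀ (m k) w)
      (scaledFundamentalForm p₀ m ρ i j k) := by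
  have hbranch (l : Fin d) : ∀ z ∈ V, DifferentiableAt ℂ (branchForm p₀ (m l)) z := fun z hz =>
    (analyticAt_branchForm ((h z hz).separatedAt.analyticAt l)).differentiableAt
  exact (isFundamentalForm3_branchForm (fun z hz => (h z hz).separatedAt)
    (fun z hz => (h z hz).snd_ne_zero) hij hjk hki).smul (hbranch i) (hbranch j) (hbranch k)
    (fun z hz => ((h z hz).analyticAt_mul_mul i j k).differentiableAt)
    fun z hz => (h z hz).mul_mul_ne_zero i j k

theorem extD_scaledFundamentalForm (h : IsBranchWebAt m ρ z) (hij : i ≠ j) (hjk : j ≠ k)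
    (hki : k ≠ i) :
    extD (scaledFundamentalForm p₀ m ρ i j k) z = -(deriv (cycBranchTerm p₀ m i j k) z.1 / z.2) :=
  have hR := h.analyticAt_mul_mul i j k
  have hR0 := h.mul_mul_ne_zero i j k
  calc extD (scaledFundamentalForm p₀ m ρ i j k) z
      = extD (branchFundamentalForm p₀ m i j k) z + extD (dlog fun w => ρ i w * ρ j w * ρ k w) z :=
        extD_add (analyticAt_branchFundamentalForm h.separatedAt h.snd_ne_zero hij hjk
          hki).differentiableAt (analyticAt_dlog hR hR0).differentiableAt
    _ = -(deriv (cycBranchTerm p₀ m i j k) z.1 / z.2) := by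
        rw [extD_dlog hR hR0, add_zero,
          extD_branchFundamentalForm h.separatedAt h.snd_ne_zero hij hjk hki]

theorem extD_sum_scaledFundamentalForm (h : IsBranchWebAt m ρ z) :
    extD (fun w => ∑ x ∈ increasingTriples d, scaledFundamentalForm p₀ m ρ x.1 x.2.1 x.2.2 w) z =
      -(deriv (totalBranchTerm p₀ m) z.1 / z.2) := by
  have hne {x} (hx : x ∈ increasingTriples d) : x.1 ≠ x.2.1 ∧ x.2.1 ≠ x.2.2 ∧ x.2.2 ≠ x.1 :=
    have ⟨hrs, hst⟩ := mem_increasingTriples.1 hx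
    ⟨hrs.ne, hst.ne, (hrs.trans hst).ne'⟩
  rw [extD_sum _ fun x hx => (h.analyticAt_scaledFundamentalForm (hne hx).1 (hne hx).2.1
    (hne hx).2.2).differentiableAt, deriv_totalBranchTerm h.separatedAt, Finset.sum_div,
    ← Finset.sum_neg_distrib]
  exact Finset.sum_congr rfl fun x hx =>
    h.extD_scaledFundamentalForm (hne hx).1 (hne hx).2.1 (hne hx).2.2

theorem hasCurvatureNear {W : ℂ × ℂ → ℂ × ℂ → ℂ} {g : ℂ × ℂ → ℂ} {V : Set (ℂ × ℂ)}
    (hV : IsOpen V) (h : ∀ z ∈ V, IsBranchWebAt m ρ z)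
    (hW : ∀ z ∈ V, ∀ ξ : ℂ × ℂ, W z ξ = ∏ i, ((ρ i z • branchForm p₀ (m i) z).1 * ξ.1 +
      (ρ i z • branchForm p₀ (m i) z).2 * ξ.2))
    (hg : ∀ z ∈ V, g z = -(deriv (totalBranchTerm p₀ m) z.1 / z.2)) (hz : z ∈ V) :
    HasCurvatureNear d W g z := by
  refine ⟨V, fun i z => ρ i z • branchForm p₀ (m i) z, scaledFundamentalForm p₀ m ρ, hV, hz,
    fun i z hz => (h z hz).analyticAt_smul i,
    fun z hz => ⟨fun i j hij => (h z hz).wedge_ne_zero hij, hW z hz⟩, fun r s t hrs hst =>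
      ⟨fun z hz => (h z hz).analyticAt_scaledFundamentalForm hrs.ne hst.ne (hrs.trans hst).ne',
        isFundamentalForm3 h hrs.ne hst.ne (hrs.trans hst).ne'⟩, fun z hz => ?_⟩
  simp only [sum_increasing_eq]
  rw [hg z hz, (h z hz).extD_sum_scaledFundamentalForm]

theorem extD_sum_fundamentalForm {V : Set (ℂ × ℂ)} (hV : IsOpen V) {ω : Fin d → ℂ × ℂ → ℂ × ℂ}
    {η : Fin d → Fin d → Fin d → ℂ × ℂ → ℂ × ℂ}
    (hη : ∀ r s t, r < s → s < t → IsFundamentalForm3 V (ω r) (ω s) (ω t) (η r s t)) (hz : z ∈ V)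
    (h : IsBranchWebAt m ρ z) (hω : ∀ i, ω i =ᶠ[𝓝 z] fun w => ρ i w • branchForm p₀ (m i) w) :
    extD (fun w => ∑ r, ∑ s, ∑ t, if r < s ∧ s < t then η r s t w else 0) z =
      -(deriv (totalBranchTerm p₀ m) z.1 / z.2) := by
  rw [← h.extD_sum_scaledFundamentalForm]
  refine extD_congr ?_
  filter_upwards [hV.eventually_mem hz, h.eventually,
    eventually_all.2 fun i => (hω i).eventuallyEq_nhds] with w hwV hw hωw
  rw [sum_increasing_eq fun r s t => η r s t w]
  refine Finset.sum_congr rfl fun x hx => ?_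
  obtain ⟨hrs, hst⟩ := mem_increasingTriples.1 hx
  have horig : IsFundamentalForm3 {w} (ω x.1) (ω x.2.1) (ω x.2.2) (η x.1 x.2.1 x.2.2) := by
    rintro _ rfl
    exact hη _ _ _ hrs hst _ hwV
  have hscaled := (isFundamentalForm3 (p₀ := p₀) (V := {w})
    (by rintro _ rfl; exact hw) hrs.ne hst.ne
    (hrs.trans hst).ne').congr (ω₁' := ω x.1) (ω₂' := ω x.2.1) (ω₃' := ω x.2.2)
    (by simpa using hωw _) (by simpa using hωw _) (by simpa using hωw _)
  have hwedge {i j : Fin d} (hij : i ≠ j) : wedge (ω i w) (ω j w) ≠ 0 := by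
    rw [(hωw i).self_of_nhds, (hωw j).self_of_nhds]
    exact hw.wedge_ne_zero hij
  exact horig.unique hscaled (Set.mem_singleton w) (hwedge hrs.ne) (hwedge hst.ne)
    (hwedge (hrs.trans hst).ne')

end IsBranchWebAt

end BranchWebs

/-! ### Pencils of polynomials -/

section TripleSums

theorem sum_distinct_eq_sum_increasingTriples {M : Type*} [AddCommMonoid M] {d : ℕ}
    (f : Fin d → Fin d → Fin d → M) :
    (∑ i, ∑ j, ∑ k, if i ≠ j ∧ i ≠ k ∧ j ≠ k then f i j k else 0) =
      ∑ x ∈ increasingTriples d, (f x.1 x.2.1 x.2.2 + f x.1 x.2.2 x.2.1 + f x.2.1 x.1 x.2.2 +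
        f x.2.1 x.2.2 x.1 + f x.2.2 x.1 x.2.1 + f x.2.2 x.2.1 x.1) := by
  have swap₁₂ (g : Fin d → Fin d → Fin d → M) : ∑ i, ∑ j, ∑ k, g i j k = ∑ i, ∑ j, ∑ k, g j i k :=
    Finset.sum_comm
  have swap₂₃ (g : Fin d → Fin d → Fin d → M) : ∑ i, ∑ j, ∑ k, g i j k = ∑ i, ∑ j, ∑ k, g i k j :=
    Finset.sum_congr rfl fun _ _ => Finset.sum_comm
  let I (i j k : Fin d) (x : M) : M := if i < j ∧ j < k then x else 0
  have hsplit (i j k : Fin d) : (if i ≠ j ∧ i ≠ k ∧ j ≠ k then f i j k else 0) =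
      I i j k (f i j k) + I i k j (f i j k) + I j i k (f i j k) + I k i j (f i j k) +
        I j k i (f i j k) + I k j i (f i j k) := by
    simp only [I]
    grind
  have hsum (g : Fin d → Fin d → Fin d → M) :
      ∑ i, ∑ j, ∑ k, I i j k (g i j k) = ∑ x ∈ increasingTriples d, g x.1 x.2.1 x.2.2 :=
    sum_increasing_eq g
  have h132 := (swap₂₃ fun i j k => I i k j (f i j k)).trans (hsum fun i j k => f i k j)
  have h213 := (swap₁₂ fun i j k => I j i k (f i j k)).trans (hsum fun i j k => f j i k)
  have h231 := (swap₂₃ fun i j k => I k i j (f i j k)).trans <|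
    (swap₁₂ fun i j k => I j i k (f i k j)).trans (hsum fun i j k => f j k i)
  have h312 := (swap₁₂ fun i j k => I j k i (f i j k)).trans <|
    (swap₂₃ fun i j k => I i k j (f j i k)).trans (hsum fun i j k => f k i j)
  have h321 := (swap₁₂ fun i j k => I k j i (f i j k)).trans <|
    (swap₂₃ fun i j k => I k i j (f j i k)).trans <|
      (swap₁₂ fun i j k => I j i k (f k i j)).trans (hsum fun i j k => f k j i)
  simp only [hsplit, Finset.sum_add_distrib, hsum f, h132, h213, h231, h312, h321]

theorem sum_distinct_eq_two_mul_sum_cyc {R : Type*} [CommRing R] {d : ℕ}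
    {f : Fin d → Fin d → Fin d → R} (hf : ∀ i j k, f i j k = f i k j) :
    (∑ i, ∑ j, ∑ k, if i ≠ j ∧ i ≠ k ∧ j ≠ k then f i j k else 0) =
      2 * ∑ x ∈ increasingTriples d,
        (f x.1 x.2.1 x.2.2 + f x.2.1 x.2.2 x.1 + f x.2.2 x.1 x.2.1) := by
  rw [sum_distinct_eq_sum_increasingTriples, Finset.mul_sum]
  refine Finset.sum_congr rfl fun ⟨r, s, t⟩ _ => ?_
  simp only
  rw [hf r t s, hf s r t, hf t s r]
  ring

theorem sum_sum_ite_ne_mul {ι R : Type*} [Fintype ι] [DecidableEq ι] [CommRing R] {i : ι}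
    {x : ι → R} (hx : x i = 0) :
    (∑ j, ∑ k, if i ≠ j ∧ i ≠ k ∧ j ≠ k then x j * x k else 0) =
      (∑ j, x j) ^ 2 - ∑ j, x j ^ 2 := by
  have h (j k : ι) : (if i ≠ j ∧ i ≠ k ∧ j ≠ k then x j * x k else 0) =
      x j * x k - if j = k then x j ^ 2 else 0 := by
    grind
  simp only [h, Finset.sum_sub_distrib, ← Finset.mul_sum, ← Finset.sum_mul, ← sq,
    Finset.sum_ite_eq, Finset.mem_univ, if_true]

end TripleSums

section SimpleRoots

variable {K : Type*} [Field K]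

theorem eval_derivative_prod_X_sub_C {ι : Type*} (s : Finset ι) (r : ι → K) {x : K}
    (hx : ∀ j ∈ s, x - r j ≠ 0) :
    (derivative (∏ j ∈ s, (Polynomial.X - Polynomial.C (r j)))).eval x =
      (∏ j ∈ s, (x - r j)) * ∑ j ∈ s, (x - r j)⁻¹ := by
  classical
  rw [Polynomial.derivative_prod_finset, Polynomial.eval_finsetSum, Finset.mul_sum]
  refine Finset.sum_congr rfl fun j hj => ?_
  rw [← Finset.mul_prod_erase s _ hj]
  have := hx j hj
  simp only [Polynomial.derivative_sub, Polynomial.derivative_X, Polynomial.derivative_C, sub_zero,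
    mul_one, Polynomial.eval_prod, Polynomial.eval_sub, Polynomial.eval_X, Polynomial.eval_C]
  field_simp

theorem eval_derivative_derivative_prod_X_sub_C {ι : Type*} (s : Finset ι) (r : ι → K) {x : K}
    (hx : ∀ j ∈ s, x - r j ≠ 0) :
    (derivative (derivative (∏ j ∈ s, (Polynomial.X - Polynomial.C (r j))))).eval x =
      (∏ j ∈ s, (x - r j)) * ((∑ j ∈ s, (x - r j)⁻¹) ^ 2 - ∑ j ∈ s, (x - r j)⁻¹ ^ 2) := by
  classical
  induction s using Finset.induction_on with
  | empty => simp
  | insert a s ha ih =>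
    have hxs : ∀ j ∈ s, x - r j ≠ 0 := fun j hj => hx j (Finset.mem_insert_of_mem hj)
    have hxa := hx a (Finset.mem_insert_self _ _)
    rw [Finset.prod_insert ha, Finset.prod_insert ha, Finset.sum_insert ha, Finset.sum_insert ha]
    simp only [Polynomial.derivative_mul, Polynomial.derivative_add, Polynomial.derivative_sub,
      Polynomial.derivative_X, Polynomial.derivative_C, Polynomial.derivative_one,
      Polynomial.eval_add, Polynomial.eval_mul, Polynomial.eval_sub, Polynomial.eval_X,
      Polynomial.eval_C, Polynomial.eval_one, Polynomial.eval_zero, sub_zero,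
      eval_derivative_prod_X_sub_C s r hxs, ih hxs]
    field_simp
    ring

/-- The polynomial `φ` has degree `d` and its roots are the `d` distinct numbers `r i`. -/
structure HasDistinctRoots {d : ℕ} (φ : K[X]) (r : Fin d → K) : Prop where
  coeff_ne_zero : φ.coeff d ≠ 0
  injective : Function.Injective r
  eq_prod : φ = Polynomial.C (φ.coeff d) * ∏ i, (Polynomial.X - Polynomial.C (r i))

namespace HasDistinctRoots

variable {d : ℕ} {φ : K[X]} {r : Fin d → K}

theorem of_eval_eq_zero (hd : φ.natDegree ≤ d) (hc : φ.coeff d ≠ 0) (hr : Function.Injective r)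
    (h0 : ∀ i, φ.eval (r i) = 0) : HasDistinctRoots φ r := by
  have hn : φ.natDegree = d := le_antisymm hd (Polynomial.le_natDegree_of_ne_zero hc)
  have hφ : φ ≠ 0 := fun h => hc (by rw [h, Polynomial.coeff_zero])
  have hle : Finset.univ.val.map r ≤ φ.roots := by
    refine (Multiset.le_iff_subset (Finset.univ.nodup.map hr)).2 fun x hx => ?_
    obtain ⟨i, -, rfl⟩ := Multiset.mem_map.1 hx
    exact (Polynomial.mem_roots hφ).2 (h0 i)
  have hroots : φ.roots = Finset.univ.val.map r :=
    (Multiset.eq_of_le_of_card_le hle (by simpa [← hn] using φ.card_roots')).symm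
  refine ⟨hc, hr, ?_⟩
  conv_lhs => rw [← Polynomial.C_leadingCoeff_mul_prod_multiset_X_sub_C (p := φ)
    (by simp [hroots, hn]), hroots, Multiset.map_map, Polynomial.leadingCoeff, hn]
  rfl

theorem roots_eq (h : HasDistinctRoots φ r) : φ.roots = Finset.univ.val.map r := by
  rw [h.eq_prod, Polynomial.roots_C_mul _ h.coeff_ne_zero, Polynomial.roots_prod _ _
    (Finset.prod_ne_zero_iff.2 fun i _ => Polynomial.X_sub_C_ne_zero _)]
  simp [Multiset.bind_singleton]

theorem eval_eq_zero (h : HasDistinctRoots φ r) (i : Fin d) : φ.eval (r i) = 0 := by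
  rw [h.eq_prod, Polynomial.eval_mul, Polynomial.eval_prod,
    Finset.prod_eq_zero (Finset.mem_univ i) (by simp), mul_zero]

theorem sub_ne_zero (h : HasDistinctRoots φ r) (i : Fin d) :
    ∀ j ∈ Finset.univ.erase i, r i - r j ≠ 0 := fun _ hj =>
  _root_.sub_ne_zero.2 (h.injective.ne (Finset.ne_of_mem_erase hj).symm)

theorem eval_derivative (h : HasDistinctRoots φ r) (i : Fin d) :
    (derivative φ).eval (r i) = φ.coeff d * ∏ j ∈ Finset.univ.erase i, (r i - r j) := by
  conv_lhs => rw [h.eq_prod, ← Finset.mul_prod_erase _ _ (Finset.mem_univ i)]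
  simp [Polynomial.eval_prod]

theorem eval_derivative_ne_zero (h : HasDistinctRoots φ r) (i : Fin d) :
    (derivative φ).eval (r i) ≠ 0 := by
  rw [h.eval_derivative]
  exact mul_ne_zero h.coeff_ne_zero (Finset.prod_ne_zero_iff.2 (h.sub_ne_zero i))

theorem eval_derivative_derivative (h : HasDistinctRoots φ r) (i : Fin d) :
    (derivative (derivative φ)).eval (r i) =
      2 * (derivative φ).eval (r i) * ∑ j ∈ Finset.univ.erase i, (r i - r j)⁻¹ := by
  rw [h.eval_derivative]
  conv_lhs => rw [h.eq_prod, ← Finset.mul_prod_erase _ _ (Finset.mem_univ i)]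
  simp only [Polynomial.derivative_mul, Polynomial.derivative_add, Polynomial.derivative_sub,
    Polynomial.derivative_X, Polynomial.derivative_C, Polynomial.derivative_one,
    Polynomial.derivative_zero, Polynomial.eval_add, Polynomial.eval_mul, Polynomial.eval_sub,
    Polynomial.eval_X, Polynomial.eval_C, Polynomial.eval_one, Polynomial.eval_zero, sub_zero,
    sub_self, zero_mul, eval_derivative_prod_X_sub_C _ r (h.sub_ne_zero i)]
  ring

theorem eval_derivative_derivative_derivative (h : HasDistinctRoots φ r) (i : Fin d) :
    (derivative (derivative (derivative φ))).eval (r i) =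
      3 * (derivative φ).eval (r i) * ((∑ j ∈ Finset.univ.erase i, (r i - r j)⁻¹) ^ 2 -
        ∑ j ∈ Finset.univ.erase i, (r i - r j)⁻¹ ^ 2) := by
  rw [h.eval_derivative]
  conv_lhs => rw [h.eq_prod, ← Finset.mul_prod_erase _ _ (Finset.mem_univ i)]
  simp only [Polynomial.derivative_mul, Polynomial.derivative_add, Polynomial.derivative_sub,
    Polynomial.derivative_X, Polynomial.derivative_C, Polynomial.derivative_one,
    Polynomial.derivative_zero, Polynomial.eval_add, Polynomial.eval_mul, Polynomial.eval_sub,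
    Polynomial.eval_X, Polynomial.eval_C, Polynomial.eval_one, Polynomial.eval_zero, sub_zero,
    sub_self, zero_mul, eval_derivative_derivative_prod_X_sub_C _ r (h.sub_ne_zero i)]
  ring

end HasDistinctRoots

theorem exists_hasDistinctRoots [IsAlgClosed K] {d : ℕ} {φ : K[X]} (hd : φ.natDegree ≤ d)
    (hc : φ.coeff d ≠ 0) (hs : ∀ μ, φ.eval μ = 0 → (derivative φ).eval μ ≠ 0) :
    ∃ r : Fin d → K, HasDistinctRoots φ r := by
  classical
  have hn : φ.natDegree = d := le_antisymm hd (Polynomial.le_natDegree_of_ne_zero hc)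
  have hφ : φ ≠ 0 := fun h => hc (by rw [h, Polynomial.coeff_zero])
  have hnodup : φ.roots.Nodup := by
    refine Multiset.nodup_iff_count_le_one.2 fun a => ?_
    rw [Polynomial.count_roots]
    by_contra! h
    obtain ⟨h0, h1⟩ := (Polynomial.one_lt_rootMultiplicity_iff_isRoot hφ).1 h
    exact hs a h0 h1
  have hcard : φ.roots.toFinset.card = d := by
    rw [Multiset.toFinset_card_of_nodup hnodup, ← hn]
    exact (IsAlgClosed.splits φ).natDegree_eq_card_roots.symm
  let e := (φ.roots.toFinset.equivFinOfCardEq hcard).symm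
  refine ⟨fun i => e i, .of_eval_eq_zero hd hc (Subtype.val_injective.comp e.injective) fun i => ?_⟩
  exact (Polynomial.mem_roots hφ).1 (Multiset.mem_toFinset.1 (e i).2)

end SimpleRoots

section Pencils

/-- The members `F + π b` of a pencil of polynomials. -/
noncomputable def pencil (F b : ℂ[X]) (π : ℂ) : ℂ[X] := F + Polynomial.C π * b

/-- `F` and `b` are polynomials of degree at most `d` without common root, so that the pencil
`F + π b` has no base point on the affine line. -/
structure IsPencil (d : ℕ) (F b : ℂ[X]) : Prop where
  natDegree_left_le : F.natDegree ≤ d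
  natDegree_right_le : b.natDegree ≤ d
  eval_right_ne_zero : ∀ μ, F.eval μ = 0 → b.eval μ ≠ 0

/-- The contribution of the root `μ` of `F + π b` to the curvature. -/
noncomputable def pencilTerm (d : ℕ) (F b : ℂ[X]) (π μ : ℂ) : ℂ :=
  b.eval μ / (2 * (derivative (pencil F b π)).eval μ) *
    ((1 + π * μ) ^ 2 * ((derivative (derivative (derivative (pencil F b π)))).eval μ /
        (3 * (derivative (pencil F b π)).eval μ))
      - (d - 2) * π * (1 + π * μ) * ((derivative (derivative (pencil F b π))).eval μ /
        (derivative (pencil F b π)).eval μ)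
      + (d - 1) * (d - 2) * π ^ 2)

/-- The sum of the contributions of the roots of `F + π b` to the curvature. -/
noncomputable def pencilSum (d : ℕ) (F b : ℂ[X]) (π : ℂ) : ℂ :=
  ((pencil F b π).roots.map (pencilTerm d F b π)).sum

variable {d : ℕ} {F b : ℂ[X]} {π μ p p₀ : ℂ}

theorem eval_pencil (F b : ℂ[X]) (π μ : ℂ) : (pencil F b π).eval μ = F.eval μ + π * b.eval μ := by
  simp [pencil]

theorem coeff_pencil (F b : ℂ[X]) (π : ℂ) (n : ℕ) :
    (pencil F b π).coeff n = F.coeff n + π * b.coeff n := by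
  simp [pencil]

theorem IsPencil.natDegree_pencil_le (h : IsPencil d F b) (π : ℂ) :
    (pencil F b π).natDegree ≤ d :=
  Polynomial.natDegree_add_le_of_degree_le h.natDegree_left_le
    ((Polynomial.natDegree_C_mul_le _ _).trans h.natDegree_right_le)

theorem IsPencil.eval_right_ne_zero_of_eval_pencil (h : IsPencil d F b)
    (hμ : (pencil F b π).eval μ = 0) : b.eval μ ≠ 0 := fun hb => by
  rw [eval_pencil, hb, mul_zero, add_zero] at hμ
  exact h.eval_right_ne_zero μ hμ hb

theorem HasDistinctRoots.pencilSum_eq {r : Fin d → ℂ} (h : HasDistinctRoots (pencil F b π) r) :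
    pencilSum d F b π = ∑ i, pencilTerm d F b π (r i) := by
  rw [pencilSum, h.roots_eq, Multiset.map_map]
  rfl

section SlopeRatios

variable {m : Fin d → ℂ} {i : Fin d}

theorem card_univ_erase_cast (i : Fin d) : ((Finset.univ.erase i).card : ℂ) = d - 1 := by
  rw [Finset.card_erase_of_mem (Finset.mem_univ i), Finset.card_univ, Fintype.card_fin,
    Nat.cast_sub i.pos, Nat.cast_one]

theorem one_add_mul_div_sub (hm : Function.Injective m) {j : Fin d}
    (hj : j ∈ Finset.univ.erase i) :
    (1 + π * m j) / (m i - m j) = (1 + π * m i) * (m i - m j)⁻¹ - π := by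
  have := sub_ne_zero.2 (hm.ne (Finset.ne_of_mem_erase hj).symm)
  field_simp
  ring

theorem sum_one_add_mul_div_sub (hm : Function.Injective m) (i : Fin d) :
    ∑ j, (1 + π * m j) / (m i - m j) =
      (1 + π * m i) * (∑ j ∈ Finset.univ.erase i, (m i - m j)⁻¹) - (d - 1) * π := by
  rw [← Finset.add_sum_erase _ _ (Finset.mem_univ i), sub_self, div_zero, zero_add,
    Finset.sum_congr rfl fun j hj => one_add_mul_div_sub hm hj, Finset.sum_sub_distrib,
    ← Finset.mul_sum, Finset.sum_const, nsmul_eq_mul, card_univ_erase_cast]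

theorem sum_one_add_mul_div_sub_sq (hm : Function.Injective m) (i : Fin d) :
    ∑ j, ((1 + π * m j) / (m i - m j)) ^ 2 =
      (1 + π * m i) ^ 2 * (∑ j ∈ Finset.univ.erase i, (m i - m j)⁻¹ ^ 2) -
        2 * π * (1 + π * m i) * (∑ j ∈ Finset.univ.erase i, (m i - m j)⁻¹) + (d - 1) * π ^ 2 := by
  rw [← Finset.add_sum_erase _ _ (Finset.mem_univ i), sub_self, div_zero, zero_pow two_ne_zero,
    zero_add, Finset.sum_congr rfl fun j hj => by rw [one_add_mul_div_sub hm hj],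
    ← card_univ_erase_cast i, ← nsmul_eq_mul, ← Finset.sum_const, Finset.mul_sum, Finset.mul_sum,
    ← Finset.sum_sub_distrib, ← Finset.sum_add_distrib]
  exact Finset.sum_congr rfl fun j _ => by ring

end SlopeRatios

theorem sum_branchTerm_eq {m : Fin d → ℂ → ℂ}
    (h : HasDistinctRoots (pencil F b (p - p₀)) fun i => m i p) {i : Fin d}
    (hm : deriv (m i) p = -(b.eval (m i p) / (derivative (pencil F b (p - p₀))).eval (m i p))) :
    (∑ j, ∑ k, if i ≠ j ∧ i ≠ k ∧ j ≠ k then branchTerm p₀ m i j k p else 0) =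
      2 * -pencilTerm d F b (p - p₀) (m i p) := by
  set x : Fin d → ℂ := fun j => (1 + (p - p₀) * m j p) / (m i p - m j p) with hx
  have hterm (j k : Fin d) : (if i ≠ j ∧ i ≠ k ∧ j ≠ k then branchTerm p₀ m i j k p else 0) =
      deriv (m i) p * if i ≠ j ∧ i ≠ k ∧ j ≠ k then x j * x k else 0 := by
    rw [mul_ite, mul_zero, ← mul_assoc]
    rfl
  have hD := h.eval_derivative_ne_zero i
  simp only [hterm, ← Finset.mul_sum]
  rw [sum_sum_ite_ne_mul (by simp [hx]), sum_one_add_mul_div_sub h.injective i,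
    sum_one_add_mul_div_sub_sq h.injective i, hm, pencilTerm, h.eval_derivative_derivative i,
    h.eval_derivative_derivative_derivative i]
  field_simp
  ring

theorem totalBranchTerm_eq_neg_pencilSum {m : Fin d → ℂ → ℂ}
    (h : HasDistinctRoots (pencil F b (p - p₀)) fun i => m i p)
    (hm : ∀ i, deriv (m i) p =
      -(b.eval (m i p) / (derivative (pencil F b (p - p₀))).eval (m i p))) :
    totalBranchTerm p₀ m p = -pencilSum d F b (p - p₀) := by
  have hsymm (i j k : Fin d) : branchTerm p₀ m i j k p = branchTerm p₀ m i k j p := by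
    simp only [branchTerm]
    ring
  have hdouble : 2 * totalBranchTerm p₀ m p = 2 * -pencilSum d F b (p - p₀) := by
    simp only [totalBranchTerm, cycBranchTerm]
    rw [← sum_distinct_eq_two_mul_sum_cyc hsymm,
      Finset.sum_congr rfl fun i _ => sum_branchTerm_eq h (hm i), h.pencilSum_eq,
      ← Finset.mul_sum, Finset.sum_neg_distrib]
  exact mul_left_cancel₀ two_ne_zero hdouble

end Pencils

section RootBranches

/-- The parameters of the pencil `F + π b` for which the binary form of degree `d` with
dehomogenization `F + π b` has `d` distinct roots, none of them at infinity. -/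
structure IsRegularParam (d : ℕ) (F b : ℂ[X]) (π : ℂ) : Prop where
  coeff_ne_zero : (pencil F b π).coeff d ≠ 0
  eval_derivative_ne_zero :
    ∀ μ, (pencil F b π).eval μ = 0 → (derivative (pencil F b π)).eval μ ≠ 0

variable {d : ℕ} {F b : ℂ[X]} {p p₀ p₁ r : ℂ}

theorem IsRegularParam.exists_hasDistinctRoots {π : ℂ} (hreg : IsRegularParam d F b π)
    (h : IsPencil d F b) : ∃ r : Fin d → ℂ, HasDistinctRoots (pencil F b π) r :=
  PlanarWeb.exists_hasDistinctRoots (h.natDegree_pencil_le π) hreg.coeff_ne_zero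
    hreg.eval_derivative_ne_zero

theorem exists_analyticAt_local_inverse {G : ℂ → ℂ} (hG : AnalyticAt ℂ G r)
    (hG' : deriv G r ≠ 0) :
    ∃ m : ℂ → ℂ, AnalyticAt ℂ m (G r) ∧ m (G r) = r ∧ (∀ᶠ p in 𝓝 (G r), G (m p) = p) ∧
      ∀ᶠ μ in 𝓝 r, m (G μ) = μ :=
  ⟨hG.hasStrictDerivAt.localInverse _ _ _ hG', hG.analyticAt_localInverse hG',
    HasStrictFDerivAt.localInverse_apply_image ..,
    hG.hasStrictDerivAt.eventually_right_inverse hG',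
    hG.hasStrictDerivAt.eventually_left_inverse hG'⟩

theorem hasDerivAt_eval_pencil_comp {m' : ℂ} {m : ℂ → ℂ} (hm : HasDerivAt m m' p) :
    HasDerivAt (fun p => (pencil F b (p - p₀)).eval (m p))
      (b.eval (m p) + (derivative (pencil F b (p - p₀))).eval (m p) * m') p := by
  simp only [eval_pencil]
  refine (((F.hasDerivAt (m p)).comp p hm).add
    (((hasDerivAt_id p).sub_const p₀).mul ((b.hasDerivAt (m p)).comp p hm))).congr_deriv ?_
  simp only [pencil, Polynomial.derivative_add, Polynomial.derivative_C_mul, Polynomial.eval_add,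
    Polynomial.eval_mul, Polynomial.eval_C, Function.comp_apply, id_eq]
  ring

theorem deriv_root_branch {m : ℂ → ℂ} (hm : DifferentiableAt ℂ m p)
    (h0 : ∀ᶠ p in 𝓝 p, (pencil F b (p - p₀)).eval (m p) = 0)
    (hs : (derivative (pencil F b (p - p₀))).eval (m p) ≠ 0) :
    deriv m p = -(b.eval (m p) / (derivative (pencil F b (p - p₀))).eval (m p)) := by
  have hconst : (fun p => (pencil F b (p - p₀)).eval (m p)) =ᶠ[𝓝 p] fun _ => 0 := h0
  have hchain := hconst.deriv_eq ▸
    (hasDerivAt_eval_pencil_comp (F := F) (b := b) (p₀ := p₀) hm.hasDerivAt).deriv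
  rw [deriv_const] at hchain
  field_simp
  linear_combination -hchain

theorem eval_pencil_eq_zero_iff {π μ : ℂ} (hb : b.eval μ ≠ 0) :
    (pencil F b π).eval μ = 0 ↔ π = -(F.eval μ / b.eval μ) := by
  rw [eval_pencil, ← neg_div, eq_div_iff hb, add_comm, eq_neg_iff_add_eq_zero]

theorem eval_pencil_sub_eq_zero_iff {μ : ℂ} (hb : b.eval μ ≠ 0) :
    (pencil F b (p - p₀)).eval μ = 0 ↔ p₀ - F.eval μ / b.eval μ = p := by
  rw [eval_pencil_eq_zero_iff hb, sub_eq_iff_eq_add', ← sub_eq_add_neg, eq_comm]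

theorem deriv_sub_div_ne_zero (hb : b.eval r ≠ 0) (h0 : (pencil F b (p₁ - p₀)).eval r = 0)
    (hs : (derivative (pencil F b (p₁ - p₀))).eval r ≠ 0) :
    deriv (fun μ => p₀ - F.eval μ / b.eval μ) r ≠ 0 := by
  rw [(((F.hasDerivAt r).fun_div (b.hasDerivAt r) hb).const_sub p₀).deriv]
  simp only [eval_pencil] at h0
  simp only [pencil, Polynomial.derivative_add, Polynomial.derivative_C_mul, Polynomial.eval_add,
    Polynomial.eval_mul, Polynomial.eval_C] at hs
  rw [neg_ne_zero, div_ne_zero_iff]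
  refine ⟨fun h => hs (mul_right_cancel₀ hb ?_), pow_ne_zero 2 hb⟩
  linear_combination h + (derivative b).eval r * h0

theorem IsPencil.exists_root_branch (h : IsPencil d F b)
    (h0 : (pencil F b (p₁ - p₀)).eval r = 0)
    (hs : (derivative (pencil F b (p₁ - p₀))).eval r ≠ 0) :
    ∃ m : ℂ → ℂ, AnalyticAt ℂ m p₁ ∧ m p₁ = r ∧
      (∀ᶠ p in 𝓝 p₁, (pencil F b (p - p₀)).eval (m p) = 0) ∧
      ∀ᶠ w : ℂ × ℂ in 𝓝 (p₁, r), (pencil F b (w.1 - p₀)).eval w.2 = 0 → m w.1 = w.2 := by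
  have hb := h.eval_right_ne_zero_of_eval_pencil h0
  have hG : AnalyticAt ℂ (fun μ => p₀ - F.eval μ / b.eval μ) r :=
    analyticAt_const.sub ((AnalyticOnNhd.eval_polynomial F r (Set.mem_univ _)).div
      (AnalyticOnNhd.eval_polynomial b r (Set.mem_univ _)) hb)
  obtain ⟨m, hma, hmr, hright, hleft⟩ :=
    exists_analyticAt_local_inverse hG (deriv_sub_div_ne_zero hb h0 hs)
  simp only [(eval_pencil_sub_eq_zero_iff hb).1 h0] at hma hmr hright
  have hb' : ∀ᶠ μ in 𝓝 r, b.eval μ ≠ 0 := b.continuous.continuousAt.eventually_ne hb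
  refine ⟨m, hma, hmr, ?_, ?_⟩
  · filter_upwards [hright, hma.continuousAt.eventually (hmr.symm ▸ hb')] with p hp hbp
    exact (eval_pencil_sub_eq_zero_iff hbp).2 hp
  · have hsnd : Tendsto (Prod.snd : ℂ × ℂ → ℂ) (𝓝 (p₁, r)) (𝓝 r) := continuous_snd.continuousAt
    filter_upwards [hsnd.eventually hleft, hsnd.eventually hb'] with w hw hbw h0w
    rw [← (eval_pencil_sub_eq_zero_iff hbw).1 h0w]
    exact hw

theorem continuous_coeff_pencil (n : ℕ) (F b : ℂ[X]) (p₀ : ℂ) :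
    Continuous fun p => (pencil F b (p - p₀)).coeff n := by
  simp only [coeff_pencil]
  fun_prop

theorem IsPencil.exists_root_branches (h : IsPencil d F b) {r : Fin d → ℂ}
    (hr : HasDistinctRoots (pencil F b (p₁ - p₀)) r) :
    ∃ m : Fin d → ℂ → ℂ, (∀ i, m i p₁ = r i) ∧
      (∀ i, ∀ᶠ w : ℂ × ℂ in 𝓝 (p₁, r i), (pencil F b (w.1 - p₀)).eval w.2 = 0 → m i w.1 = w.2) ∧
      ∀ᶠ p in 𝓝 p₁, SeparatedAt m p ∧ HasDistinctRoots (pencil F b (p - p₀)) (fun i => m i p) ∧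
        totalBranchTerm p₀ m p = -pencilSum d F b (p - p₀) := by
  choose m hma hmr hm0 hmu using fun i =>
    h.exists_root_branch (hr.eval_eq_zero i) (hr.eval_derivative_ne_zero i)
  have hsep : SeparatedAt m p₁ := ⟨hma, by simpa only [hmr] using hr.injective⟩
  refine ⟨m, hmr, hmu, ?_⟩
  filter_upwards [hsep.eventually, (eventually_all.2 hm0).eventually_nhds,
    (continuous_coeff_pencil d F b p₀).continuousAt.eventually_ne hr.coeff_ne_zero] with p hp hp0 hc
  have hroots : HasDistinctRoots (pencil F b (p - p₀)) fun i => m i p :=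
    .of_eval_eq_zero (h.natDegree_pencil_le _) hc hp.injective hp0.self_of_nhds
  exact ⟨hp, hroots, totalBranchTerm_eq_neg_pencilSum hroots fun i =>
    deriv_root_branch (hp.analyticAt i).differentiableAt (hp0.mono fun _ h => h i)
      (hroots.eval_derivative_ne_zero i)⟩

end RootBranches

section PartialFractions

namespace HasDistinctRoots

variable {K : Type*} [Field K] {d : ℕ} {φ b : K[X]} {r : Fin d → K} {z : K}

theorem eq_C_mul_nodal (h : HasDistinctRoots φ r) :
    φ = Polynomial.C (φ.coeff d) * Lagrange.nodal Finset.univ r :=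
  h.eq_prod

theorem sum_div_derivative_of_degree_lt (h : HasDistinctRoots φ r) (hb : b.degree < d)
    (hz : φ.eval z ≠ 0) :
    ∑ i, b.eval (r i) / (derivative φ).eval (r i) * (z - r i)⁻¹ = b.eval z / φ.eval z := by
  have hzr : ∀ i ∈ Finset.univ, z ≠ r i := fun i _ hzi => hz (hzi ▸ h.eval_eq_zero i)
  have hinterp := congrArg (Polynomial.eval z)
    (Lagrange.eq_interpolate (s := Finset.univ) h.injective.injOn (f := b) (by simpa using hb))
  rw [Lagrange.eval_interpolate_not_at_node _ hzr] at hinterp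
  have hφz : φ.eval z = φ.coeff d * (Lagrange.nodal Finset.univ r).eval z := by
    conv_lhs => rw [h.eq_C_mul_nodal, Polynomial.eval_mul, Polynomial.eval_C]
  have hφ' (i : Fin d) : (derivative φ).eval (r i) =
      φ.coeff d * (derivative (Lagrange.nodal Finset.univ r)).eval (r i) := by
    conv_lhs => rw [h.eq_C_mul_nodal, Polynomial.derivative_C_mul, Polynomial.eval_mul,
      Polynomial.eval_C]
  rw [eq_div_iff hz, hinterp, hφz, mul_comm, mul_comm (φ.coeff d), mul_assoc, Finset.mul_sum]
  congr 1
  refine Finset.sum_congr rfl fun i _ => ?_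
  have hc := h.coeff_ne_zero
  rw [Lagrange.nodalWeight_eq_eval_derivative_nodal (Finset.mem_univ i), hφ' i]
  field_simp

theorem sum_div_derivative (h : HasDistinctRoots φ r) (hb : b.natDegree ≤ d)
    (hz : φ.eval z ≠ 0) :
    ∑ i, b.eval (r i) / (derivative φ).eval (r i) * (z - r i)⁻¹ =
      b.eval z / φ.eval z - b.coeff d / φ.coeff d := by
  have hn : φ.natDegree ≤ d := by
    rw [h.eq_C_mul_nodal]
    exact (Polynomial.natDegree_C_mul_le _ _).trans (by simp [Lagrange.natDegree_nodal])
  let q : K[X] := b - Polynomial.C (b.coeff d / φ.coeff d) * φ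
  have hq (μ : K) : q.eval μ = b.eval μ - b.coeff d / φ.coeff d * φ.eval μ := by simp [q]
  have hqd : q.degree < d := (Polynomial.degree_lt_iff_coeff_zero _ _).2 fun m hm => by
    rcases hm.eq_or_lt with rfl | hm
    · simp [q, h.coeff_ne_zero]
    · simp [q, Polynomial.coeff_eq_zero_of_natDegree_lt (hb.trans_lt hm),
        Polynomial.coeff_eq_zero_of_natDegree_lt (hn.trans_lt hm)]
  have hsum := h.sum_div_derivative_of_degree_lt hqd hz
  simpa only [hq, h.eval_eq_zero, mul_zero, sub_zero, sub_div, mul_div_cancel_right₀ _ hz]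
    using hsum

theorem sum_div_derivative_sq {𝕜 : Type*} [NontriviallyNormedField 𝕜] {φ b : 𝕜[X]} {r : Fin d → 𝕜}
    {z : 𝕜} (h : HasDistinctRoots φ r) (hb : b.natDegree ≤ d) (hz : φ.eval z ≠ 0) :
    ∑ i, b.eval (r i) / (derivative φ).eval (r i) * (z - r i)⁻¹ ^ 2 =
      (b.eval z * (derivative φ).eval z - (derivative b).eval z * φ.eval z) / φ.eval z ^ 2 := by
  have hzr (i : Fin d) : z - r i ≠ 0 := _root_.sub_ne_zero.2 fun hzi => hz (hzi ▸ h.eval_eq_zero i)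
  have hexpand : (fun z => ∑ i, b.eval (r i) / (derivative φ).eval (r i) * (z - r i)⁻¹) =ᶠ[𝓝 z]
      fun z => b.eval z / φ.eval z - b.coeff d / φ.coeff d :=
    (φ.continuous.continuousAt.eventually_ne hz).mono fun w hw => h.sum_div_derivative hb hw
  have hsum : HasDerivAt (fun z => ∑ i, b.eval (r i) / (derivative φ).eval (r i) * (z - r i)⁻¹)
      (∑ i, b.eval (r i) / (derivative φ).eval (r i) * (-1 / (z - r i) ^ 2)) z :=
    HasDerivAt.fun_sum fun i _ =>
      (((hasDerivAt_id z).sub_const (r i)).fun_inv (hzr i)).const_mul _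
  have hquot := ((b.hasDerivAt z).div (φ.hasDerivAt z) hz).sub_const (b.coeff d / φ.coeff d)
  calc ∑ i, b.eval (r i) / (derivative φ).eval (r i) * (z - r i)⁻¹ ^ 2
      = -∑ i, b.eval (r i) / (derivative φ).eval (r i) * (-1 / (z - r i) ^ 2) := by
        rw [← Finset.sum_neg_distrib]
        exact Finset.sum_congr rfl fun i _ => by rw [inv_pow]; ring
    _ = _ := by
        rw [hsum.unique (hquot.congr_of_eventuallyEq hexpand)]
        ring

end HasDistinctRoots

end PartialFractions

section SmallOnRoots

theorem tendsto_eval_div_pow_cobounded {𝕜 : Type*} [NormedField 𝕜] {P : 𝕜[X]} {n : ℕ}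
    (hP : P.natDegree ≤ n) :
    Tendsto (fun z => P.eval z / z ^ n) (cobounded 𝕜) (𝓝 (P.coeff n)) := by
  have hreflect : Tendsto (fun z : 𝕜 => (P.reflect n).eval z⁻¹) (cobounded 𝕜) (𝓝 (P.coeff n)) := by
    have h0 : (P.reflect n).eval 0 = P.coeff n := by
      rw [← Polynomial.coeff_zero_eq_eval_zero, Polynomial.coeff_reflect, Polynomial.revAt_zero]
    exact h0 ▸ ((P.reflect n).continuous.tendsto 0).comp tendsto_inv₀_cobounded
  refine hreflect.congr' ((eventually_ne_cobounded 0).mono fun z hz => ?_)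
  let _ := invertibleOfNonzero hz
  rw [eq_div_iff (pow_ne_zero n hz), ← invOf_eq_inv]
  exact Polynomial.eval₂_reflect_mul_pow (RingHom.id 𝕜) z n P hP

namespace IsPencil

variable {d : ℕ} {F b : ℂ[X]} {R : ℂ → ℂ}

theorem eventually_eval_pencil_ne_zero_cobounded (h : IsPencil d F b) (hd : F.coeff d ≠ 0) :
    ∀ᶠ w : ℂ × ℂ in 𝓝 0 ×ˢ cobounded ℂ, (pencil F b w.1).eval w.2 ≠ 0 := by
  have hlim : Tendsto (fun w : ℂ × ℂ => F.eval w.2 / w.2 ^ d + w.1 * (b.eval w.2 / w.2 ^ d))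
      (𝓝 0 ×ˢ cobounded ℂ) (𝓝 (F.coeff d + 0 * b.coeff d)) :=
    ((tendsto_eval_div_pow_cobounded h.natDegree_left_le).comp tendsto_snd).add
      (tendsto_fst.mul ((tendsto_eval_div_pow_cobounded h.natDegree_right_le).comp tendsto_snd))
  filter_upwards [hlim.eventually_ne (by simpa using hd)] with w hw h0
  rw [eval_pencil] at h0
  rw [← mul_div_assoc, ← add_div, h0, zero_div] at hw
  exact hw rfl

theorem eventually_norm_lt_nhds (h : IsPencil d F b) {μ₀ : ℂ} {ε : ℝ}
    (hR : F.eval μ₀ = 0 → ∀ᶠ μ in 𝓝[≠] μ₀, ‖R μ‖ < ε) :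
    ∀ᶠ w : ℂ × ℂ in 𝓝 (0, μ₀), w.1 ≠ 0 → (pencil F b w.1).eval w.2 = 0 → ‖R w.2‖ < ε := by
  by_cases hF : F.eval μ₀ = 0
  · have hsnd : Tendsto (Prod.snd : ℂ × ℂ → ℂ) (𝓝 (0, μ₀)) (𝓝 μ₀) := continuous_snd.continuousAt
    filter_upwards [hsnd.eventually (eventually_nhdsWithin_iff.1 (hR hF))] with w hw hw0 hroot
    refine hw fun hμ => mul_ne_zero hw0 (h.eval_right_ne_zero μ₀ hF) ?_
    rw [Set.mem_singleton_iff] at hμ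
    rwa [eval_pencil, hμ, hF, zero_add] at hroot
  · have hcont : Continuous fun w : ℂ × ℂ => (pencil F b w.1).eval w.2 := by
      simp only [eval_pencil]
      fun_prop
    have hne : (pencil F b ((0, μ₀) : ℂ × ℂ).1).eval ((0, μ₀) : ℂ × ℂ).2 ≠ 0 := by
      simpa [eval_pencil] using hF
    exact (hcont.continuousAt.eventually_ne hne).mono fun w hw _ hroot => absurd hroot hw

theorem eventually_norm_lt_of_root (h : IsPencil d F b)
    (hR : ∀ r, F.eval r = 0 → Tendsto R (𝓝[≠] r) (𝓝 0))
    (hinf : F.coeff d ≠ 0 ∨ Tendsto R (cobounded ℂ) (𝓝 0)) {ε : ℝ} (hε : 0 < ε) :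
    ∀ᶠ π in 𝓝[≠] (0 : ℂ), ∀ μ, (pencil F b π).eval μ = 0 → ‖R μ‖ < ε := by
  have hsmall {l : Filter ℂ} (hl : Tendsto R l (𝓝 0)) : ∀ᶠ μ in l, ‖R μ‖ < ε :=
    hl.norm.eventually_lt_const (by rwa [norm_zero])
  have hfar : ∀ᶠ w : ℂ × ℂ in 𝓝 0 ×ˢ cobounded ℂ,
      (pencil F b w.1).eval w.2 = 0 → ‖R w.2‖ < ε := by
    rcases hinf with hd | hinf
    · exact (h.eventually_eval_pencil_ne_zero_cobounded hd).mono fun w hw h0 => absurd h0 hw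
    · exact (tendsto_snd.eventually (hsmall hinf)).mono fun w hw _ => hw
  obtain ⟨P, hP, S, hS, hfar⟩ := eventually_prod_iff.1 hfar
  obtain ⟨M, -, hM⟩ := (hasBasis_cobounded_norm (E := ℂ)).mem_iff.1 hS
  have hnear := (isCompact_closedBall (0 : ℂ) M).eventually_forall_of_forall_eventually
    (x₀ := (0 : ℂ)) (P := fun π μ => π ≠ 0 → (pencil F b π).eval μ = 0 → ‖R μ‖ < ε)
    fun μ₀ _ => h.eventually_norm_lt_nhds fun hμ₀ => hsmall (hR μ₀ hμ₀)
  filter_upwards [nhdsWithin_le_nhds hP, nhdsWithin_le_nhds hnear, self_mem_nhdsWithin]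
    with π hπ hπM hπ0 μ hμ
  rcases le_total M ‖μ‖ with hMμ | hμM
  · exact hfar hπ (hM hMμ) hμ
  · exact hπM μ (mem_closedBall_zero_iff.2 hμM) hπ0 hμ

end IsPencil

end SmallOnRoots

/-! ### The residue of the curvature of a pencil -/

section IteratedWronskians

variable {R : Type*} [CommRing R] {m : ℕ} {μ₀ : R} {F b G : R[X]}

/-- The Wronskian-type bracket `F⁽ʲ⁾ b - F b⁽ʲ⁾`: at a root of `φ = F + π b` it equals `b φ⁽ʲ⁾`,
and it no longer involves `π`. -/
noncomputable def iterWronskian (j : ℕ) (F b : R[X]) : R[X] :=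
  derivative^[j] F * b - F * derivative^[j] b

/-- The polynomial `K_j` with `(x - μ₀)ʲ (d/dx)ʲ ((x - μ₀)ᵐ G) = (x - μ₀)ᵐ K_j`. -/
noncomputable def rootDerivative (m : ℕ) (μ₀ : R) (G : R[X]) : ℕ → R[X]
  | 0 => G
  | j + 1 => Polynomial.C ((m : R) - j) * rootDerivative m μ₀ G j +
      (Polynomial.X - Polynomial.C μ₀) * derivative (rootDerivative m μ₀ G j)

/-- The polynomial `w_j` with `(x - μ₀)ʲ iterWronskian j F b = (x - μ₀)ᵐ w_j`, where
`F = (x - μ₀)ᵐ G`. -/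
noncomputable def rootWronskian (m : ℕ) (μ₀ : R) (G b : R[X]) (j : ℕ) : R[X] :=
  rootDerivative m μ₀ G j * b - (Polynomial.X - Polynomial.C μ₀) ^ j * (G * derivative^[j] b)

theorem iterWronskian_one (F b : R[X]) :
    iterWronskian 1 F b = derivative F * b - F * derivative b := rfl

theorem X_sub_C_mul_derivative_X_sub_C_pow_mul (μ₀ : R) (n : ℕ) (K : R[X]) :
    (Polynomial.X - Polynomial.C μ₀) * derivative ((Polynomial.X - Polynomial.C μ₀) ^ n * K) =
      (Polynomial.X - Polynomial.C μ₀) ^ n *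
        (Polynomial.C (n : R) * K + (Polynomial.X - Polynomial.C μ₀) * derivative K) := by
  rcases n with _ | n
  · simp
  · rw [Polynomial.derivative_mul, Polynomial.derivative_X_sub_C_pow]
    simp only [Nat.add_sub_cancel]
    ring

theorem X_sub_C_pow_mul_iterate_derivative (hF : F = (Polynomial.X - Polynomial.C μ₀) ^ m * G)
    (j : ℕ) : (Polynomial.X - Polynomial.C μ₀) ^ j * derivative^[j] F =
      (Polynomial.X - Polynomial.C μ₀) ^ m * rootDerivative m μ₀ G j := by
  induction j with
  | zero => simpa [rootDerivative] using hF
  | succ j ih =>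
    have hleft := X_sub_C_mul_derivative_X_sub_C_pow_mul μ₀ j (derivative^[j] F)
    rw [ih, X_sub_C_mul_derivative_X_sub_C_pow_mul, ← Function.iterate_succ_apply' derivative]
      at hleft
    rw [rootDerivative, Polynomial.C_sub]
    linear_combination -Polynomial.C (j : R) * ih - hleft

theorem X_sub_C_pow_mul_iterWronskian (hF : F = (Polynomial.X - Polynomial.C μ₀) ^ m * G)
    (b : R[X]) (j : ℕ) : (Polynomial.X - Polynomial.C μ₀) ^ j * iterWronskian j F b =
      (Polynomial.X - Polynomial.C μ₀) ^ m * rootWronskian m μ₀ G b j := by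
  have hderiv := X_sub_C_pow_mul_iterate_derivative hF j
  rw [iterWronskian, rootWronskian]
  linear_combination b * hderiv -
    (Polynomial.X - Polynomial.C μ₀) ^ j * derivative^[j] b * hF

theorem eval_rootDerivative (m : ℕ) (μ₀ : R) (G : R[X]) (j : ℕ) :
    (rootDerivative m μ₀ G j).eval μ₀ = (∏ i ∈ Finset.range j, ((m : R) - i)) * G.eval μ₀ := by
  induction j with
  | zero => simp [rootDerivative]
  | succ j ih =>
    simp only [rootDerivative, Polynomial.eval_add, Polynomial.eval_mul, Polynomial.eval_C,
      Polynomial.eval_sub, Polynomial.eval_X, sub_self, zero_mul, add_zero, ih,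
      Finset.prod_range_succ]
    ring

theorem eval_derivative_rootDerivative (m : ℕ) (μ₀ : R) (G : R[X]) (j : ℕ) :
    (derivative (rootDerivative m μ₀ G j)).eval μ₀ =
      (∏ i ∈ Finset.range j, ((m : R) + 1 - i)) * (derivative G).eval μ₀ := by
  induction j with
  | zero => simp [rootDerivative]
  | succ j ih =>
    simp only [rootDerivative, Polynomial.derivative_add, Polynomial.derivative_mul,
      Polynomial.derivative_C, Polynomial.derivative_sub, Polynomial.derivative_X,
      Polynomial.eval_add, Polynomial.eval_mul, Polynomial.eval_C, Polynomial.eval_sub,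
      Polynomial.eval_X, Polynomial.eval_zero, Polynomial.eval_one, sub_self, ih,
      Finset.prod_range_succ]
    ring

theorem eval_rootWronskian_succ (m : ℕ) (μ₀ : R) (G b : R[X]) (j : ℕ) :
    (rootWronskian m μ₀ G b (j + 1)).eval μ₀ =
      (∏ i ∈ Finset.range (j + 1), ((m : R) - i)) * G.eval μ₀ * b.eval μ₀ := by
  simp [rootWronskian, eval_rootDerivative]

theorem eval_derivative_rootWronskian_one (m : ℕ) (μ₀ : R) (G b : R[X]) :
    (derivative (rootWronskian m μ₀ G b 1)).eval μ₀ =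
      (m + 1) * (derivative G).eval μ₀ * b.eval μ₀ +
        (m - 1) * G.eval μ₀ * (derivative b).eval μ₀ := by
  simp only [rootWronskian, Polynomial.derivative_sub, Polynomial.derivative_mul,
    Polynomial.eval_sub, Polynomial.eval_add, Polynomial.eval_mul, eval_rootDerivative,
    eval_derivative_rootDerivative, pow_one, Polynomial.derivative_X, Polynomial.derivative_C,
    Polynomial.eval_X, Polynomial.eval_C, Polynomial.eval_one, Polynomial.eval_zero,
    Function.iterate_one, Finset.prod_range_one, Nat.cast_zero, sub_self]
  ring

theorem eval_derivative_rootWronskian_add_two (m : ℕ) (μ₀ : R) (G b : R[X]) (j : ℕ) :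
    (derivative (rootWronskian m μ₀ G b (j + 2))).eval μ₀ =
      (∏ i ∈ Finset.range (j + 2), ((m : R) + 1 - i)) * (derivative G).eval μ₀ * b.eval μ₀ +
        (∏ i ∈ Finset.range (j + 2), ((m : R) - i)) * G.eval μ₀ * (derivative b).eval μ₀ := by
  simp only [rootWronskian, Polynomial.derivative_sub, Polynomial.derivative_mul,
    Polynomial.derivative_X_sub_C_pow, Polynomial.eval_sub, Polynomial.eval_add,
    Polynomial.eval_mul, Polynomial.eval_pow, eval_rootDerivative,
    eval_derivative_rootDerivative, Polynomial.eval_X, Polynomial.eval_C, sub_self]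
  simp

theorem natDegree_X_pow_mul_iterate_derivative_le (P : R[X]) (j : ℕ) :
    (Polynomial.X ^ j * derivative^[j] P).natDegree ≤ P.natDegree := by
  rcases lt_or_ge P.natDegree j with hj | hj
  · simp [Polynomial.iterate_derivative_eq_zero hj]
  · have hmul := Polynomial.natDegree_mul_le (p := (Polynomial.X : R[X]) ^ j)
      (q := derivative^[j] P)
    have hpow := Polynomial.natDegree_X_pow_le (R := R) j
    have hderiv := Polynomial.natDegree_iterate_derivative P j
    lia

theorem natDegree_X_pow_mul_iterWronskian_le (F b : R[X]) (j : ℕ) :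
    (Polynomial.X ^ j * iterWronskian j F b).natDegree ≤ F.natDegree + b.natDegree := by
  rw [show Polynomial.X ^ j * iterWronskian j F b = Polynomial.X ^ j * derivative^[j] F * b -
    F * (Polynomial.X ^ j * derivative^[j] b) by rw [iterWronskian]; ring]
  exact (Polynomial.natDegree_sub_le _ _).trans (max_le
    (Polynomial.natDegree_mul_le_of_le (natDegree_X_pow_mul_iterate_derivative_le F j) le_rfl)
    (Polynomial.natDegree_mul_le_of_le le_rfl (natDegree_X_pow_mul_iterate_derivative_le b j)))

theorem coeff_natDegree_X_mul_derivative (P : R[X]) :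
    (Polynomial.X * derivative P).coeff P.natDegree = P.natDegree * P.leadingCoeff := by
  rcases hP : P.natDegree with _ | n
  · simp
  · rw [Polynomial.coeff_X_mul, Polynomial.coeff_derivative, Polynomial.leadingCoeff, hP]
    push_cast
    ring

theorem coeff_X_mul_iterWronskian_one (F b : R[X]) :
    (Polynomial.X * iterWronskian 1 F b).coeff (F.natDegree + b.natDegree) =
      ((F.natDegree : R) - b.natDegree) * F.leadingCoeff * b.leadingCoeff := by
  have hdeg (P : R[X]) : (Polynomial.X * derivative P).natDegree ≤ P.natDegree := by
    simpa using natDegree_X_pow_mul_iterate_derivative_le P 1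
  rw [show Polynomial.X * iterWronskian 1 F b = Polynomial.X * derivative F * b -
      F * (Polynomial.X * derivative b) by rw [iterWronskian_one]; ring, Polynomial.coeff_sub,
    Polynomial.coeff_mul_add_eq_of_natDegree_le (hdeg F) le_rfl,
    Polynomial.coeff_mul_add_eq_of_natDegree_le le_rfl (hdeg b),
    coeff_natDegree_X_mul_derivative, coeff_natDegree_X_mul_derivative,
    Polynomial.coeff_natDegree, Polynomial.coeff_natDegree]
  ring

end IteratedWronskians

section RootTerm

variable {d m : ℕ} {F b G : ℂ[X]} {π μ μ₀ ρ r c₁ c₂ : ℂ}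

/-- The product of `π` with the contribution to the curvature of the root `μ` of `F + π b`, in which
`π` has been replaced by `-F(μ) / b(μ)`. -/
noncomputable def rootTerm (d : ℕ) (F b : ℂ[X]) (μ : ℂ) : ℂ :=
  -(F.eval μ * (b.eval μ - μ * F.eval μ) ^ 2 * (iterWronskian 3 F b).eval μ /
      (6 * b.eval μ * (iterWronskian 1 F b).eval μ ^ 2)) -
    (d - 2) * (F.eval μ ^ 2 * (b.eval μ - μ * F.eval μ) * (iterWronskian 2 F b).eval μ /
      (2 * b.eval μ * (iterWronskian 1 F b).eval μ ^ 2)) -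
    (d - 1) * (d - 2) * (F.eval μ ^ 3 / (2 * b.eval μ * (iterWronskian 1 F b).eval μ))

/-- A rational function with a pole of order two at `μ₀`; the simple pole at the auxiliary point `ρ`
makes it vanish to order two at infinity. -/
noncomputable def polarPart (μ₀ ρ c₁ c₂ μ : ℂ) : ℂ :=
  c₂ / (μ - μ₀) ^ 2 + c₁ * (1 / (μ - μ₀) - 1 / (μ - ρ))

/-- `rootTerm` with its singular part removed, the weight being `-π b / φ'` at a root of
`φ = F + π b`, so that the removed terms can be summed over the roots by partial fractions. -/
noncomputable def regularizedTerm (d : ℕ) (F b : ℂ[X]) (μ₀ ρ c₁ c₂ μ : ℂ) : ℂ :=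
  rootTerm d F b μ -
    F.eval μ * b.eval μ / (iterWronskian 1 F b).eval μ * polarPart μ₀ ρ c₁ c₂ μ

theorem eval_iterate_derivative_pencil (hb : b.eval μ ≠ 0) (h0 : (pencil F b π).eval μ = 0)
    (j : ℕ) : (derivative^[j] (pencil F b π)).eval μ =
      (iterWronskian j F b).eval μ / b.eval μ := by
  rw [eval_pencil] at h0
  rw [pencil, iterate_map_add, Polynomial.iterate_derivative_C_mul, iterWronskian,
    eq_div_iff hb]
  simp only [Polynomial.eval_add, Polynomial.eval_mul, Polynomial.eval_sub, Polynomial.eval_C]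
  linear_combination (derivative^[j] b).eval μ * h0

theorem eval_iterWronskian_one_ne_zero (hb : b.eval μ ≠ 0) (h0 : (pencil F b π).eval μ = 0)
    (hs : (derivative (pencil F b π)).eval μ ≠ 0) : (iterWronskian 1 F b).eval μ ≠ 0 := by
  have hderiv := eval_iterate_derivative_pencil hb h0 1
  rw [Function.iterate_one] at hderiv
  exact (div_ne_zero_iff.1 (hderiv ▸ hs)).1

theorem mul_pencilTerm_eq_rootTerm (hb : b.eval μ ≠ 0) (h0 : (pencil F b π).eval μ = 0)
    (hs : (derivative (pencil F b π)).eval μ ≠ 0) :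
    π * pencilTerm d F b π μ = rootTerm d F b μ := by
  have hW := eval_iterWronskian_one_ne_zero hb h0 hs
  have hderiv := eval_iterate_derivative_pencil hb h0
  have hπ : π = -(F.eval μ / b.eval μ) := (eval_pencil_eq_zero_iff hb).1 h0
  have h₁ := hderiv 1
  have h₂ := hderiv 2
  have h₃ := hderiv 3
  simp only [Function.iterate_succ, Function.iterate_zero, Function.comp_apply, id] at h₁ h₂ h₃
  rw [pencilTerm, rootTerm, h₁, h₂, h₃, hπ]
  field_simp
  ring

theorem mul_pencilTerm_eq_regularizedTerm_sub (hb : b.eval μ ≠ 0)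
    (h0 : (pencil F b π).eval μ = 0) (hs : (derivative (pencil F b π)).eval μ ≠ 0)
    (μ₀ ρ c₁ c₂ : ℂ) : π * pencilTerm d F b π μ = regularizedTerm d F b μ₀ ρ c₁ c₂ μ -
      π * (b.eval μ / (derivative (pencil F b π)).eval μ) * polarPart μ₀ ρ c₁ c₂ μ := by
  have hW := eval_iterWronskian_one_ne_zero hb h0 hs
  have hderiv := eval_iterate_derivative_pencil hb h0 1
  have hπ : π = -(F.eval μ / b.eval μ) := (eval_pencil_eq_zero_iff hb).1 h0
  have hweight : π * (b.eval μ / (derivative (pencil F b π)).eval μ) =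
      -(F.eval μ * b.eval μ / (iterWronskian 1 F b).eval μ) := by
    rw [Function.iterate_one] at hderiv
    rw [hderiv, hπ]
    field_simp
  rw [mul_pencilTerm_eq_rootTerm hb h0 hs, regularizedTerm, hweight]
  ring

theorem regularizedTerm_tendsto_of_simple (hr : F.eval r = 0) (hb : b.eval r ≠ 0)
    (hs : (derivative F).eval r ≠ 0) (hμ₀ : r ≠ μ₀) (hρ : r ≠ ρ) :
    Tendsto (regularizedTerm d F b μ₀ ρ c₁ c₂) (𝓝[≠] r) (𝓝 0) := by
  have hW : (iterWronskian 1 F b).eval r ≠ 0 := by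
    simp [iterWronskian_one, hr, hb, hs]
  have hμ₀' := sub_ne_zero.2 hμ₀
  have hcont : ContinuousAt (regularizedTerm d F b μ₀ ρ c₁ c₂) r := by
    unfold regularizedTerm rootTerm polarPart
    fun_prop (disch := simp [hb, hW, hμ₀', sub_ne_zero.2 hρ])
  have h0 : regularizedTerm d F b μ₀ ρ c₁ c₂ r = 0 := by
    simp [regularizedTerm, rootTerm, hr]
  exact (h0 ▸ hcont.tendsto).mono_left nhdsWithin_le_nhds

end RootTerm

section Infinity

variable {d : ℕ} {F b : ℂ[X]} {μ₀ ρ c₁ c₂ : ℂ}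

theorem tendsto_iterWronskian_cobounded (F b : ℂ[X]) (j : ℕ) :
    Tendsto (fun z => z ^ j * (iterWronskian j F b).eval z / z ^ (F.natDegree + b.natDegree))
      (cobounded ℂ)
      (𝓝 ((Polynomial.X ^ j * iterWronskian j F b).coeff (F.natDegree + b.natDegree))) := by
  refine (tendsto_eval_div_pow_cobounded (natDegree_X_pow_mul_iterWronskian_le F b j)).congr
    fun z => ?_
  simp

theorem tendsto_inv_sub_cobounded (c : ℂ) :
    Tendsto (fun z : ℂ => (z - c)⁻¹) (cobounded ℂ) (𝓝 0) :=
  tendsto_inv₀_cobounded.comp (tendsto_sub_const_cobounded c)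

theorem rootTerm_eq_of_ne_zero {z : ℂ} (hz : z ≠ 0) (d : ℕ) (F b : ℂ[X]) (e k : ℕ) :
    rootTerm d F b z =
      -(F.eval z / z ^ e * ((b - Polynomial.X * F).eval z / z ^ k) ^ 2 *
          (z ^ 3 * (iterWronskian 3 F b).eval z / z ^ (e + k)) /
          (6 * (b.eval z / z ^ k) * (z ^ 1 * (iterWronskian 1 F b).eval z / z ^ (e + k)) ^ 2) *
          z⁻¹) -
        (d - 2) * (F.eval z / z ^ e * (F.eval z / z ^ k) *
          ((b - Polynomial.X * F).eval z / z ^ k) *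
          (z ^ 2 * (iterWronskian 2 F b).eval z / z ^ (e + k)) /
          (2 * (b.eval z / z ^ k) * (z ^ 1 * (iterWronskian 1 F b).eval z / z ^ (e + k)) ^ 2)) -
        (d - 1) * (d - 2) * (F.eval z / z ^ e * (F.eval z / z ^ k) *
          ((Polynomial.X * F).eval z / z ^ k) /
          (2 * (b.eval z / z ^ k) *
            (z ^ 1 * (iterWronskian 1 F b).eval z / z ^ (e + k)))) := by
  simp only [rootTerm, Polynomial.eval_sub, Polynomial.eval_mul, Polynomial.eval_X]
  rw [pow_add]
  field_simp

theorem coeff_X_mul_iterWronskian_one_ne_zero (hF0 : F ≠ 0) (hF : F.natDegree < b.natDegree) :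
    (Polynomial.X * iterWronskian 1 F b).coeff (F.natDegree + b.natDegree) ≠ 0 := by
  rw [coeff_X_mul_iterWronskian_one]
  refine mul_ne_zero (mul_ne_zero (sub_ne_zero.2 ?_) (Polynomial.leadingCoeff_ne_zero.2 hF0))
    (Polynomial.leadingCoeff_ne_zero.2 (Polynomial.ne_zero_of_natDegree_gt hF))
  exact_mod_cast hF.ne

theorem rootTerm_tendsto_cobounded (hF0 : F ≠ 0) (hF : F.natDegree < b.natDegree) :
    Tendsto (rootTerm d F b) (cobounded ℂ) (𝓝 0) := by
  have hXF : (Polynomial.X * F).natDegree ≤ b.natDegree := by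
    rwa [Polynomial.natDegree_X_mul hF0]
  have hf := tendsto_eval_div_pow_cobounded (P := F) le_rfl
  have hfk := tendsto_eval_div_pow_cobounded hF.le
  have hxf := tendsto_eval_div_pow_cobounded hXF
  have hq := tendsto_eval_div_pow_cobounded
    (Polynomial.natDegree_sub_le_of_le le_rfl hXF |>.trans_eq (max_self _))
  have hg := tendsto_eval_div_pow_cobounded (P := b) le_rfl
  have hw := tendsto_iterWronskian_cobounded F b
  have hw₁ := coeff_X_mul_iterWronskian_one_ne_zero hF0 hF
  have hg₀ : b.coeff b.natDegree ≠ 0 :=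
    Polynomial.leadingCoeff_ne_zero.2 (Polynomial.ne_zero_of_natDegree_gt hF)
  rw [Polynomial.coeff_eq_zero_of_natDegree_lt hF] at hfk
  rw [← pow_one Polynomial.X] at hw₁
  have hden := ((hg.const_mul 2).mul ((hw 1).pow 2))
  have hden₀ := mul_ne_zero (mul_ne_zero two_ne_zero hg₀) (pow_ne_zero 2 hw₁)
  have hthird := ((((hf.mul (hq.pow 2)).mul (hw 3)).div ((hg.const_mul 6).mul ((hw 1).pow 2))
    (mul_ne_zero (mul_ne_zero (by norm_num) hg₀) (pow_ne_zero 2 hw₁))).mul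
    tendsto_inv₀_cobounded).neg
  have hsecond := ((((hf.mul hfk).mul hq).mul (hw 2)).div hden hden₀).const_mul ((d : ℂ) - 2)
  have hfirst := (((hf.mul hfk).mul hxf).div ((hg.const_mul 2).mul (hw 1))
    (mul_ne_zero (mul_ne_zero two_ne_zero hg₀) hw₁)).const_mul (((d : ℂ) - 1) * (d - 2))
  have hsum := (hthird.sub hsecond).sub hfirst
  simp only [mul_zero, zero_mul, zero_div, neg_zero, sub_zero] at hsum
  exact hsum.congr' ((eventually_ne_cobounded 0).mono fun z hz =>
    (rootTerm_eq_of_ne_zero hz d F b F.natDegree b.natDegree).symm)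

theorem mul_sub_inv_mul_sub_inv_tendsto_cobounded (α β : ℂ) :
    Tendsto (fun z => z * ((z - α)⁻¹ * (z - β)⁻¹)) (cobounded ℂ) (𝓝 0) := by
  have hα := tendsto_inv_sub_cobounded α
  have hβ := tendsto_inv_sub_cobounded β
  have hlim := hβ.add ((hα.mul hβ).const_mul α)
  simp only [mul_zero, add_zero] at hlim
  refine hlim.congr' ((eventually_ne_cobounded α).mono fun z hz => ?_)
  linear_combination -(z - β)⁻¹ * mul_inv_cancel₀ (sub_ne_zero.2 hz)

theorem mul_polarPart_tendsto_cobounded (hF0 : F ≠ 0) (hF : F.natDegree < b.natDegree) :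
    Tendsto (fun z => F.eval z * b.eval z / (iterWronskian 1 F b).eval z *
      polarPart μ₀ ρ c₁ c₂ z) (cobounded ℂ) (𝓝 0) := by
  have hw₁ := coeff_X_mul_iterWronskian_one_ne_zero hF0 hF
  rw [← pow_one Polynomial.X] at hw₁
  have hweight := ((tendsto_eval_div_pow_cobounded (P := F) le_rfl).mul
    (tendsto_eval_div_pow_cobounded (P := b) le_rfl)).div
      (tendsto_iterWronskian_cobounded F b 1) hw₁
  have hpolar := ((mul_sub_inv_mul_sub_inv_tendsto_cobounded μ₀ μ₀).const_mul c₂).add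
    ((mul_sub_inv_mul_sub_inv_tendsto_cobounded μ₀ ρ).const_mul (c₁ * (μ₀ - ρ)))
  have hlim := hweight.mul hpolar
  simp only [mul_zero, add_zero] at hlim
  refine hlim.congr' ?_
  filter_upwards [eventually_ne_cobounded 0, eventually_ne_cobounded μ₀,
    eventually_ne_cobounded ρ] with z hz hμ₀ hρ
  have hμ₀' := sub_ne_zero.2 hμ₀
  have hρ' := sub_ne_zero.2 hρ
  simp only [polarPart, Pi.div_apply, pow_add]
  field_simp
  ring

theorem regularizedTerm_tendsto_cobounded (hF0 : F ≠ 0) (hF : F.natDegree < b.natDegree) :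
    Tendsto (regularizedTerm d F b μ₀ ρ c₁ c₂) (cobounded ℂ) (𝓝 0) := by
  have hlim := (rootTerm_tendsto_cobounded (d := d) hF0 hF).sub
    (mul_polarPart_tendsto_cobounded (μ₀ := μ₀) (ρ := ρ) (c₁ := c₁) (c₂ := c₂) hF0 hF)
  rwa [sub_zero] at hlim

end Infinity

section MultipleRoot

variable {d m : ℕ} {F b G : ℂ[X]} {μ₀ ρ : ℂ}

/-- The coefficient of `1 / (μ - μ₀)²` in the expansion of the curvature term at a root `μ₀` of
multiplicity `m` of `F`, relative to the weight of `regularizedTerm`. -/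
noncomputable def doublePolarCoeff (m : ℕ) : ℂ := -((m - 1) * (m - 2) / 6)

/-- The coefficient of `1 / (μ - μ₀)` in the expansion of the curvature term at the root `μ₀` of
`F = (x - μ₀)ᵐ G`, relative to the weight of `regularizedTerm`. -/
noncomputable def simplePolarCoeff (m : ℕ) (G b : ℂ[X]) (μ₀ : ℂ) : ℂ :=
  -((m - 1) / (6 * m) * (2 * (m + 1) * ((derivative G).eval μ₀ / G.eval μ₀) +
    (m - 2) * ((derivative b).eval μ₀ / b.eval μ₀)))

theorem eval_rootWronskian_one_ne_zero (hm : m ≠ 0) (hG : G.eval μ₀ ≠ 0) (hb : b.eval μ₀ ≠ 0) :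
    (rootWronskian m μ₀ G b 1).eval μ₀ ≠ 0 := by
  simpa [eval_rootWronskian_succ] using ⟨⟨hm, hG⟩, hb⟩

theorem iterWronskian_one_ne_zero (hF : F = (Polynomial.X - Polynomial.C μ₀) ^ m * G)
    (hm : m ≠ 0) (hG : G.eval μ₀ ≠ 0) (hb : b.eval μ₀ ≠ 0) : iterWronskian 1 F b ≠ 0 := by
  intro hW
  have hfactor := X_sub_C_pow_mul_iterWronskian hF b 1
  rw [hW, mul_zero, eq_comm, mul_eq_zero,
    or_iff_right (pow_ne_zero m (Polynomial.X_sub_C_ne_zero μ₀))] at hfactor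
  exact eval_rootWronskian_one_ne_zero hm hG hb (by rw [hfactor, Polynomial.eval_zero])

theorem eval_iterWronskian_of_ne (hF : F = (Polynomial.X - Polynomial.C μ₀) ^ m * G) {z : ℂ}
    (hz : z ≠ μ₀) (b : ℂ[X]) (j : ℕ) : (iterWronskian j F b).eval z =
      (z - μ₀) ^ m * (rootWronskian m μ₀ G b j).eval z / (z - μ₀) ^ j := by
  rw [eq_div_iff (pow_ne_zero j (sub_ne_zero.2 hz)), mul_comm]
  simpa using congrArg (Polynomial.eval z) (X_sub_C_pow_mul_iterWronskian hF b j)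

theorem neg_rootWronskian_div_eq (hm : m ≠ 0) (hG : G.eval μ₀ ≠ 0) (hb : b.eval μ₀ ≠ 0) :
    -((rootWronskian m μ₀ G b 3).eval μ₀ / (6 * (rootWronskian m μ₀ G b 1).eval μ₀)) =
      doublePolarCoeff m := by
  have hm' : (m : ℂ) ≠ 0 := Nat.cast_ne_zero.2 hm
  simp only [eval_rootWronskian_succ, Finset.prod_range_succ, Finset.prod_range_zero,
    doublePolarCoeff]
  push_cast
  rw [sub_zero, one_mul]
  field_simp

theorem hasDerivAt_neg_rootWronskian_div (hm : m ≠ 0) (hG : G.eval μ₀ ≠ 0) (hb : b.eval μ₀ ≠ 0) :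
    HasDerivAt (fun z => -((rootWronskian m μ₀ G b 3).eval z /
      (6 * (rootWronskian m μ₀ G b 1).eval z))) (simplePolarCoeff m G b μ₀) μ₀ := by
  have hm' : (m : ℂ) ≠ 0 := Nat.cast_ne_zero.2 hm
  have hw := eval_rootWronskian_one_ne_zero hm hG hb
  refine ((((rootWronskian m μ₀ G b 3).hasDerivAt μ₀).fun_div
    (((rootWronskian m μ₀ G b 1).hasDerivAt μ₀).const_mul 6)
    (mul_ne_zero (by norm_num) hw)).fun_neg).congr_deriv ?_
  simp only [eval_rootWronskian_succ, eval_derivative_rootWronskian_one,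
    eval_derivative_rootWronskian_add_two, Finset.prod_range_succ, Finset.prod_range_zero,
    simplePolarCoeff]
  push_cast
  rw [sub_zero, sub_zero, one_mul, one_mul]
  field_simp
  ring

/-- The quotient by `z - μ₀` of the part of `regularizedTerm` which vanishes at a multiple root
`μ₀` without any cancellation. -/
noncomputable def rootRemainder (d m : ℕ) (F b G : ℂ[X]) (μ₀ ρ c₁ z : ℂ) : ℂ :=
  -((z - μ₀) ^ m * G.eval z ^ 2 * (z ^ 2 * F.eval z - 2 * z * b.eval z) *
      (rootWronskian (m + 2) μ₀ G b 3).eval z /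
        (6 * b.eval z * (rootWronskian (m + 2) μ₀ G b 1).eval z ^ 2)) -
    (d - 2) * ((z - μ₀) ^ (m + 1) * G.eval z ^ 2 * (b.eval z - z * F.eval z) *
      (rootWronskian (m + 2) μ₀ G b 2).eval z /
        (2 * b.eval z * (rootWronskian (m + 2) μ₀ G b 1).eval z ^ 2)) -
    (d - 1) * (d - 2) * ((z - μ₀) ^ (2 * m + 4) * G.eval z ^ 3 /
      (2 * b.eval z * (rootWronskian (m + 2) μ₀ G b 1).eval z)) +
    G.eval z * b.eval z / (rootWronskian (m + 2) μ₀ G b 1).eval z * (c₁ / (z - ρ))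

theorem regularizedTerm_eq_of_ne (hF : F = (Polynomial.X - Polynomial.C μ₀) ^ (m + 2) * G) {z : ℂ}
    (hz : z ≠ μ₀) (hb : b.eval z ≠ 0) (hw : (rootWronskian (m + 2) μ₀ G b 1).eval z ≠ 0)
    (c₁ c₂ : ℂ) : regularizedTerm d F b μ₀ ρ c₁ c₂ z =
      G.eval z * b.eval z / (rootWronskian (m + 2) μ₀ G b 1).eval z *
        ((-((rootWronskian (m + 2) μ₀ G b 3).eval z /
          (6 * (rootWronskian (m + 2) μ₀ G b 1).eval z)) - c₂) / (z - μ₀) - c₁) +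
      (z - μ₀) * rootRemainder d m F b G μ₀ ρ c₁ z := by
  have hs := sub_ne_zero.2 hz
  have hFz : F.eval z = (z - μ₀) ^ (m + 2) * G.eval z := by simp [hF]
  have hsq : (b.eval z - z * F.eval z) ^ 2 = b.eval z ^ 2 +
      F.eval z * (z ^ 2 * F.eval z - 2 * z * b.eval z) := by ring
  simp only [regularizedTerm, rootTerm, polarPart, rootRemainder, eval_iterWronskian_of_ne hF hz]
  rw [hsq]
  generalize b.eval z - z * F.eval z = Q
  generalize z ^ 2 * F.eval z - 2 * z * b.eval z = Q'
  rw [hFz]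
  generalize z - ρ = s'
  field_simp
  ring

theorem regularizedTerm_tendsto_of_multiple
    (hF : F = (Polynomial.X - Polynomial.C μ₀) ^ (m + 2) * G) (hG : G.eval μ₀ ≠ 0)
    (hb : b.eval μ₀ ≠ 0) (hρ : μ₀ ≠ ρ) :
    Tendsto (regularizedTerm d F b μ₀ ρ (simplePolarCoeff (m + 2) G b μ₀)
      (doublePolarCoeff (m + 2))) (𝓝[≠] μ₀) (𝓝 0) := by
  have hm : m + 2 ≠ 0 := by lia
  have hw := eval_rootWronskian_one_ne_zero hm hG hb
  have hslope := hasDerivAt_iff_tendsto_slope.1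
    (hasDerivAt_neg_rootWronskian_div hm hG hb)
  have hweight : ContinuousAt
      (fun z => G.eval z * b.eval z / (rootWronskian (m + 2) μ₀ G b 1).eval z) μ₀ := by
    fun_prop (disch := exact hw)
  have hremainder : ContinuousAt
      (rootRemainder d m F b G μ₀ ρ (simplePolarCoeff (m + 2) G b μ₀)) μ₀ := by
    unfold rootRemainder
    fun_prop (disch := simp [hb, hw, sub_ne_zero.2 hρ])
  have hlim := ((hweight.tendsto.mono_left nhdsWithin_le_nhds).mul
    (hslope.sub_const (simplePolarCoeff (m + 2) G b μ₀))).add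
    (((tendsto_id.sub_const μ₀).mul hremainder).mono_left nhdsWithin_le_nhds)
  simp only [id, sub_self, mul_zero, zero_mul, add_zero] at hlim
  refine hlim.congr' ?_
  filter_upwards [nhdsWithin_le_nhds (b.continuous.continuousAt.eventually_ne hb),
    nhdsWithin_le_nhds ((rootWronskian (m + 2) μ₀ G b 1).continuous.continuousAt.eventually_ne hw),
    self_mem_nhdsWithin] with z hbz hwz hz
  rw [regularizedTerm_eq_of_ne hF hz hbz hwz, slope_def_field,
    neg_rootWronskian_div_eq hm hG hb]

end MultipleRoot

section PencilSumResidue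

variable {d m : ℕ} {F b G : ℂ[X]} {μ₀ ρ c₁ c₂ π : ℂ}

theorem HasDistinctRoots.sum_mul_polarPart {r : Fin d → ℂ} {φ : ℂ[X]} (h : HasDistinctRoots φ r)
    (hb : b.natDegree ≤ d) (hμ₀ : φ.eval μ₀ ≠ 0) (hρ : φ.eval ρ ≠ 0) (c₁ c₂ : ℂ) :
    ∑ i, b.eval (r i) / (derivative φ).eval (r i) * polarPart μ₀ ρ c₁ c₂ (r i) =
      c₂ * ((b.eval μ₀ * (derivative φ).eval μ₀ - (derivative b).eval μ₀ * φ.eval μ₀) /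
        φ.eval μ₀ ^ 2) + c₁ * (b.eval ρ / φ.eval ρ - b.eval μ₀ / φ.eval μ₀) := by
  have hterm (i : Fin d) : polarPart μ₀ ρ c₁ c₂ (r i) =
      c₂ * (μ₀ - r i)⁻¹ ^ 2 + c₁ * ((ρ - r i)⁻¹ - (μ₀ - r i)⁻¹) := by
    rw [polarPart, ← neg_sub μ₀, ← neg_sub ρ, one_div, one_div, inv_neg, inv_neg, neg_sq,
      div_eq_mul_inv, inv_pow]
    ring
  have hμ₀sum := h.sum_div_derivative hb hμ₀
  have hρsum := h.sum_div_derivative hb hρ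
  have hsq := h.sum_div_derivative_sq hb hμ₀
  simp only [hterm, mul_add, mul_sub, Finset.sum_add_distrib, Finset.sum_sub_distrib,
    mul_left_comm _ c₁, mul_left_comm _ c₂, ← Finset.mul_sum, hμ₀sum, hρsum, hsq]
  ring

theorem IsPencil.mul_pencilSum_sub (h : IsPencil d F b) (hreg : IsRegularParam d F b π)
    {r : Fin d → ℂ} (hr : HasDistinctRoots (pencil F b π) r) (hπ : π ≠ 0) (hF : F.eval μ₀ = 0)
    (hF' : (derivative F).eval μ₀ = 0) (hρ : (pencil F b π).eval ρ ≠ 0) (c₁ c₂ : ℂ) :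
    π * pencilSum d F b π - c₁ * (1 - π * (b.eval ρ / (pencil F b π).eval ρ)) =
      ∑ i, regularizedTerm d F b μ₀ ρ c₁ c₂ (r i) := by
  have hb := h.eval_right_ne_zero μ₀ hF
  have hφ : (pencil F b π).eval μ₀ = π * b.eval μ₀ := by rw [eval_pencil, hF, zero_add]
  have hφ' : (derivative (pencil F b π)).eval μ₀ = π * (derivative b).eval μ₀ := by
    simp [pencil, hF']
  have hpolar := hr.sum_mul_polarPart h.natDegree_right_le
    (by rw [hφ]; exact mul_ne_zero hπ hb) hρ c₁ c₂
  rw [hφ, hφ'] at hpolar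
  have hterms : π * pencilSum d F b π = ∑ i, regularizedTerm d F b μ₀ ρ c₁ c₂ (r i) -
      π * ∑ i, b.eval (r i) / (derivative (pencil F b π)).eval (r i) *
        polarPart μ₀ ρ c₁ c₂ (r i) := by
    rw [hr.pencilSum_eq, Finset.mul_sum, Finset.mul_sum, ← Finset.sum_sub_distrib]
    refine Finset.sum_congr rfl fun i _ => ?_
    have hi := hr.eval_eq_zero i
    rw [mul_pencilTerm_eq_regularizedTerm_sub (h.eval_right_ne_zero_of_eval_pencil hi) hi
      (hreg.eval_derivative_ne_zero _ hi) μ₀ ρ c₁ c₂, mul_assoc]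
  rw [hterms, hpolar]
  field_simp
  ring

theorem IsPencil.eventually_isRegularParam (h : IsPencil d F b)
    (hlead : F.coeff d ≠ 0 ∨ b.coeff d ≠ 0) (hW : iterWronskian 1 F b ≠ 0) :
    ∀ᶠ π in 𝓝[≠] (0 : ℂ), IsRegularParam d F b π := by
  have hcoeff : ∀ᶠ π in 𝓝[≠] (0 : ℂ), (pencil F b π).coeff d ≠ 0 := by
    simp only [coeff_pencil]
    rcases eq_or_ne (F.coeff d) 0 with hF | hF
    · filter_upwards [self_mem_nhdsWithin] with π hπ
      rw [hF, zero_add]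
      exact mul_ne_zero hπ (hlead.resolve_left (not_not.2 hF))
    · have hcont : Continuous fun π => F.coeff d + π * b.coeff d := by fun_prop
      exact nhdsWithin_le_nhds (hcont.continuousAt.eventually_ne (by simpa using hF))
  have hcritical : ∀ᶠ π in 𝓝[≠] (0 : ℂ),
      π ∉ (fun μ => -(F.eval μ / b.eval μ)) '' {μ | (iterWronskian 1 F b).IsRoot μ} :=
    nhdsNE_le_cofinite 0 ((Polynomial.finite_setOfPred_isRoot hW).image _).compl_mem_cofinite
  filter_upwards [hcoeff, hcritical] with π hπ hcrit
  refine ⟨hπ, fun μ h0 hs => hcrit ⟨μ, ?_, ?_⟩⟩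
  all_goals have hb := h.eval_right_ne_zero_of_eval_pencil h0
  · have hderiv := eval_iterate_derivative_pencil hb h0 1
    rw [Function.iterate_one, hs, eq_comm, div_eq_zero_iff, or_iff_left hb] at hderiv
    exact hderiv
  · exact ((eval_pencil_eq_zero_iff hb).1 h0).symm

theorem IsPencil.regularizedTerm_tendsto (h : IsPencil d F b)
    (hF : F = (Polynomial.X - Polynomial.C μ₀) ^ (m + 2) * G) (hG : G.eval μ₀ ≠ 0)
    (hsimple : ∀ μ, μ ≠ μ₀ → F.eval μ = 0 → (derivative F).eval μ ≠ 0) (hρ : F.eval ρ ≠ 0) {r : ℂ}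
    (hr : F.eval r = 0) :
    Tendsto (regularizedTerm d F b μ₀ ρ (simplePolarCoeff (m + 2) G b μ₀)
      (doublePolarCoeff (m + 2))) (𝓝[≠] r) (𝓝 0) := by
  have hrρ : r ≠ ρ := fun h => hρ (h ▸ hr)
  have hb := h.eval_right_ne_zero r hr
  rcases eq_or_ne r μ₀ with rfl | hrμ₀
  · exact regularizedTerm_tendsto_of_multiple hF hG hb hrρ
  · exact regularizedTerm_tendsto_of_simple hr hb (hsimple r hrμ₀ hr) hrμ₀ hrρ

theorem IsPencil.coeff_ne_zero_or_regularizedTerm_tendsto (h : IsPencil d F b) (hF : F ≠ 0)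
    (hlead : F.coeff d ≠ 0 ∨ b.coeff d ≠ 0) :
    F.coeff d ≠ 0 ∨ Tendsto (regularizedTerm d F b μ₀ ρ c₁ c₂) (cobounded ℂ) (𝓝 0) := by
  refine or_iff_not_imp_left.2 fun hFd => regularizedTerm_tendsto_cobounded hF ?_
  rw [h.natDegree_right_le.antisymm
    (Polynomial.le_natDegree_of_ne_zero (hlead.resolve_left hFd))]
  refine h.natDegree_left_le.lt_of_ne fun hdeg => hFd ?_
  rw [← hdeg]
  exact Polynomial.leadingCoeff_ne_zero.2 hF

theorem tendsto_eval_pencil (F b : ℂ[X]) (ρ : ℂ) :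
    Tendsto (fun π => (pencil F b π).eval ρ) (𝓝[≠] 0) (𝓝 (F.eval ρ)) := by
  have hcont : Continuous fun π => (pencil F b π).eval ρ := by
    simp only [eval_pencil]
    fun_prop
  simpa [eval_pencil] using (hcont.tendsto 0).mono_left nhdsWithin_le_nhds

theorem IsPencil.tendsto_mul_pencilSum_sub (h : IsPencil d F b)
    (hreg : ∀ᶠ π in 𝓝[≠] (0 : ℂ), IsRegularParam d F b π) (hF : F.eval μ₀ = 0)
    (hF' : (derivative F).eval μ₀ = 0) (hρ : F.eval ρ ≠ 0)
    (hR : ∀ r, F.eval r = 0 → Tendsto (regularizedTerm d F b μ₀ ρ c₁ c₂) (𝓝[≠] r) (𝓝 0))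
    (hinf : F.coeff d ≠ 0 ∨ Tendsto (regularizedTerm d F b μ₀ ρ c₁ c₂) (cobounded ℂ) (𝓝 0)) :
    Tendsto (fun π => π * pencilSum d F b π -
      c₁ * (1 - π * (b.eval ρ / (pencil F b π).eval ρ))) (𝓝[≠] 0) (𝓝 0) := by
  refine Metric.tendsto_nhds.2 fun ε hε => ?_
  have hε' : 0 < ε / (d + 1) := by positivity
  filter_upwards [hreg, (tendsto_eval_pencil F b ρ).eventually_ne hρ, self_mem_nhdsWithin,
    h.eventually_norm_lt_of_root hR hinf hε'] with π hπ hφρ hπ0 hsmall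
  obtain ⟨r, hr⟩ := hπ.exists_hasDistinctRoots h
  rw [dist_zero_right, h.mul_pencilSum_sub hπ hr hπ0 hF hF' hφρ]
  calc ‖∑ i, regularizedTerm d F b μ₀ ρ c₁ c₂ (r i)‖
      ≤ ∑ _i : Fin d, ε / (d + 1) :=
        norm_sum_le_of_le _ fun i _ => (hsmall _ (hr.eval_eq_zero i)).le
    _ = d / (d + 1) * ε := by
        rw [Finset.sum_const, Finset.card_univ, Fintype.card_fin, nsmul_eq_mul]
        ring
    _ < ε := mul_lt_of_lt_one_left hε ((div_lt_one (by positivity)).2 (lt_add_one _))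

theorem IsPencil.tendsto_mul_pencilSum (h : IsPencil d F b)
    (hlead : F.coeff d ≠ 0 ∨ b.coeff d ≠ 0)
    (hF : F = (Polynomial.X - Polynomial.C μ₀) ^ (m + 2) * G) (hG : G.eval μ₀ ≠ 0)
    (hsimple : ∀ μ, μ ≠ μ₀ → F.eval μ = 0 → (derivative F).eval μ ≠ 0) :
    Tendsto (fun π => π * pencilSum d F b π) (𝓝[≠] 0) (𝓝 (simplePolarCoeff (m + 2) G b μ₀)) := by
  have hF0 : F.eval μ₀ = 0 := by simp [hF]
  have hF'0 : (derivative F).eval μ₀ = 0 := by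
    simp [hF, Polynomial.derivative_mul, Polynomial.derivative_X_sub_C_pow]
  have hb := h.eval_right_ne_zero μ₀ hF0
  have hFne : F ≠ 0 := by
    rw [hF]
    exact mul_ne_zero (pow_ne_zero _ (Polynomial.X_sub_C_ne_zero μ₀))
      fun hG0 => hG (by rw [hG0, Polynomial.eval_zero])
  obtain ⟨ρ, hρ⟩ : ∃ ρ, F.eval ρ ≠ 0 := by
    by_contra! hzero
    exact hFne (Polynomial.funext fun z => by rw [hzero z, Polynomial.eval_zero])
  have hreg := h.eventually_isRegularParam hlead
    (iterWronskian_one_ne_zero hF (by lia : m + 2 ≠ 0) hG hb)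
  have hrest := h.tendsto_mul_pencilSum_sub hreg hF0 hF'0 hρ
    (fun r => h.regularizedTerm_tendsto hF hG hsimple hρ)
    (h.coeff_ne_zero_or_regularizedTerm_tendsto hFne hlead)
  have hmain : Tendsto (fun π =>
      simplePolarCoeff (m + 2) G b μ₀ * (1 - π * (b.eval ρ / (pencil F b π).eval ρ))) (𝓝[≠] 0)
      (𝓝 (simplePolarCoeff (m + 2) G b μ₀ * (1 - 0 * (b.eval ρ / F.eval ρ)))) :=
    (((tendsto_id.mono_left nhdsWithin_le_nhds).mul
      (tendsto_const_nhds.div (tendsto_eval_pencil F b ρ) hρ)).const_sub 1).const_mul _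
  simpa using hrest.add hmain

end PencilSumResidue

/-! ### Curvature of the web of a pencil -/

section PunctureExtension

variable {f : ℂ → ℂ} {p₀ c L : ℂ}

theorem exists_analyticAt_of_tendsto (hf : ∀ᶠ p in 𝓝[≠] p₀, DifferentiableAt ℂ f p)
    (hc : Tendsto f (𝓝[≠] p₀) (𝓝 c)) :
    ∃ h : ℂ → ℂ, AnalyticAt ℂ h p₀ ∧ h p₀ = c ∧ ∀ p ≠ p₀, h p = f p := by
  have hne : ∀ p ≠ p₀, Function.update f p₀ c p = f p := fun p hp => Function.update_of_ne hp _ _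
  refine ⟨Function.update f p₀ c, ?_, Function.update_self .., hne⟩
  refine Complex.analyticAt_of_differentiable_on_punctured_nhds_of_continuousAt ?_
    (continuousAt_update_same.2 hc)
  filter_upwards [hf, self_mem_nhdsWithin] with p hp hpp₀
  refine hp.congr_of_eventuallyEq ?_
  filter_upwards [isOpen_ne.mem_nhds hpp₀] with w hw using hne w hw

theorem eventually_differentiableAt_sub_mul (hf : ∀ᶠ p in 𝓝[≠] p₀, DifferentiableAt ℂ f p) :
    ∀ᶠ p in 𝓝[≠] p₀, DifferentiableAt ℂ (fun p => (p - p₀) * f p) p :=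
  hf.mono fun _ hp => (differentiableAt_id.sub_const p₀).mul hp

theorem exists_analyticAt_of_tendsto_sub_mul (hf : ∀ᶠ p in 𝓝[≠] p₀, DifferentiableAt ℂ f p)
    (hc : Tendsto (fun p => (p - p₀) * f p) (𝓝[≠] p₀) (𝓝 0)) :
    ∃ h : ℂ → ℂ, AnalyticAt ℂ h p₀ ∧ ∀ p ≠ p₀, h p = f p := by
  obtain ⟨k, ⟨s, hs⟩, hk0, hk⟩ :=
    exists_analyticAt_of_tendsto (eventually_differentiableAt_sub_mul hf) hc
  refine ⟨dslope k p₀, hs.has_fpower_series_dslope_fslope.analyticAt, fun p hp => ?_⟩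
  rw [dslope_of_ne _ hp, slope_def_field, hk p hp, hk0, sub_zero,
    mul_div_cancel_left₀ _ (sub_ne_zero.2 hp)]

theorem eq_zero_of_tendsto_deriv (hf : ∀ᶠ p in 𝓝[≠] p₀, DifferentiableAt ℂ f p)
    (hc : Tendsto (fun p => (p - p₀) * f p) (𝓝[≠] p₀) (𝓝 c))
    (hL : Tendsto (deriv f) (𝓝[≠] p₀) (𝓝 L)) : c = 0 := by
  obtain ⟨h, han, -, hh⟩ :=
    exists_analyticAt_of_tendsto (eventually_differentiableAt_sub_mul hf) hc
  have hsub : Tendsto (fun p => p - p₀) (𝓝[≠] p₀) (𝓝 0) := by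
    simpa using ((continuous_id.sub continuous_const).tendsto (f := fun p => p - p₀) p₀).mono_left
      nhdsWithin_le_nhds
  have hderiv : ∀ᶠ p in 𝓝[≠] p₀,
      (p - p₀) * deriv h p = (p - p₀) * f p + (p - p₀) ^ 2 * deriv f p := by
    filter_upwards [hf, self_mem_nhdsWithin] with p hp hne
    have hev : h =ᶠ[𝓝 p] (fun p => p - p₀) * f := by
      filter_upwards [isOpen_ne.mem_nhds hne] with w hw using hh w hw
    have hmul : HasDerivAt ((fun p => p - p₀) * f) (1 * f p + (p - p₀) * deriv f p) p :=
      ((hasDerivAt_id p).sub_const p₀).mul hp.hasDerivAt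
    rw [hev.deriv_eq, hmul.deriv]
    ring
  have hleft : Tendsto (fun p => (p - p₀) * deriv h p) (𝓝[≠] p₀) (𝓝 (0 * deriv h p₀)) :=
    hsub.mul (han.deriv.continuousAt.tendsto.mono_left nhdsWithin_le_nhds)
  have hright : Tendsto (fun p => (p - p₀) * f p + (p - p₀) ^ 2 * deriv f p) (𝓝[≠] p₀)
      (𝓝 (c + 0 ^ 2 * L)) := hc.add ((hsub.pow 2).mul hL)
  simpa using (tendsto_nhds_unique hleft (hright.congr' (hderiv.mono fun _ hp => hp.symm))).symm

theorem tendsto_sub_nhdsNE (p₀ : ℂ) : Tendsto (fun p : ℂ => p - p₀) (𝓝[≠] p₀) (𝓝[≠] 0) := by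
  refine tendsto_nhdsWithin_iff.2 ⟨?_, ?_⟩
  · simpa using ((continuous_id.sub continuous_const).tendsto (f := fun p => p - p₀) p₀).mono_left
      nhdsWithin_le_nhds
  · filter_upwards [self_mem_nhdsWithin] with p hp using sub_ne_zero.2 hp

end PunctureExtension

section Homogenize

variable {R : Type*} [CommRing R]

theorem eval_homogenize_zero (d : ℕ) (φ : R[X]) (x : R) :
    eval ![x, 0] (φ.homogenize d) = φ.coeff d * x ^ d := by
  rw [Polynomial.homogenize, map_sum, Finset.sum_eq_single (d, 0)]
  · simp [eval_monomial, Finsupp.prod_fintype]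
  · rintro ⟨k, l⟩ hkl hne
    have hl : l ≠ 0 := fun hl => hne (by simp_all)
    simp [eval_monomial, Finsupp.prod_fintype, hl]
  · simp

theorem eval_homogenize_one {d : ℕ} {φ : R[X]} (hφ : φ.natDegree ≤ d) (x : R) :
    eval ![x, 1] (φ.homogenize d) = φ.eval x := by
  simpa using Polynomial.aeval_homogenize_of_eq_one hφ ![x, 1] rfl

theorem eval_homogenize_C_mul_prod {d : ℕ} (l : R) (r : Fin d → R) (x k : R) :
    eval ![x, k] ((Polynomial.C l * ∏ i, (Polynomial.X - Polynomial.C (r i))).homogenize d) =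
      l * ∏ i, (x - r i * k) := by
  have h := Polynomial.homogenize_finsetProd (s := Finset.univ) (n := fun _ => 1)
    fun i _ => Polynomial.natDegree_X_sub_C_le (r i)
  rw [Finset.sum_const, Finset.card_univ, Fintype.card_fin, smul_eq_mul, mul_one] at h
  simp [h, map_prod]

end Homogenize

section PencilWebs

/-- The web `W` is, in the coordinates `(p, q)`, the web of the roots of the pencil `F + π b`,
`π = p - p₀`: it is the superposition of the foliations `branchForm p₀ m = 0`, where `m p` runs
through the roots of `F + (p - p₀) b`, a root at infinity being allowed. -/
def IsPencilWeb (d : ℕ) (F b : ℂ[X]) (p₀ : ℂ) (W : ℂ × ℂ → ℂ × ℂ → ℂ) : Prop :=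
  ∀ z ξ : ℂ × ℂ, W z ξ = eval ![ξ.2, z.2 * ξ.1 - (z.1 - p₀) * ξ.2]
    ((pencil F b (z.1 - p₀)).homogenize d)

/-- The factor `ρ` in the presentation of `θ` as `ρ • branchForm p₀ m z`. -/
noncomputable def formScale (p₀ : ℂ) (z θ : ℂ × ℂ) : ℂ := -θ.2 - (z.1 - p₀) / z.2 * θ.1

/-- The slope `m` in the presentation of `θ` as `ρ • branchForm p₀ m z`. -/
noncomputable def formSlope (p₀ : ℂ) (z θ : ℂ × ℂ) : ℂ := θ.1 / (z.2 * formScale p₀ z θ)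

variable {d : ℕ} {F b : ℂ[X]} {p₀ p q : ℂ} {W : ℂ × ℂ → ℂ × ℂ → ℂ} {z θ : ℂ × ℂ}

theorem analyticAt_formScale {ω : ℂ × ℂ → ℂ × ℂ} (hω : AnalyticAt ℂ ω z) (hz : z.2 ≠ 0) :
    AnalyticAt ℂ (fun w => formScale p₀ w (ω w)) z :=
  (AnalyticAt.comp (g := Prod.snd) analyticAt_snd hω).neg.sub
    (((analyticAt_fst.sub analyticAt_const).div analyticAt_snd hz).mul
      (AnalyticAt.comp (g := Prod.fst) analyticAt_fst hω))

theorem analyticAt_formSlope {ω : ℂ × ℂ → ℂ × ℂ} (hω : AnalyticAt ℂ ω z) (hz : z.2 ≠ 0)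
    (hρ : formScale p₀ z (ω z) ≠ 0) : AnalyticAt ℂ (fun w => formSlope p₀ w (ω w)) z :=
  (AnalyticAt.comp (g := Prod.fst) analyticAt_fst hω).div
    (analyticAt_snd.mul (analyticAt_formScale hω hz)) (mul_ne_zero hz hρ)

theorem eq_formScale_smul_branchForm (hz : z.2 ≠ 0) (hρ : formScale p₀ z θ ≠ 0) :
    θ = formScale p₀ z θ • branchForm p₀ (fun _ => formSlope p₀ z θ) z := by
  have hfst : formScale p₀ z θ * formSlope p₀ z θ = θ.1 / z.2 := by
    rw [formSlope]
    field_simp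
  ext
  · simp only [branchForm, Prod.smul_fst, smul_eq_mul, ← mul_assoc, mul_comm _ z.2]
    rw [mul_assoc, hfst, mul_div_cancel₀ _ hz]
  · simp only [branchForm, Prod.smul_snd, smul_eq_mul]
    rw [show ∀ ρ π m : ℂ, ρ * -(1 + π * m) = -ρ - π * (ρ * m) by intros; ring, hfst, formScale]
    ring

namespace IsPencilWeb

theorem eq_mul_prod (hW : IsPencilWeb d F b p₀ W) {m : Fin d → ℂ → ℂ}
    (hm : HasDistinctRoots (pencil F b (z.1 - p₀)) fun i => m i z.1) (ξ : ℂ × ℂ) :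
    W z ξ = (-1) ^ d * (pencil F b (z.1 - p₀)).coeff d *
      ∏ i, ((branchForm p₀ (m i) z).1 * ξ.1 + (branchForm p₀ (m i) z).2 * ξ.2) := by
  have hform : ∀ i, ξ.2 - m i z.1 * (z.2 * ξ.1 - (z.1 - p₀) * ξ.2) =
      -1 * ((branchForm p₀ (m i) z).1 * ξ.1 + (branchForm p₀ (m i) z).2 * ξ.2) := fun i => by
    simp only [branchForm]
    ring
  rw [hW, hm.eq_prod, eval_homogenize_C_mul_prod, ← hm.eq_prod, Finset.prod_congr rfl
    fun i _ => hform i, Finset.prod_mul_distrib, Finset.prod_const, Finset.card_univ,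
    Fintype.card_fin]
  ring

theorem formScale_ne_zero (hW : IsPencilWeb d F b p₀ W) (hz : z.2 ≠ 0)
    (hc : (pencil F b (z.1 - p₀)).coeff d ≠ 0) {θ : Fin d → ℂ × ℂ} (hθ : Factors (W z) θ)
    (i : Fin d) : formScale p₀ z (θ i) ≠ 0 := by
  intro h0
  have hvanish : (θ i).1 * (z.1 - p₀) + (θ i).2 * z.2 = 0 := by
    rw [formScale] at h0
    field_simp at h0
    linear_combination -h0
  have hval := hθ.2 (z.1 - p₀, z.2)
  rw [Finset.prod_eq_zero (Finset.mem_univ i) hvanish, hW, mul_comm z.2, sub_self,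
    eval_homogenize_zero] at hval
  exact mul_ne_zero hc (pow_ne_zero _ hz) hval

theorem eval_pencil_formSlope (hW : IsPencilWeb d F b p₀ W) (h : IsPencil d F b) (hz : z.2 ≠ 0)
    {θ : Fin d → ℂ × ℂ} (hθ : Factors (W z) θ) {i : Fin d} (hρ : formScale p₀ z (θ i) ≠ 0) :
    (pencil F b (z.1 - p₀)).eval (formSlope p₀ z (θ i)) = 0 := by
  set m := formSlope p₀ z (θ i) with hm
  have hvanish : (θ i).1 * ((1 + (z.1 - p₀) * m) / z.2) + (θ i).2 * m = 0 := by
    rw [eq_formScale_smul_branchForm hz hρ, ← hm]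
    simp only [branchForm, Prod.smul_fst, Prod.smul_snd, smul_eq_mul]
    field_simp
    ring
  have hval := hθ.2 ((1 + (z.1 - p₀) * m) / z.2, m)
  rw [Finset.prod_eq_zero (Finset.mem_univ i) hvanish, hW, mul_div_cancel₀ _ hz,
    add_sub_cancel_right, eval_homogenize_one (h.natDegree_pencil_le _)] at hval
  exact hval

theorem hasDistinctRoots_formSlope (hW : IsPencilWeb d F b p₀ W) (h : IsPencil d F b)
    (hz : z.2 ≠ 0) (hc : (pencil F b (z.1 - p₀)).coeff d ≠ 0) {θ : Fin d → ℂ × ℂ}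
    (hθ : Factors (W z) θ) :
    HasDistinctRoots (pencil F b (z.1 - p₀)) fun i => formSlope p₀ z (θ i) := by
  have hρ := hW.formScale_ne_zero hz hc hθ
  refine HasDistinctRoots.of_eval_eq_zero (h.natDegree_pencil_le _) hc (fun i j hij => ?_)
    fun i => hW.eval_pencil_formSlope h hz hθ (hρ i)
  by_contra hne
  apply hθ.1 i j hne
  rw [eq_formScale_smul_branchForm hz (hρ i), eq_formScale_smul_branchForm hz (hρ j),
    wedge_smul_left, wedge_smul_right, wedge_branchForm, hij, sub_self, mul_zero, mul_zero,
    mul_zero]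

theorem eventually_coeff_ne_zero (hc : (pencil F b (z.1 - p₀)).coeff d ≠ 0) :
    ∀ᶠ w : ℂ × ℂ in 𝓝 z, (pencil F b (w.1 - p₀)).coeff d ≠ 0 :=
  ((continuous_coeff_pencil d F b p₀).comp continuous_fst).continuousAt.eventually_ne hc

theorem deriv_totalBranchTerm {m : Fin d → ℂ → ℂ}
    (hm : ∀ᶠ p in 𝓝 p, totalBranchTerm p₀ m p = -pencilSum d F b (p - p₀)) :
    -(deriv (totalBranchTerm p₀ m) p / q) = deriv (fun p => pencilSum d F b (p - p₀)) p / q := by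
  rw [EventuallyEq.deriv_eq hm, deriv.fun_neg, neg_div, neg_neg]

theorem eq_deriv_pencilSum_of_hasCurvatureNear (hW : IsPencilWeb d F b p₀ W) (h : IsPencil d F b)
    (hz : z.2 ≠ 0) (hc : (pencil F b (z.1 - p₀)).coeff d ≠ 0) {g : ℂ × ℂ → ℂ}
    (hg : HasCurvatureNear d W g z) :
    g z = deriv (fun p => pencilSum d F b (p - p₀)) z.1 / z.2 := by
  obtain ⟨V, ω, η, hV, hzV, hω, hfac, hη, hg⟩ := hg
  have hρ := hW.formScale_ne_zero hz hc (hfac z hzV)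
  obtain ⟨m, -, hmu, hm⟩ :=
    h.exists_root_branches (hW.hasDistinctRoots_formSlope h hz hc (hfac z hzV))
  have hweb : IsBranchWebAt m (fun i w => formScale p₀ w (ω i w)) z :=
    ⟨hm.self_of_nhds.1, hz, fun i => analyticAt_formScale (hω i z hzV) hz, hρ⟩
  have heq : ∀ i, ω i =ᶠ[𝓝 z] fun w => formScale p₀ w (ω i w) • branchForm p₀ (m i) w := by
    intro i
    have hslope : Tendsto (fun w => (w.1, formSlope p₀ w (ω i w))) (𝓝 z)
        (𝓝 (z.1, formSlope p₀ z (ω i z))) :=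
      continuous_fst.continuousAt.prodMk_nhds
        (analyticAt_formSlope (hω i z hzV) hz (hρ i)).continuousAt
    filter_upwards [hslope.eventually (hmu i), continuous_snd.continuousAt.eventually_ne hz,
      eventually_coeff_ne_zero hc, hV.mem_nhds hzV] with w hmw hw2 hcw hwV
    have hρw := hW.formScale_ne_zero hw2 hcw (hfac w hwV) i
    conv_lhs => rw [eq_formScale_smul_branchForm hw2 hρw]
    simp only [branchForm, hmw (hW.eval_pencil_formSlope h hw2 (hfac w hwV) hρw)]
  rw [hg z hzV, hweb.extD_sum_fundamentalForm hV (fun r s t hrs hst => (hη r s t hrs hst).2) hzV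
    heq, deriv_totalBranchTerm (hm.mono fun _ hp => hp.2.2)]

theorem analyticAt_pencilSum (h : IsPencil d F b) (hreg : IsRegularParam d F b (p - p₀)) :
    AnalyticAt ℂ (fun p => pencilSum d F b (p - p₀)) p := by
  obtain ⟨r, hr⟩ := hreg.exists_hasDistinctRoots h
  obtain ⟨m, -, -, hm⟩ := h.exists_root_branches hr
  refine (analyticAt_totalBranchTerm (p₀ := p₀) hm.self_of_nhds.1).neg.congr ?_
  filter_upwards [hm] with w hw
  rw [Pi.neg_apply, hw.2.2, neg_neg]

theorem eq_prod_mulSingle_smul {c : ℂ} {θ : Fin d → ℂ × ℂ} (i₀ : Fin d) (ξ : ℂ × ℂ) :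
    c * ∏ i, ((θ i).1 * ξ.1 + (θ i).2 * ξ.2) =
      ∏ i, (((Pi.mulSingle i₀ c : Fin d → ℂ) i • θ i).1 * ξ.1 +
        ((Pi.mulSingle i₀ c : Fin d → ℂ) i • θ i).2 * ξ.2) := by
  simp only [Prod.smul_fst, Prod.smul_snd, smul_eq_mul, mul_assoc, ← mul_add,
    Finset.prod_mul_distrib, Finset.prod_pi_mulSingle', Finset.mem_univ, if_true]

theorem isBranchWebAt_mulSingle {m : Fin d → ℂ → ℂ} (hsep : SeparatedAt m z.1) (hz : z.2 ≠ 0)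
    {c : ℂ → ℂ} (hc : AnalyticAt ℂ c z.1) (hc0 : c z.1 ≠ 0) (i₀ : Fin d) :
    IsBranchWebAt m (fun i w => (Pi.mulSingle i₀ (c w.1) : Fin d → ℂ) i) z := by
  refine ⟨hsep, hz, fun i => ?_, fun i => ?_⟩
  · rcases eq_or_ne i i₀ with rfl | hi
    · simp only [Pi.mulSingle_eq_same]
      exact hc.comp analyticAt_fst
    · simpa only [Pi.mulSingle_eq_of_ne hi] using analyticAt_const
  · rcases eq_or_ne i i₀ with rfl | hi
    · rwa [Pi.mulSingle_eq_same]
    · rw [Pi.mulSingle_eq_of_ne hi]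
      exact one_ne_zero

theorem hasCurvatureNear (hd : 0 < d) (hW : IsPencilWeb d F b p₀ W) (h : IsPencil d F b)
    (hz : z.2 ≠ 0) (hreg : IsRegularParam d F b (z.1 - p₀)) {g : ℂ × ℂ → ℂ}
    (hg : ∀ᶠ w in 𝓝 z, g w = deriv (fun p => pencilSum d F b (p - p₀)) w.1 / w.2) :
    HasCurvatureNear d W g z := by
  obtain ⟨r, hr⟩ := hreg.exists_hasDistinctRoots h
  obtain ⟨m, -, -, hm⟩ := h.exists_root_branches hr
  have hfst : Tendsto Prod.fst (𝓝 z) (𝓝 z.1) := continuous_fst.continuousAt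
  obtain ⟨V, hVsub, hV, hzV⟩ := eventually_nhds_iff.1 <| (hfst.eventually hm.eventually_nhds).and <|
    (continuous_snd.continuousAt.eventually_ne hz).and hg
  have hca : ∀ p, AnalyticAt ℂ (fun p => (-1) ^ d * (pencil F b (p - p₀)).coeff d) p := fun p => by
    simp only [coeff_pencil]
    fun_prop
  refine IsBranchWebAt.hasCurvatureNear (p₀ := p₀) hV (fun w hw =>
    isBranchWebAt_mulSingle (hVsub w hw).1.self_of_nhds.1 (hVsub w hw).2.1 (hca w.1)
      (mul_ne_zero (pow_ne_zero _ (neg_ne_zero.2 one_ne_zero))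
        (hVsub w hw).1.self_of_nhds.2.1.coeff_ne_zero) ⟨0, hd⟩)
    (fun w hw ξ => ?_) (fun w hw => ?_) hzV
  · rw [hW.eq_mul_prod (hVsub w hw).1.self_of_nhds.2.1, eq_prod_mulSingle_smul]
  · rw [deriv_totalBranchTerm ((hVsub w hw).1.mono fun _ hp => hp.2.2), (hVsub w hw).2.2]

theorem notMem_discriminant (hd : 0 < d) (hW : IsPencilWeb d F b p₀ W) (h : IsPencil d F b)
    (hz : z.2 ≠ 0) (hreg : IsRegularParam d F b (z.1 - p₀)) : z ∉ discriminant d W := by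
  obtain ⟨V, ω, -, -, hzV, -, hfac, -⟩ :=
    hW.hasCurvatureNear hd h hz hreg (Eventually.of_forall fun _ => rfl)
  exact fun hdisc => hdisc ⟨_, hfac z hzV⟩

end IsPencilWeb

theorem Factors.eval_derivative_ne_zero (hd : 2 ≤ d) {f : ℂ × ℂ → ℂ} {θ : Fin d → ℂ × ℂ}
    (hθ : Factors f θ) {φ : ℂ[X]} {s μ : ℂ} (hs : s ≠ 0) (hφ : ∀ x, f (s, x) = φ.eval x)
    (hμ : φ.eval μ = 0) : (derivative φ).eval μ ≠ 0 := by
  have : Nontrivial (Fin d) := Fin.nontrivial_iff_two_le.2 hd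
  let L : Fin d → ℂ[X] := fun i =>
    Polynomial.C ((θ i).1 * s) + Polynomial.C (θ i).2 * Polynomial.X
  have hL : ∀ i x, (L i).eval x = (θ i).1 * s + (θ i).2 * x := fun i x => by simp [L]
  have hprod : φ = ∏ i, L i := Polynomial.funext fun x => by
    simp_rw [← hφ, hθ.2, Polynomial.eval_prod, hL]
  obtain ⟨i, -, (hi : (L i).eval μ = 0)⟩ :=
    Finset.prod_eq_zero_iff.1 (by rwa [hprod, Polynomial.eval_prod] at hμ)
  have hwedge : ∀ j, j ≠ i → (θ i).2 * (L j).eval μ ≠ 0 := by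
    intro j hj h0
    refine hθ.1 i j hj.symm (mul_right_cancel₀ hs ?_)
    rw [hL] at hi h0
    simp only [wedge, zero_mul]
    linear_combination (θ j).2 * hi - h0
  rw [hprod, ← Finset.mul_prod_erase _ _ (Finset.mem_univ i), Polynomial.derivative_mul,
    Polynomial.eval_add, Polynomial.eval_mul, Polynomial.eval_mul, hi, zero_mul, add_zero,
    Polynomial.eval_prod]
  obtain ⟨j₀, hj₀⟩ := exists_ne i
  refine mul_ne_zero ?_ (Finset.prod_ne_zero_iff.2 fun j hj =>
    right_ne_zero_of_mul (hwedge j (Finset.ne_of_mem_erase hj)))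
  simpa [L] using left_ne_zero_of_mul (hwedge j₀ hj₀)

namespace IsPencilWeb

theorem mem_discriminant (hd : 2 ≤ d) (hW : IsPencilWeb d F b p₀ W) (hF : F.natDegree ≤ d)
    {μ : ℂ} (hμ : F.eval μ = 0) (hμ' : (derivative F).eval μ = 0) (hq : q ≠ 0) :
    (p₀, q) ∈ discriminant d W := by
  rintro ⟨θ, hθ⟩
  refine hθ.eval_derivative_ne_zero hd (inv_ne_zero hq) (fun x => ?_) hμ hμ'
  have hpencil : pencil F b 0 = F := by simp [pencil]
  rw [hW]
  simp only [sub_self, zero_mul, sub_zero, mul_inv_cancel₀ hq, hpencil]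
  exact eval_homogenize_one hF x

theorem eq_zero_of_curvatureHolomorphicAt {c : ℂ} (hd : 0 < d) (hW : IsPencilWeb d F b p₀ W)
    (h : IsPencil d F b) (hreg : ∀ᶠ p in 𝓝[≠] p₀, IsRegularParam d F b (p - p₀))
    (hlim : Tendsto (fun p => (p - p₀) * pencilSum d F b (p - p₀)) (𝓝[≠] p₀) (𝓝 c))
    (hq : q ≠ 0) (hcurv : CurvatureHolomorphicAt d W (p₀, q)) : c = 0 := by
  obtain ⟨N, g, hN, hqN, hg, hcurv⟩ := hcurv
  have hline : ContinuousAt (fun p : ℂ => (p, q)) p₀ := by fun_prop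
  have hderiv : ∀ᶠ p in 𝓝[≠] p₀, g (p, q) * q = deriv (fun p => pencilSum d F b (p - p₀)) p := by
    filter_upwards [hreg, (hline.eventually (hN.eventually_mem hqN)).filter_mono nhdsWithin_le_nhds]
      with p hp hpN
    rw [hW.eq_deriv_pencilSum_of_hasCurvatureNear (z := (p, q)) h hq hp.coeff_ne_zero
      (hcurv _ hpN (hW.notMem_discriminant hd h hq hp)), div_mul_cancel₀ _ hq]
  have hgq : Tendsto (fun p => g (p, q) * q) (𝓝[≠] p₀) (𝓝 (g (p₀, q) * q)) :=
    (((hg _ hqN).continuousAt.comp (f := fun p : ℂ => (p, q)) hline).mul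
      continuousAt_const).tendsto.mono_left nhdsWithin_le_nhds
  exact eq_zero_of_tendsto_deriv
    (hreg.mono fun p hp => (analyticAt_pencilSum h hp).differentiableAt) hlim (hgq.congr' hderiv)

theorem curvatureHolomorphicAt {μ : ℂ} (hd : 2 ≤ d) (hW : IsPencilWeb d F b p₀ W)
    (h : IsPencil d F b) (hμ : F.eval μ = 0) (hμ' : (derivative F).eval μ = 0)
    (hreg : ∀ᶠ p in 𝓝[≠] p₀, IsRegularParam d F b (p - p₀))
    (hlim : Tendsto (fun p => (p - p₀) * pencilSum d F b (p - p₀)) (𝓝[≠] p₀) (𝓝 0))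
    (hq : q ≠ 0) : CurvatureHolomorphicAt d W (p₀, q) := by
  obtain ⟨k, hk, hkeq⟩ := exists_analyticAt_of_tendsto_sub_mul
    (hreg.mono fun p hp => (analyticAt_pencilSum h hp).differentiableAt) hlim
  obtain ⟨U, hUsub, hU, hp₀U⟩ :=
    eventually_nhds_iff.1 (hk.eventually_analyticAt.and (eventually_nhdsWithin_iff.1 hreg))
  refine ⟨U ×ˢ {q | q ≠ 0}, fun z => deriv k z.1 / z.2, hU.prod isOpen_ne, ⟨hp₀U, hq⟩,
    fun z hz => ?_, fun z hz hdisc => ?_⟩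
  · have hk' : AnalyticAt ℂ (deriv k ∘ Prod.fst) z := (hUsub _ hz.1).1.deriv.comp analyticAt_fst
    exact hk'.div analyticAt_snd hz.2
  have hne : z.1 ≠ p₀ := by
    rintro rfl
    exact hdisc (hW.mem_discriminant hd h.natDegree_left_le hμ hμ' hz.2)
  refine hW.hasCurvatureNear (by lia) h hz.2 ((hUsub _ hz.1).2 hne) ?_
  filter_upwards [continuous_fst.continuousAt.eventually_ne hne] with w hw
  have hev : k =ᶠ[𝓝 w.1] fun p => pencilSum d F b (p - p₀) := by
    filter_upwards [isOpen_ne.mem_nhds hw] with p hp using hkeq p hp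
  rw [hev.deriv_eq]

theorem curvatureHolomorphicAt_iff {μ c : ℂ} (hd : 2 ≤ d) (hW : IsPencilWeb d F b p₀ W)
    (h : IsPencil d F b) (hμ : F.eval μ = 0) (hμ' : (derivative F).eval μ = 0)
    (hreg : ∀ᶠ π in 𝓝[≠] 0, IsRegularParam d F b π)
    (hlim : Tendsto (fun π => π * pencilSum d F b π) (𝓝[≠] 0) (𝓝 c)) (hq : q ≠ 0) :
    CurvatureHolomorphicAt d W (p₀, q) ↔ c = 0 := by
  have hreg' := (tendsto_sub_nhdsNE p₀).eventually hreg
  have hlim' := hlim.comp (tendsto_sub_nhdsNE p₀)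
  refine ⟨hW.eq_zero_of_curvatureHolomorphicAt (by lia) h hreg' hlim' hq, ?_⟩
  rintro rfl
  exact hW.curvatureHolomorphicAt hd h hμ hμ' hreg' hlim' hq

end IsPencilWeb

end PencilWebs

theorem simplePolarCoeff_C_mul (m : ℕ) {c : ℂ} (hc : c ≠ 0) (G b : ℂ[X]) (μ₀ : ℂ) :
    simplePolarCoeff m (Polynomial.C c * G) b μ₀ = simplePolarCoeff m G b μ₀ := by
  rw [simplePolarCoeff, simplePolarCoeff, Polynomial.derivative_C_mul, Polynomial.eval_C_mul,
    Polynomial.eval_C_mul, mul_div_mul_left _ _ hc]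

theorem simplePolarCoeff_eq_zero_iff (n : ℕ) {G b : ℂ[X]} {μ₀ : ℂ} (hG : G.eval μ₀ ≠ 0)
    (hb : b.eval μ₀ ≠ 0) : simplePolarCoeff (n + 2) G b μ₀ = 0 ↔
      n * (derivative b).eval μ₀ * G.eval μ₀ +
        2 * (n + 3) * (derivative G).eval μ₀ * b.eval μ₀ = 0 := by
  have hn₁ : (n : ℂ) + 1 ≠ 0 := Nat.cast_add_one_ne_zero n
  have hn₂ : (n : ℂ) + 2 ≠ 0 := by exact_mod_cast (n + 1).succ_ne_zero
  have hcoeff : simplePolarCoeff (n + 2) G b μ₀ =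
      -((n + 1) / (6 * (n + 2) * (G.eval μ₀ * b.eval μ₀))) *
        (n * (derivative b).eval μ₀ * G.eval μ₀ +
          2 * (n + 3) * (derivative G).eval μ₀ * b.eval μ₀) := by
    rw [simplePolarCoeff]
    push_cast
    field_simp
    ring
  rw [hcoeff, mul_eq_zero_iff_left]
  exact neg_ne_zero.2 (div_ne_zero hn₁
    (mul_ne_zero (mul_ne_zero (by norm_num) hn₂) (mul_ne_zero hG hb)))

theorem IsPencilWeb.curvatureHolomorphicAt_iff_simplePolarCoeff {d m : ℕ} {F G b : ℂ[X]}
    {p₀ q μ₀ : ℂ} {W : ℂ × ℂ → ℂ × ℂ → ℂ} (hd : 2 ≤ d) (hW : IsPencilWeb d F b p₀ W)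
    (h : IsPencil d F b) (hlead : F.coeff d ≠ 0 ∨ b.coeff d ≠ 0)
    (hF : F = (Polynomial.X - Polynomial.C μ₀) ^ (m + 2) * G) (hG : G.eval μ₀ ≠ 0)
    (hsimple : ∀ μ, μ ≠ μ₀ → F.eval μ = 0 → (derivative F).eval μ ≠ 0) (hq : q ≠ 0) :
    CurvatureHolomorphicAt d W (p₀, q) ↔ simplePolarCoeff (m + 2) G b μ₀ = 0 := by
  have hroot : F.eval μ₀ = 0 := by simp [hF]
  have hdouble : (derivative F).eval μ₀ = 0 := by
    simp [hF, Polynomial.derivative_mul, Polynomial.derivative_X_sub_C_pow]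
  have hW₁ : iterWronskian 1 F b ≠ 0 :=
    iterWronskian_one_ne_zero hF (Nat.succ_ne_zero _) hG (h.eval_right_ne_zero μ₀ hroot)
  exact hW.curvatureHolomorphicAt_iff hd h hroot hdouble (h.eventually_isRegularParam hlead hW₁)
    (h.tendsto_mul_pencilSum hlead hF hG hsimple) hq

/-! ### Plane vectors and binary forms -/

section PlaneVectors

variable {K : Type*} [Field K]

theorem mem_span_singleton_of_det_eq_zero {u w : Fin 2 → K} (hu : u ≠ 0)
    (h : w 0 * u 1 = w 1 * u 0) : w ∈ Submodule.span K {u} := by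
  obtain ⟨i, hi⟩ := Function.ne_iff.1 hu
  refine Submodule.mem_span_singleton.2 ⟨w i / u i, funext fun j => ?_⟩
  rw [Pi.smul_apply, smul_eq_mul, div_mul_eq_mul_div, div_eq_iff hi]
  fin_cases i <;> fin_cases j
  exacts [rfl, h, h.symm, rfl]

theorem exists_smul_pair_of_mul_eq_mul {u₀ u₁ w₀ w₁ : K}
    (hu : ![u₀, u₁] ≠ 0) (h : w₀ * u₁ = w₁ * u₀) : ∃ c, c * u₀ = w₀ ∧ c * u₁ = w₁ := by
  obtain ⟨c, hc⟩ := Submodule.mem_span_singleton.1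
    (mem_span_singleton_of_det_eq_zero (w := ![w₀, w₁]) hu h)
  exact ⟨c, congrFun hc 0, congrFun hc 1⟩

theorem mul_eq_mul_of_mul_eq_mul {u₀ u₁ v₀ v₁ w₀ w₁ : K}
    (hu : ![u₀, u₁] ≠ 0) (hv : v₀ * u₁ = v₁ * u₀) (hw : w₀ * u₁ = w₁ * u₀) :
    v₀ * w₁ = v₁ * w₀ := by
  obtain ⟨r, rfl, rfl⟩ := exists_smul_pair_of_mul_eq_mul hu hv
  obtain ⟨s, rfl, rfl⟩ := exists_smul_pair_of_mul_eq_mul hu hw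
  ring

end PlaneVectors

section BinaryForms

variable {R σ : Type*} [CommRing R] {m n : ℕ}

theorem eval_smul_of_isHomogeneous {f : MvPolynomial σ R} (hf : f.IsHomogeneous n) (k : R)
    (w : σ → R) : eval (k • w) f = k ^ n * eval w f := by
  rw [eval_eq, eval_eq, Finset.mul_sum]
  refine Finset.sum_congr rfl fun s hs => ?_
  simp only [Pi.smul_apply, smul_eq_mul, mul_pow]
  rw [Finset.prod_mul_distrib, Finset.prod_pow_eq_pow_sum, ← hf.degree_eq_sum_deg_support hs]
  ring

theorem smul_eval_pderiv_of_isHomogeneous {f : MvPolynomial σ R} (hf : f.IsHomogeneous n) (i : σ)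
    (k : R) (w : σ → R) : k * eval (k • w) (pderiv i f) = k ^ n * eval w (pderiv i f) := by
  rw [eval_smul_of_isHomogeneous hf.pderiv]
  rcases n with _ | n
  · rw [totalDegree_eq_zero_iff_eq_C.1 ((totalDegree_zero_iff_isHomogeneous σ).2 hf), pderiv_C,
      map_zero, mul_zero, mul_zero]
  · rw [Nat.add_sub_cancel, ← mul_assoc, pow_succ']

theorem eval_pair_mul {f : MvPolynomial (Fin 2) R} (hf : f.IsHomogeneous n) (k x y : R) :
    eval ![k * x, k * y] f = k ^ n * eval ![x, y] f := by
  simpa only [Matrix.smul_cons, smul_eq_mul, Matrix.smul_empty] using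
    eval_smul_of_isHomogeneous hf k ![x, y]

theorem mul_eval_pderiv_pair_mul {f : MvPolynomial (Fin 2) R} (hf : f.IsHomogeneous n) (i : Fin 2)
    (k x y : R) :
    k * eval ![k * x, k * y] (pderiv i f) = k ^ n * eval ![x, y] (pderiv i f) := by
  simpa only [Matrix.smul_cons, smul_eq_mul, Matrix.smul_empty] using
    smul_eval_pderiv_of_isHomogeneous hf i k ![x, y]

theorem euler_identity {f : MvPolynomial (Fin 2) R} (hf : f.IsHomogeneous n) :
    X 0 * pderiv 0 f + X 1 * pderiv 1 f = (n : MvPolynomial (Fin 2) R) * f := by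
  rw [← nsmul_eq_mul, ← hf.sum_X_mul_pderiv, Fin.sum_univ_two]

theorem eval_euler_identity {f : MvPolynomial (Fin 2) R} (hf : f.IsHomogeneous n) (x y : R) :
    x * eval ![x, y] (pderiv 0 f) + y * eval ![x, y] (pderiv 1 f) = n * eval ![x, y] f := by
  simpa using congrArg (eval ![x, y]) (euler_identity hf)

/-- The restriction of a polynomial in two variables to the line `y = p x - 1`, parametrized by
`x`. -/
noncomputable def restrictLine (p : R) : MvPolynomial (Fin 2) R →ₐ[R] R[X] :=
  aeval ![Polynomial.X, Polynomial.C p * Polynomial.X - 1]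

theorem restrictLine_X_zero (p : R) : restrictLine p (X 0) = Polynomial.X := by
  simp [restrictLine]

theorem restrictLine_X_one (p : R) :
    restrictLine p (X 1) = Polynomial.C p * Polynomial.X - 1 := by
  simp [restrictLine]

theorem restrictLine_C (p c : R) : restrictLine p (C c) = Polynomial.C c := by
  simp [restrictLine]

theorem eval_restrictLine (p : R) (f : MvPolynomial (Fin 2) R) (μ : R) :
    (restrictLine p f).eval μ = eval ![μ, p * μ - 1] f := by
  rw [← Polynomial.coe_aeval_eq_eval, ← coe_aeval_eq_eval, RingHom.coe_coe]
  refine DFunLike.congr_fun (F := MvPolynomial (Fin 2) R →ₐ[R] R)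
    (f := (Polynomial.aeval μ).comp (restrictLine p)) (algHom_ext fun i => ?_) f
  fin_cases i <;> simp [restrictLine]

theorem derivative_restrictLine (p : R) (f : MvPolynomial (Fin 2) R) :
    derivative (restrictLine p f) =
      restrictLine p (pderiv 0 f) + Polynomial.C p * restrictLine p (pderiv 1 f) := by
  induction f using MvPolynomial.induction_on with
  | C c => simp
  | add f g hf hg =>
    simp only [map_add, hf, hg]
    ring
  | mul_X f i hf =>
    fin_cases i
    · simp only [Fin.zero_eta, map_mul, restrictLine_X_zero, Polynomial.derivative_mul, hf,
        Polynomial.derivative_X, mul_one, Derivation.leibniz, pderiv_X, Pi.single_eq_same,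
        smul_eq_mul, map_add, ne_eq, zero_ne_one, not_false_eq_true, Pi.single_eq_of_ne, mul_zero,
        zero_add]
      ring
    · simp only [Fin.mk_one, map_mul, restrictLine_X_one, Polynomial.derivative_mul, hf,
        Polynomial.derivative_sub, Polynomial.derivative_C, zero_mul, Polynomial.derivative_X,
        mul_one, zero_add, Polynomial.derivative_one, sub_zero, Derivation.leibniz, pderiv_X,
        ne_eq, one_ne_zero, not_false_eq_true, Pi.single_eq_of_ne, smul_eq_mul, mul_zero,
        Pi.single_eq_same, map_add]
      ring

theorem natDegree_restrictLine_le {f : MvPolynomial (Fin 2) R} (hf : f.IsHomogeneous n) (p : R) :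
    (restrictLine p f).natDegree ≤ n := by
  refine (aeval_natDegree_le (n := 1) f hf.totalDegree_le _ fun i => ?_).trans_eq (mul_one n)
  fin_cases i
  · exact Polynomial.natDegree_X_le
  · change (Polynomial.C p * Polynomial.X - 1).natDegree ≤ 1
    compute_degree

theorem homogenize_restrictLine {f : MvPolynomial (Fin 2) R} (hf : f.IsHomogeneous n) (p : R) :
    (restrictLine p f).homogenize n = aeval ![X 0, C p * X 0 - X 1] f := by
  have hlin : ∀ i, (![X 0, C p * X 0 - X 1] i : MvPolynomial (Fin 2) R).IsHomogeneous 1 := by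
    intro i
    fin_cases i
    · exact isHomogeneous_X R 0
    · exact (isHomogeneous_C_mul_X p 0).sub (isHomogeneous_X R 1)
  have hhom := hf.aeval _ hlin
  rw [one_mul] at hhom
  refine Polynomial.homogenize_eq_of_isHomogeneous hhom ?_
  have hcomp : (aeval ![Polynomial.X, 1]).comp
      (aeval ![X 0, C p * X 0 - X 1] : MvPolynomial (Fin 2) R →ₐ[R] MvPolynomial (Fin 2) R) =
        restrictLine p := by
    refine algHom_ext fun i => ?_
    fin_cases i <;> simp [restrictLine]
  exact DFunLike.congr_fun hcomp f

theorem eval_homogenize_restrictLine {f : MvPolynomial (Fin 2) R} (hf : f.IsHomogeneous n)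
    (p x k : R) : eval ![x, k] ((restrictLine p f).homogenize n) = eval ![x, p * x - k] f := by
  rw [homogenize_restrictLine hf, ← coe_aeval_eq_eval, ← coe_aeval_eq_eval, RingHom.coe_coe,
    RingHom.coe_coe]
  refine DFunLike.congr_fun (F := MvPolynomial (Fin 2) R →ₐ[R] R)
    (f := (aeval ![x, k]).comp (aeval ![X 0, C p * X 0 - X 1])) (algHom_ext fun i => ?_) f
  fin_cases i <;> simp

theorem coeff_restrictLine {f : MvPolynomial (Fin 2) R} (hf : f.IsHomogeneous n) (p : R) :
    (restrictLine p f).coeff n = eval ![1, p] f := by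
  have h := eval_homogenize_restrictLine hf p 1 0
  rwa [eval_homogenize_zero, one_pow, mul_one, mul_one, sub_zero] at h

theorem eval_pair_restrictLine {f : MvPolynomial (Fin 2) R} (hf : f.IsHomogeneous n) {p k μ x y : R}
    (hx : k * μ = x) (hy : k * (p * μ - 1) = y) :
    eval ![x, y] f = k ^ n * (restrictLine p f).eval μ := by
  rw [eval_restrictLine, ← eval_pair_mul hf, hx, hy]

theorem eval_pderiv_pair_restrictLine {f : MvPolynomial (Fin 2) R} (hf : f.IsHomogeneous n)
    {p k μ x y : R} (hx : k * μ = x) (hy : k * (p * μ - 1) = y) :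
    k * (eval ![x, y] (pderiv 0 f) + p * eval ![x, y] (pderiv 1 f)) =
      k ^ n * (derivative (restrictLine p f)).eval μ := by
  have h₀ := mul_eval_pderiv_pair_mul hf 0 k μ (p * μ - 1)
  have h₁ := mul_eval_pderiv_pair_mul hf 1 k μ (p * μ - 1)
  rw [hx, hy] at h₀ h₁
  rw [derivative_restrictLine, Polynomial.eval_add, Polynomial.eval_mul, Polynomial.eval_C,
    eval_restrictLine, eval_restrictLine]
  linear_combination h₀ + p * h₁

theorem eval_pderiv_eq_zero_of_restrictLine {f : MvPolynomial (Fin 2) R} (hf : f.IsHomogeneous n)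
    {p μ : R} (h₀ : (restrictLine p f).eval μ = 0)
    (h₁ : (derivative (restrictLine p f)).eval μ = 0) (i : Fin 2) :
    eval ![μ, p * μ - 1] (pderiv i f) = 0 := by
  have heuler := eval_euler_identity hf μ (p * μ - 1)
  rw [eval_restrictLine] at h₀
  rw [derivative_restrictLine, Polynomial.eval_add, Polynomial.eval_mul, Polynomial.eval_C,
    eval_restrictLine, eval_restrictLine] at h₁
  have hone : eval ![μ, p * μ - 1] (pderiv 1 f) = 0 := by
    linear_combination μ * h₁ - heuler - n * h₀
  have hzero : eval ![μ, p * μ - 1] (pderiv 0 f) = 0 := by linear_combination h₁ - p * hone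
  fin_cases i
  exacts [hzero, hone]

end BinaryForms

section LinearForms

variable {a b : ℂ}

theorem isHomogeneous_linForm (a b : ℂ) : (linForm a b).IsHomogeneous 1 :=
  (isHomogeneous_C_mul_X a 0).add (isHomogeneous_C_mul_X b 1)

theorem eval_linForm (a b x y : ℂ) : eval ![x, y] (linForm a b) = a * x + b * y := by
  simp [linForm]

theorem pderiv_zero_linForm (a b : ℂ) : pderiv 0 (linForm a b) = C a := by
  simp [linForm, pderiv_X]

theorem pderiv_one_linForm (a b : ℂ) : pderiv 1 (linForm a b) = C b := by
  simp [linForm, pderiv_X]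

theorem linForm_neg_neg (a b : ℂ) : linForm (-a) (-b) = -linForm a b := by
  simp only [linForm, map_neg]
  ring

theorem linForm_ne_zero (hv : ![b, -a] ≠ 0) : linForm a b ≠ 0 := by
  intro h
  have ha := congrArg (eval ![1, 0]) h
  have hb := congrArg (eval ![0, 1]) h
  simp only [eval_linForm, mul_one, mul_zero, add_zero, zero_add, map_zero] at ha hb
  exact hv (by simp [ha, hb])

theorem linForm_dvd_of_eval_eq_zero {n : ℕ} {f : MvPolynomial (Fin 2) ℂ} (hf : f.IsHomogeneous n)
    (hv : ![b, -a] ≠ 0) (h : eval ![b, -a] f = 0) : linForm a b ∣ f := by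
  simpa only [linForm_neg_neg, neg_dvd] using HomogeneousFoliation.linForm_dvd hf hv h

theorem eval_eq_zero_of_linForm_dvd {f : MvPolynomial (Fin 2) ℂ} (h : linForm a b ∣ f) :
    eval ![b, -a] f = 0 := by
  obtain ⟨g, rfl⟩ := h
  rw [map_mul, eval_linForm]
  ring

theorem isHomogeneous_of_mul {σ : Type*} {m n : ℕ} {l g : MvPolynomial σ ℂ}
    (hl : l.IsHomogeneous m) (hl₀ : l ≠ 0) (hlg : (l * g).IsHomogeneous (m + n)) :
    g.IsHomogeneous n := by
  let := gradedAlgebra (σ := σ) (R := ℂ)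
  have hcomponent : ∀ (k : ℕ) (f : MvPolynomial σ ℂ),
      (DirectSum.decompose (homogeneousSubmodule σ ℂ) f k : MvPolynomial σ ℂ) =
        homogeneousComponent k f := fun k f => decomposition.decompose'_apply f k
  have hmul := DirectSum.coe_decompose_mul_add_of_left_mem (homogeneousSubmodule σ ℂ) (i := m)
    (j := n) (b := g) ((mem_homogeneousSubmodule m l).2 hl)
  rw [hcomponent, hcomponent, homogeneousComponent_eq_self hlg] at hmul
  rw [mul_left_cancel₀ hl₀ hmul]
  exact homogeneousComponent_isHomogeneous n g

theorem exists_linForm_pow_mul (hv : ![b, -a] ≠ 0) {n : ℕ} {f : MvPolynomial (Fin 2) ℂ}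
    (hf : f.IsHomogeneous n) (hf₀ : f ≠ 0) :
    ∃ (k e : ℕ) (P : MvPolynomial (Fin 2) ℂ), P.IsHomogeneous e ∧ f = linForm a b ^ k * P ∧
      eval ![b, -a] P ≠ 0 := by
  obtain ⟨P, hfP, hP⟩ := (FiniteMultiplicity.of_not_isUnit
    (HomogeneousFoliation.not_isUnit_linForm a b) hf₀).exists_eq_pow_mul_and_not_dvd
  set k := multiplicity (linForm a b) f
  have hl : (linForm a b ^ k).IsHomogeneous k := by
    simpa only [one_mul] using (isHomogeneous_linForm a b).pow k
  have hl₀ : linForm a b ^ k ≠ 0 := pow_ne_zero _ (linForm_ne_zero hv)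
  have hP₀ : P ≠ 0 := by
    rintro rfl
    exact hP (dvd_zero _)
  have hkn : k + P.totalDegree = n := by
    rw [← hf.totalDegree hf₀, hfP, totalDegree_mul_of_isDomain hl₀ hP₀, hl.totalDegree hl₀]
  have hPhom : P.IsHomogeneous P.totalDegree := isHomogeneous_of_mul hl hl₀ (by rwa [hkn, ← hfP])
  exact ⟨k, _, P, hPhom, hfP, fun h => hP (linForm_dvd_of_eval_eq_zero hPhom hv h)⟩

theorem emultiplicity_linForm (hv : ![b, -a] ≠ 0) {k : ℕ} {c : ℂ} (hc : c ≠ 0)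
    {f S : MvPolynomial (Fin 2) ℂ} (hf : C c * f = linForm a b ^ k * S)
    (hS : eval ![b, -a] S ≠ 0) : emultiplicity (linForm a b) f = k := by
  have hunit : IsUnit (C c : MvPolynomial (Fin 2) ℂ) :=
    (isUnit_iff_ne_zero.2 hc).map (C : ℂ →+* MvPolynomial (Fin 2) ℂ)
  rw [emultiplicity_eq_coe, ← hunit.dvd_mul_left, ← hunit.dvd_mul_left (b := f), hf]
  refine ⟨dvd_mul_right _ _, fun h => hS (eval_eq_zero_of_linForm_dvd ?_)⟩
  rwa [pow_succ, mul_dvd_mul_iff_left (pow_ne_zero _ (linForm_ne_zero hv))] at h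

/-- The Jacobian determinant `∂(f, g) / ∂(x, y)`, which vanishes where the rational map `[f : g]`
ramifies when `f` and `g` are binary forms of the same degree. -/
noncomputable def jacobianDet (f g : MvPolynomial (Fin 2) ℂ) : MvPolynomial (Fin 2) ℂ :=
  pderiv 0 f * pderiv 1 g - pderiv 1 f * pderiv 0 g

theorem exists_jacobianDet_linForm_pow_mul {k n : ℕ} {P D : MvPolynomial (Fin 2) ℂ}
    (hD : D.IsHomogeneous n) (hn : n ≠ 0) (hDv : eval ![b, -a] D ≠ 0) (hPv : eval ![b, -a] P ≠ 0) :
    ∃ S, jacobianDet (linForm a b ^ (k + 1) * P) D = linForm a b ^ k * S ∧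
      eval ![b, -a] S ≠ 0 := by
  refine ⟨((k + 1 : ℕ) : MvPolynomial (Fin 2) ℂ) * P * (C a * pderiv 1 D - C b * pderiv 0 D) +
    linForm a b * jacobianDet P D, ?_, fun h => ?_⟩
  · simp only [jacobianDet, pderiv_mul, pderiv_pow, pderiv_zero_linForm, pderiv_one_linForm,
      Nat.add_sub_cancel]
    ring
  · simp only [map_add, map_mul, map_sub, map_natCast, eval_C, eval_linForm] at h
    have heuler := eval_euler_identity hD b (-a)
    have hprod : ((k + 1 : ℕ) : ℂ) * eval ![b, -a] P * (n * eval ![b, -a] D) = 0 := by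
      linear_combination -h - ((k + 1 : ℕ) : ℂ) * eval ![b, -a] P * heuler
    exact mul_ne_zero (mul_ne_zero (Nat.cast_ne_zero.2 k.succ_ne_zero) hPv)
      (mul_ne_zero (Nat.cast_ne_zero.2 hn) hDv) hprod

theorem restrictLine_linForm {p : ℂ} (hp : a + b * p ≠ 0) :
    restrictLine p (linForm a b) =
      Polynomial.C (a + b * p) * (Polynomial.X - Polynomial.C (b / (a + b * p))) := by
  rw [linForm, map_add, map_mul, map_mul, restrictLine_C, restrictLine_C, restrictLine_X_zero,
    restrictLine_X_one, mul_sub (Polynomial.C (a + b * p)), ← Polynomial.C_mul,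
    mul_div_cancel₀ _ hp, Polynomial.C_add, Polynomial.C_mul]
  ring

end LinearForms

end PlanarWeb

namespace HomogeneousFoliation

open PlanarWeb
open scoped Polynomial Topology
open Polynomial (derivative)

/-! ### Fibres of the Gauss map -/

section Swap

/-- The exchange of the two variables of a polynomial. -/
noncomputable def swapVars : MvPolynomial (Fin 2) ℂ →ₐ[ℂ] MvPolynomial (Fin 2) ℂ :=
  rename (Equiv.swap 0 1)

theorem swapVars_C (c : ℂ) : swapVars (C c) = C c := rename_C _ c

theorem swapVars_swapVars (f : MvPolynomial (Fin 2) ℂ) : swapVars (swapVars f) = f := by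
  rw [swapVars, rename_rename, ← Equiv.coe_trans, Equiv.swap_swap, Equiv.coe_refl, rename_id_apply]

theorem eval_swapVars (f : MvPolynomial (Fin 2) ℂ) (x y : ℂ) :
    eval ![x, y] (swapVars f) = eval ![y, x] f := by
  have hswap : ![x, y] ∘ Equiv.swap 0 1 = ![y, x] := by
    funext i
    fin_cases i <;> rfl
  rw [swapVars, eval_rename, hswap]

theorem pderiv_zero_swapVars (f : MvPolynomial (Fin 2) ℂ) :
    pderiv 0 (swapVars f) = swapVars (pderiv 1 f) := by
  simpa only [swapVars, Equiv.swap_apply_right] using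
    pderiv_rename (Equiv.swap (0 : Fin 2) 1).injective 1 f

theorem pderiv_one_swapVars (f : MvPolynomial (Fin 2) ℂ) :
    pderiv 1 (swapVars f) = swapVars (pderiv 0 f) := by
  simpa only [swapVars, Equiv.swap_apply_left] using
    pderiv_rename (Equiv.swap (0 : Fin 2) 1).injective 0 f

theorem swapVars_linForm (a b : ℂ) : swapVars (linForm a b) = linForm b a := by
  simp only [swapVars, linForm, map_add, map_mul, rename_C, rename_X, Equiv.swap_apply_left,
    Equiv.swap_apply_right]
  ring

variable {d : ℕ} (H : HomogeneousFoliation d)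

/-- The foliation obtained by exchanging the coordinates `x` and `y`; it exchanges the two charts
of the dual plane. -/
noncomputable def swap : HomogeneousFoliation d where
  A := swapVars H.B
  B := swapVars H.A
  homogeneous_A := H.homogeneous_B.rename_isHomogeneous
  homogeneous_B := H.homogeneous_A.rename_isHomogeneous
  gcd_eq_one f hB hA := by
    have hunit : IsUnit (swapVars f) := H.gcd_eq_one
      (by simpa only [swapVars_swapVars] using map_dvd swapVars hA)
      (by simpa only [swapVars_swapVars] using map_dvd swapVars hB)
    simpa only [swapVars_swapVars] using hunit.map swapVars

theorem eval_swap_A (x y : ℂ) : eval ![x, y] H.swap.A = eval ![y, x] H.B := eval_swapVars H.B x y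

theorem eval_swap_B (x y : ℂ) : eval ![x, y] H.swap.B = eval ![y, x] H.A := eval_swapVars H.A x y

theorem leg₁_swap : H.swap.leg₁ = H.leg₂ := by
  funext m ξ
  rw [leg₁, leg₂, eval_swap_A, eval_swap_B, add_comm]

theorem fiberPoly_swap (a b : ℂ) :
    H.swap.fiberPoly (-b) (-a) = -swapVars (H.fiberPoly a b) := by
  rw [fiberPoly, fiberPoly, neg_neg, eval_swap_A, eval_swap_B, map_sub, map_mul, map_mul,
    swapVars_C, swapVars_C]
  simp only [swap]
  ring

theorem criterionPoly_swap (ν : ℕ) (c : ℂ) (P : MvPolynomial (Fin 2) ℂ) :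
    H.swap.criterionPoly ν (C c * swapVars P) = -(C c * swapVars (H.criterionPoly ν P)) := by
  simp only [criterionPoly, swap, pderiv_C_mul, pderiv_zero_swapVars, pderiv_one_swapVars, map_add,
    map_sub, map_mul, swapVars_C]
  ring

end Swap

section FiberPoly

variable {d : ℕ} (H : HomogeneousFoliation d) {a b : ℂ}

theorem eval_B_ne_zero_of_eval_A_eq_zero {x y : ℂ} (hv : ![x, y] ≠ 0)
    (hA : eval ![x, y] H.A = 0) : eval ![x, y] H.B ≠ 0 := fun hB =>
  not_isUnit_linForm _ _
    (H.gcd_eq_one (linForm_dvd H.homogeneous_A hv hA) (linForm_dvd H.homogeneous_B hv hB))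

theorem isHomogeneous_fiberPoly (a b : ℂ) : (H.fiberPoly a b).IsHomogeneous d := by
  rw [fiberPoly, mul_comm]
  exact (H.homogeneous_A.C_mul _).sub (H.homogeneous_B.C_mul _)

theorem eval_fiberPoly (a b x y : ℂ) : eval ![x, y] (H.fiberPoly a b) =
    eval ![x, y] H.A * eval ![b, -a] H.B - eval ![b, -a] H.A * eval ![x, y] H.B := by
  rw [fiberPoly, map_sub, map_mul, map_mul, eval_C, eval_C]

theorem pderiv_fiberPoly (a b : ℂ) (i : Fin 2) : pderiv i (H.fiberPoly a b) =
    C (eval ![b, -a] H.B) * pderiv i H.A - C (eval ![b, -a] H.A) * pderiv i H.B := by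
  rw [fiberPoly, mul_comm, map_sub, pderiv_C_mul, pderiv_C_mul]

theorem jacobianDet_fiberPoly_A (a b : ℂ) : jacobianDet (H.fiberPoly a b) H.A =
    C (eval ![b, -a] H.A) * jacobianDet H.A H.B := by
  rw [jacobianDet, jacobianDet, pderiv_fiberPoly, pderiv_fiberPoly]
  ring

theorem jacobianDet_fiberPoly_B (a b : ℂ) : jacobianDet (H.fiberPoly a b) H.B =
    C (eval ![b, -a] H.B) * jacobianDet H.A H.B := by
  rw [jacobianDet, jacobianDet, pderiv_fiberPoly, pderiv_fiberPoly]
  ring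

theorem exists_jacobianDet_fiberPoly_eq (hv : ![b, -a] ≠ 0) :
    ∃ (D : MvPolynomial (Fin 2) ℂ) (c : ℂ), D.IsHomogeneous d ∧ eval ![b, -a] D ≠ 0 ∧ c ≠ 0 ∧
      jacobianDet (H.fiberPoly a b) D = C c * jacobianDet H.A H.B := by
  rcases eq_or_ne (eval ![b, -a] H.A) 0 with hA | hA
  · have hB := H.eval_B_ne_zero_of_eval_A_eq_zero hv hA
    exact ⟨H.B, _, H.homogeneous_B, hB, hB, H.jacobianDet_fiberPoly_B a b⟩
  · exact ⟨H.A, _, H.homogeneous_A, hA, hA, H.jacobianDet_fiberPoly_A a b⟩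

theorem natCast_mul_inflectionPoly : (d : MvPolynomial (Fin 2) ℂ) * H.inflectionPoly =
    -((X 0 * H.A + X 1 * H.B) * jacobianDet H.A H.B) := by
  have hA := euler_identity H.homogeneous_A
  have hB := euler_identity H.homogeneous_B
  have hx : H.tangentField (X 0) = H.B := by simp [tangentField, pderiv_X]
  have hy : H.tangentField (X 1) = -H.A := by simp [tangentField, pderiv_X]
  rw [inflectionPoly, hx, hy, jacobianDet]
  simp only [tangentField, map_neg]
  linear_combination (-H.B * pderiv 0 H.B + H.A * pderiv 1 H.B) * hA +
    (H.B * pderiv 0 H.A - H.A * pderiv 1 H.A) * hB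

theorem ne_zero_of_not_isInvariantLine (hv : ![b, -a] ≠ 0) (h : ¬ H.IsInvariantLine a b) :
    b * eval ![b, -a] H.A - a * eval ![b, -a] H.B ≠ 0 := by
  intro h0
  refine h (linForm_dvd_of_eval_eq_zero
    ((H.homogeneous_B.C_mul a).sub (H.homogeneous_A.C_mul b)) hv ?_)
  rw [map_sub, map_mul, map_mul, eval_C, eval_C]
  linear_combination -h0

theorem emultiplicity_inflectionPoly (hd : d ≠ 0) (hv : ![b, -a] ≠ 0)
    (hinv : ¬ H.IsInvariantLine a b) {k : ℕ} {P : MvPolynomial (Fin 2) ℂ}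
    (hP : H.fiberPoly a b = linForm a b ^ (k + 1) * P) (hPv : eval ![b, -a] P ≠ 0) :
    emultiplicity (linForm a b) H.inflectionPoly = k := by
  obtain ⟨D, c, hD, hDv, hc, hJ⟩ := H.exists_jacobianDet_fiberPoly_eq hv
  obtain ⟨S, hS, hSv⟩ := exists_jacobianDet_linForm_pow_mul (k := k) hD hd hDv hPv
  rw [hP, hS] at hJ
  refine emultiplicity_linForm hv (mul_ne_zero hc (Nat.cast_ne_zero.2 hd))
    (S := -((X 0 * H.A + X 1 * H.B) * S)) ?_ ?_
  · rw [C_mul, map_natCast]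
    linear_combination C c * H.natCast_mul_inflectionPoly + (X 0 * H.A + X 1 * H.B) * hJ
  · have htangent := H.ne_zero_of_not_isInvariantLine hv hinv
    rw [sub_eq_add_neg] at htangent
    simpa using ⟨htangent, hSv⟩

theorem fiberPoly_ne_zero (hd : d ≠ 0) (hv : ![b, -a] ≠ 0) {n : ℕ}
    (hT : emultiplicity (linForm a b) H.inflectionPoly = n) : H.fiberPoly a b ≠ 0 := by
  intro h0
  obtain ⟨D, c, -, -, hc, hJ⟩ := H.exists_jacobianDet_fiberPoly_eq hv
  have hjac : jacobianDet H.A H.B = 0 := by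
    rw [h0, jacobianDet, map_zero, map_zero, zero_mul, zero_mul, sub_zero, eq_comm] at hJ
    exact (mul_eq_zero.1 hJ).resolve_left (C_ne_zero.2 hc)
  have hinfl := H.natCast_mul_inflectionPoly
  rw [hjac, mul_zero, neg_zero, mul_eq_zero, or_iff_right (Nat.cast_ne_zero.2 hd)] at hinfl
  rw [hinfl, emultiplicity_zero] at hT
  exact ENat.top_ne_natCast n hT

theorem exists_linForm_pow_mul_eq_fiberPoly (hd : d ≠ 0) (hv : ![b, -a] ≠ 0) {n : ℕ}
    (hT : H.IsTransverseInflectionLine a b n) :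
    ∃ (e : ℕ) (P : MvPolynomial (Fin 2) ℂ), P.IsHomogeneous e ∧
      linForm a b ^ (n + 1) * P = H.fiberPoly a b ∧ eval ![b, -a] P ≠ 0 := by
  obtain ⟨hinv, -, hmult⟩ := hT
  obtain ⟨_ | k, e, P, hP, hPe, hPv⟩ := exists_linForm_pow_mul hv
    (H.isHomogeneous_fiberPoly a b) (H.fiberPoly_ne_zero hd hv hmult)
  · rw [pow_zero, one_mul] at hPe
    refine absurd ?_ hPv
    rw [← hPe, eval_fiberPoly]
    ring
  · have hkn : k = n := by
      exact_mod_cast (H.emultiplicity_inflectionPoly hd hv hinv hPe hPv).symm.trans hmult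
    exact ⟨e, P, hP, by rw [hPe, hkn], hPv⟩

end FiberPoly

section GaussFibers

theorem exists_rep_mk_pair {y x : ℂ} (h : ![y, x] ≠ 0) :
    ∃ c : ℂ, c ≠ 0 ∧ (Projectivization.mk ℂ ![y, x] h).rep = ![c * y, c * x] := by
  obtain ⟨c, hc⟩ := Projectivization.exists_smul_eq_mk_rep ℂ ![y, x] h
  refine ⟨c, c.ne_zero, ?_⟩
  rw [← hc, Units.smul_def, Matrix.smul_cons, Matrix.smul_cons, Matrix.smul_empty, smul_eq_mul,
    smul_eq_mul]

variable {d : ℕ} (H : HomogeneousFoliation d) {a b x y : ℂ}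

theorem gaussLift_pair (x y : ℂ) :
    H.gaussLift ![y, x] = ![-(eval ![x, y] H.A), eval ![x, y] H.B] := rfl

theorem gaussLift_pair_mul (c x y : ℂ) :
    H.gaussLift ![c * y, c * x] = c ^ d • H.gaussLift ![y, x] := by
  rw [gaussLift_pair, gaussLift_pair, eval_pair_mul H.homogeneous_A,
    eval_pair_mul H.homogeneous_B, Matrix.smul_cons, Matrix.smul_cons, Matrix.smul_empty,
    smul_eq_mul, smul_eq_mul, mul_neg]

theorem gaussMap_mk (h : ![y, x] ≠ 0) : H.gaussMap (Projectivization.mk ℂ ![y, x] h) =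
    Projectivization.mk ℂ (H.gaussLift ![y, x]) (H.gaussLift_ne_zero h) := by
  obtain ⟨c, -, hrep⟩ := exists_rep_mk_pair h
  rw [gaussMap, Projectivization.mk_eq_mk_iff']
  exact ⟨c ^ d, by rw [hrep, gaussLift_pair_mul]⟩

theorem gaussMap_mk_eq_of_eval_fiberPoly_eq_zero (h : ![y, x] ≠ 0) (hab : ![-a, b] ≠ 0)
    (h₀ : eval ![x, y] (H.fiberPoly a b) = 0) :
    H.gaussMap (Projectivization.mk ℂ ![y, x] h) =
      Projectivization.mk ℂ (H.gaussLift ![-a, b]) (H.gaussLift_ne_zero hab) := by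
  rw [gaussMap_mk, Projectivization.mk_eq_mk_iff', ← Submodule.mem_span_singleton]
  refine mem_span_singleton_of_det_eq_zero (H.gaussLift_ne_zero hab) ?_
  rw [eval_fiberPoly] at h₀
  change -(eval ![x, y] H.A) * eval ![b, -a] H.B = eval ![x, y] H.B * -(eval ![b, -a] H.A)
  linear_combination -h₀

theorem isCriticalPoint_mk (h : ![y, x] ≠ 0)
    (hcrit : ∀ i, eval ![x, y] (pderiv i H.A) * eval ![x, y] H.B =
      eval ![x, y] (pderiv i H.B) * eval ![x, y] H.A) :
    H.IsCriticalPoint (Projectivization.mk ℂ ![y, x] h) := by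
  obtain ⟨c, hc, hrep⟩ := exists_rep_mk_pair h
  have hscaled : ∀ i, eval ![c * x, c * y] (pderiv i H.A) * eval ![c * x, c * y] H.B =
      eval ![c * x, c * y] (pderiv i H.B) * eval ![c * x, c * y] H.A := by
    intro i
    apply mul_left_cancel₀ hc
    rw [← mul_assoc, ← mul_assoc, mul_eval_pderiv_pair_mul H.homogeneous_A,
      mul_eval_pderiv_pair_mul H.homogeneous_B, eval_pair_mul H.homogeneous_A,
      eval_pair_mul H.homogeneous_B]
    linear_combination c ^ d * c ^ d * hcrit i
  intro s t
  refine mem_span_singleton_of_det_eq_zero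
    (H.gaussLift_ne_zero (Projectivization.rep_nonzero _)) ?_
  rw [hrep]
  change -(s * eval ![c * x, c * y] (pderiv 0 H.A) + t * eval ![c * x, c * y] (pderiv 1 H.A)) *
      eval ![c * x, c * y] H.B =
    (s * eval ![c * x, c * y] (pderiv 0 H.B) + t * eval ![c * x, c * y] (pderiv 1 H.B)) *
      -(eval ![c * x, c * y] H.A)
  linear_combination -s * hscaled 0 - t * hscaled 1

theorem isCriticalPoint_mk_of_eval_pderiv_fiberPoly_eq_zero (h : ![y, x] ≠ 0)
    (hab : ![-a, b] ≠ 0) (h₀ : eval ![x, y] (H.fiberPoly a b) = 0)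
    (h₁ : ∀ i, eval ![x, y] (pderiv i (H.fiberPoly a b)) = 0) :
    H.IsCriticalPoint (Projectivization.mk ℂ ![y, x] h) := by
  refine H.isCriticalPoint_mk h fun i => ?_
  have hgrad := h₁ i
  rw [eval_fiberPoly] at h₀
  rw [pderiv_fiberPoly, map_sub, map_mul, map_mul, eval_C, eval_C] at hgrad
  have hU := H.gaussLift_ne_zero hab
  rw [gaussLift_pair] at hU
  have hparallel := mul_eq_mul_of_mul_eq_mul hU
    (v₀ := -(eval ![x, y] (pderiv i H.A))) (v₁ := eval ![x, y] (pderiv i H.B))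
    (w₀ := -(eval ![x, y] H.A)) (w₁ := eval ![x, y] H.B)
    (by linear_combination -hgrad) (by linear_combination -h₀)
  linear_combination -hparallel

theorem eval_linForm_eq_zero_of_nonFixedCriticalPointsInFiber_eq (hab : ![-a, b] ≠ 0)
    (hfib : H.nonFixedCriticalPointsInFiber (Projectivization.mk ℂ ![-a, b] hab) =
      {Projectivization.mk ℂ ![-a, b] hab})
    (hfix : x * eval ![b, -a] H.A + y * eval ![b, -a] H.B ≠ 0)
    (h₀ : eval ![x, y] (H.fiberPoly a b) = 0)
    (h₁ : ∀ i, eval ![x, y] (pderiv i (H.fiberPoly a b)) = 0) : a * x + b * y = 0 := by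
  have hne : ![y, x] ≠ 0 := by
    intro h
    have hy : y = 0 := congrFun h 0
    have hx : x = 0 := congrFun h 1
    exact hfix (by rw [hx, hy, zero_mul, zero_mul, add_zero])
  have hfiber := H.gaussMap_mk_eq_of_eval_fiberPoly_eq_zero hne hab h₀
  have hmem : Projectivization.mk ℂ ![y, x] hne ∈
      H.nonFixedCriticalPointsInFiber (Projectivization.mk ℂ ![-a, b] hab) := by
    refine ⟨hfiber.trans (H.gaussMap_mk hab).symm,
      H.isCriticalPoint_mk_of_eval_pderiv_fiberPoly_eq_zero hne hab h₀ h₁, ?_⟩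
    rw [hfiber, Ne, Projectivization.mk_eq_mk_iff']
    rintro ⟨c, hc⟩
    have hA : c * y = -(eval ![b, -a] H.A) := congrFun hc 0
    have hB : c * x = eval ![b, -a] H.B := congrFun hc 1
    exact hfix (by linear_combination x * hA - y * hB)
  rw [hfib, Set.mem_singleton_iff, Projectivization.mk_eq_mk_iff'] at hmem
  obtain ⟨c, hc⟩ := hmem
  have hy : c * -a = y := congrFun hc 0
  have hx : c * b = x := congrFun hc 1
  rw [← hx, ← hy]
  ring

end GaussFibers

section IsolatedCriticalFiber

variable {d : ℕ} {H : HomogeneousFoliation d} {a b : ℂ} {n : ℕ} {P : MvPolynomial (Fin 2) ℂ}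

/-- The fibre of the Gauss map through the direction `(b, -a)` of the line `a x + b y = 0` has the
equation `(a x + b y) ^ (n + 2) * P = 0`; in this fibre `(b, -a)` is not a fixed point, has
multiplicity exactly `n + 2`, and is the only nonfixed multiple root. -/
structure HasIsolatedCriticalFiber (H : HomogeneousFoliation d) (a b : ℂ) (n : ℕ)
    (P : MvPolynomial (Fin 2) ℂ) : Prop where
  exists_isHomogeneous : ∃ e, P.IsHomogeneous e
  linForm_pow_mul : linForm a b ^ (n + 2) * P = H.fiberPoly a b
  eval_ne_zero : eval ![b, -a] P ≠ 0
  transverse : b * eval ![b, -a] H.A - a * eval ![b, -a] H.B ≠ 0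
  eval_linForm_eq_zero : ∀ x y, x * eval ![b, -a] H.A + y * eval ![b, -a] H.B ≠ 0 →
    eval ![x, y] (H.fiberPoly a b) = 0 →
    (∀ i, eval ![x, y] (pderiv i (H.fiberPoly a b)) = 0) → a * x + b * y = 0

theorem HasIsolatedCriticalFiber.swap (h : H.HasIsolatedCriticalFiber a b n P) :
    H.swap.HasIsolatedCriticalFiber (-b) (-a) n (C ((-1) ^ (n + 1)) * swapVars P) where
  exists_isHomogeneous := by
    obtain ⟨e, he⟩ := h.exists_isHomogeneous
    exact ⟨e, IsHomogeneous.C_mul he.rename_isHomogeneous _⟩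
  linForm_pow_mul := by
    rw [fiberPoly_swap, ← h.linForm_pow_mul, map_mul, map_pow swapVars,
      swapVars_linForm, linForm_neg_neg, neg_pow, map_pow C, map_neg, map_one]
    have hsign : (-1 : MvPolynomial (Fin 2) ℂ) ^ (n + 2) * (-1) ^ (n + 1) = -1 := by
      rw [← pow_add]
      exact Odd.neg_one_pow ⟨n + 1, by ring⟩
    linear_combination linForm b a ^ (n + 2) * swapVars P * hsign
  eval_ne_zero := by
    rw [neg_neg, map_mul, eval_C, eval_swapVars]
    exact mul_ne_zero (pow_ne_zero _ (neg_ne_zero.2 one_ne_zero)) h.eval_ne_zero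
  transverse := by
    rw [neg_neg, eval_swap_A, eval_swap_B, neg_mul, neg_mul, neg_sub_neg]
    exact h.transverse
  eval_linForm_eq_zero x y hfix h₀ h₁ := by
    rw [neg_neg, eval_swap_A, eval_swap_B, add_comm] at hfix
    rw [fiberPoly_swap, map_neg, neg_eq_zero, eval_swapVars] at h₀
    simp only [fiberPoly_swap, map_neg, neg_eq_zero, Fin.forall_fin_two, pderiv_zero_swapVars,
      pderiv_one_swapVars, eval_swapVars] at h₁
    linear_combination -h.eval_linForm_eq_zero y x hfix h₀ (Fin.forall_fin_two.2 h₁.symm)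

theorem IsTransverseInflectionLine.exists_hasIsolatedCriticalFiber (hd : d ≠ 0)
    (hab : ![-a, b] ≠ 0) (hT : H.IsTransverseInflectionLine a b (n + 1))
    (hfib : H.nonFixedCriticalPointsInFiber (Projectivization.mk ℂ ![-a, b] hab) =
      {Projectivization.mk ℂ ![-a, b] hab}) : ∃ P, H.HasIsolatedCriticalFiber a b n P := by
  have hv : ![b, -a] ≠ 0 := by
    intro h
    have hb : b = 0 := congrFun h 0
    have ha : -a = 0 := congrFun h 1
    exact hab (by simp [ha, hb])
  obtain ⟨e, P, hP, hF, hPv⟩ := H.exists_linForm_pow_mul_eq_fiberPoly hd hv hT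
  exact ⟨P, ⟨e, hP⟩, hF, hPv, H.ne_zero_of_not_isInvariantLine hv hT.1, fun _ _ =>
    H.eval_linForm_eq_zero_of_nonFixedCriticalPointsInFiber_eq hab hfib⟩

end IsolatedCriticalFiber

/-! ### Curvature along the image of an inflection line -/

section SlopePencil

variable {d : ℕ} (H : HomogeneousFoliation d) (p : ℂ)

/-- The equation `A(μ, p μ - 1) + p B(μ, p μ - 1)` of the points at which the foliation has slope
`p`, where `μ` is the coordinate `x` on the line `y = p x - 1`. -/
noncomputable def slopePoly : ℂ[X] := restrictLine p (H.A + C p * H.B)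

theorem isHomogeneous_A_add_C_mul_B : (H.A + C p * H.B).IsHomogeneous d :=
  H.homogeneous_A.add (H.homogeneous_B.C_mul p)

theorem isPencilWeb_leg₁ : IsPencilWeb d (H.slopePoly p) (restrictLine p H.B) p H.leg₁ := by
  intro z ξ
  have hpencil : pencil (H.slopePoly p) (restrictLine p H.B) (z.1 - p) =
      restrictLine p (H.A + C z.1 * H.B) := by
    simp only [pencil, slopePoly, map_add, map_mul, restrictLine_C, Polynomial.C_sub]
    ring
  have hy : p * ξ.2 - (z.2 * ξ.1 - (z.1 - p) * ξ.2) = z.1 * ξ.2 - z.2 * ξ.1 := by ring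
  rw [hpencil, eval_homogenize_restrictLine (H.isHomogeneous_A_add_C_mul_B z.1), hy, map_add,
    map_mul, eval_C, leg₁]

theorem isPencil_slopePoly : IsPencil d (H.slopePoly p) (restrictLine p H.B) where
  natDegree_left_le := natDegree_restrictLine_le (H.isHomogeneous_A_add_C_mul_B p) p
  natDegree_right_le := natDegree_restrictLine_le H.homogeneous_B p
  eval_right_ne_zero μ hF hB := by
    rw [slopePoly, eval_restrictLine, map_add, map_mul, eval_C] at hF
    rw [eval_restrictLine] at hB
    rw [hB, mul_zero, add_zero] at hF
    refine H.eval_B_ne_zero_of_eval_A_eq_zero (fun hv => ?_) hF hB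
    have hx : μ = 0 := congrFun hv 0
    have hy : p * μ - 1 = 0 := congrFun hv 1
    simp [hx] at hy

theorem coeff_slopePoly_ne_zero_or :
    (H.slopePoly p).coeff d ≠ 0 ∨ (restrictLine p H.B).coeff d ≠ 0 := by
  rw [slopePoly, coeff_restrictLine (H.isHomogeneous_A_add_C_mul_B p),
    coeff_restrictLine H.homogeneous_B, map_add, map_mul, eval_C, or_iff_not_imp_right, not_not]
  intro hB hA
  rw [hB, mul_zero, add_zero] at hA
  exact H.eval_B_ne_zero_of_eval_A_eq_zero (fun hv => one_ne_zero (congrFun hv 0)) hA hB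

end SlopePencil

namespace HasIsolatedCriticalFiber

variable {d : ℕ} {H : HomogeneousFoliation d} {a b p : ℂ} {n : ℕ} {P : MvPolynomial (Fin 2) ℂ}

theorem eval_B_ne_zero (h : H.HasIsolatedCriticalFiber a b n P)
    (hp : eval ![b, -a] H.A + p * eval ![b, -a] H.B = 0) : eval ![b, -a] H.B ≠ 0 := by
  intro hB
  rw [hB, mul_zero, add_zero] at hp
  exact h.transverse (by rw [hp, hB, mul_zero, mul_zero, sub_zero])

theorem add_mul_ne_zero (h : H.HasIsolatedCriticalFiber a b n P)
    (hp : eval ![b, -a] H.A + p * eval ![b, -a] H.B = 0) : a + b * p ≠ 0 := fun hκ =>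
  h.transverse (by linear_combination b * hp - eval ![b, -a] H.B * hκ)

theorem C_mul_eq_fiberPoly (hp : eval ![b, -a] H.A + p * eval ![b, -a] H.B = 0) :
    C (eval ![b, -a] H.B) * (H.A + C p * H.B) = H.fiberPoly a b := by
  have hC : C (eval ![b, -a] H.A) + C p * C (eval ![b, -a] H.B) =
      (0 : MvPolynomial (Fin 2) ℂ) := by rw [← C_mul, ← C_add, hp, C_0]
  rw [fiberPoly]
  linear_combination H.B * hC

theorem slopePoly_eq (h : H.HasIsolatedCriticalFiber a b n P)
    (hp : eval ![b, -a] H.A + p * eval ![b, -a] H.B = 0) :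
    H.slopePoly p = (Polynomial.X - Polynomial.C (b / (a + b * p))) ^ (n + 2) *
      (Polynomial.C ((a + b * p) ^ (n + 2) / eval ![b, -a] H.B) * restrictLine p P) := by
  have hB := h.eval_B_ne_zero hp
  have hfiber := congrArg (restrictLine p) ((C_mul_eq_fiberPoly hp).trans h.linForm_pow_mul.symm)
  rw [map_mul, map_mul, map_pow, restrictLine_linForm (h.add_mul_ne_zero hp), restrictLine_C,
    ← slopePoly, mul_pow, ← Polynomial.C_pow] at hfiber
  apply mul_left_cancel₀ (Polynomial.C_ne_zero.2 hB)
  rw [hfiber, mul_left_comm (Polynomial.C (eval ![b, -a] H.B)), ← mul_assoc (Polynomial.C _),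
    ← Polynomial.C_mul, mul_div_cancel₀ _ hB]
  ring

theorem eval_derivative_slopePoly_ne_zero (h : H.HasIsolatedCriticalFiber a b n P)
    (hp : eval ![b, -a] H.A + p * eval ![b, -a] H.B = 0) {μ : ℂ} (hμ : μ ≠ b / (a + b * p))
    (hF : (H.slopePoly p).eval μ = 0) : (derivative (H.slopePoly p)).eval μ ≠ 0 := by
  intro hF'
  have hgrad := eval_pderiv_eq_zero_of_restrictLine (H.isHomogeneous_A_add_C_mul_B p) hF hF'
  rw [slopePoly, eval_restrictLine] at hF
  have hfix : μ * eval ![b, -a] H.A + (p * μ - 1) * eval ![b, -a] H.B ≠ 0 := fun h0 =>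
    h.eval_B_ne_zero hp (by linear_combination μ * hp - h0)
  have hline := h.eval_linForm_eq_zero μ (p * μ - 1) hfix
    (by rw [← C_mul_eq_fiberPoly hp, map_mul, hF, mul_zero])
    fun i => by rw [← C_mul_eq_fiberPoly hp, pderiv_C_mul, map_mul, hgrad, mul_zero]
  exact hμ ((eq_div_iff (h.add_mul_ne_zero hp)).2 (by linear_combination hline))

theorem eval_pderiv_one_A (h : H.HasIsolatedCriticalFiber a b n P)
    (hp : eval ![b, -a] H.A + p * eval ![b, -a] H.B = 0) :
    eval ![b, -a] (pderiv 1 H.A) = -p * eval ![b, -a] (pderiv 1 H.B) := by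
  have hl : eval ![b, -a] (linForm a b) = 0 := by
    rw [eval_linForm]
    ring
  have hgrad := congrArg (fun f => eval ![b, -a] (pderiv 1 f))
    ((C_mul_eq_fiberPoly hp).trans h.linForm_pow_mul.symm)
  simp only [pderiv_mul, pderiv_C, pderiv_pow, map_add, map_mul, map_pow, eval_C,
    hl, zero_pow (Nat.succ_ne_zero _), mul_zero, zero_mul, add_zero, zero_add,
    Nat.reduceSubDiff] at hgrad
  linear_combination (mul_eq_zero.1 hgrad).resolve_left (h.eval_B_ne_zero hp)

theorem mul_eval_criterionPoly (h : H.HasIsolatedCriticalFiber a b n P)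
    (hp : eval ![b, -a] H.A + p * eval ![b, -a] H.B = 0) {e : ℕ} (hP : P.IsHomogeneous e) {μ : ℂ}
    (hμ : μ = b / (a + b * p)) :
    (a + b * p) * eval ![b, -a] (H.criterionPoly (n + 2) P) = (a + b * p) ^ (d + e) *
      (n * (derivative (restrictLine p H.B)).eval μ * (restrictLine p P).eval μ +
        2 * (n + 3) * (derivative (restrictLine p P)).eval μ * (restrictLine p H.B).eval μ) := by
  have hx : (a + b * p) * μ = b := by rw [hμ, mul_div_cancel₀ _ (h.add_mul_ne_zero hp)]
  have hy : (a + b * p) * (p * μ - 1) = -a := by linear_combination p * hx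
  have hBv := eval_pair_restrictLine H.homogeneous_B hx hy
  have hPv := eval_pair_restrictLine hP hx hy
  have hB' := eval_pderiv_pair_restrictLine H.homogeneous_B hx hy
  have hP' := eval_pderiv_pair_restrictLine hP hx hy
  have hA : eval ![b, -a] H.A = -p * eval ![b, -a] H.B := by linear_combination hp
  simp only [criterionPoly, map_add, map_sub, map_mul, eval_C, h.eval_pderiv_one_A hp, hA]
  push_cast
  rw [pow_add]
  linear_combination (n : ℂ) * eval ![b, -a] P * hB' +
    n * (a + b * p) ^ d * (derivative (restrictLine p H.B)).eval μ * hPv +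
    2 * (n + 3) * eval ![b, -a] H.B * hP' +
    2 * (n + 3) * (a + b * p) ^ e * (derivative (restrictLine p P)).eval μ * hBv

theorem curvatureHolomorphicAt_leg₁_iff (h : H.HasIsolatedCriticalFiber a b n P) (hd : 2 ≤ d)
    (hp : eval ![b, -a] H.A + p * eval ![b, -a] H.B = 0) {q : ℂ} (hq : q ≠ 0) :
    CurvatureHolomorphicAt d H.leg₁ (p, q) ↔ eval ![b, -a] (H.criterionPoly (n + 2) P) = 0 := by
  obtain ⟨e, hP⟩ := h.exists_isHomogeneous
  have hB := h.eval_B_ne_zero hp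
  have hκ := h.add_mul_ne_zero hp
  set μ₀ := b / (a + b * p) with hμ₀
  set c := (a + b * p) ^ (n + 2) / eval ![b, -a] H.B
  have hc : c ≠ 0 := div_ne_zero (pow_ne_zero _ hκ) hB
  have hx : (a + b * p) * μ₀ = b := mul_div_cancel₀ _ hκ
  have hy : (a + b * p) * (p * μ₀ - 1) = -a := by linear_combination p * hx
  have hPμ : (restrictLine p P).eval μ₀ ≠ 0 :=
    right_ne_zero_of_mul (eval_pair_restrictLine hP hx hy ▸ h.eval_ne_zero)
  have hBμ : (restrictLine p H.B).eval μ₀ ≠ 0 :=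
    right_ne_zero_of_mul (eval_pair_restrictLine H.homogeneous_B hx hy ▸ hB)
  have hGμ : (Polynomial.C c * restrictLine p P).eval μ₀ ≠ 0 := by
    rw [Polynomial.eval_C_mul]
    exact mul_ne_zero hc hPμ
  rw [(H.isPencilWeb_leg₁ p).curvatureHolomorphicAt_iff_simplePolarCoeff hd
    (H.isPencil_slopePoly p) (H.coeff_slopePoly_ne_zero_or p) (h.slopePoly_eq hp) hGμ
    (fun _ => h.eval_derivative_slopePoly_ne_zero hp) hq,
    simplePolarCoeff_C_mul _ hc, simplePolarCoeff_eq_zero_iff n hPμ hBμ]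
  have hcriterion := congrArg (· = 0) (h.mul_eval_criterionPoly hp hP hμ₀)
  simp only [mul_eq_zero_iff_left hκ, mul_eq_zero_iff_left (pow_ne_zero _ hκ)] at hcriterion
  rw [hcriterion]

theorem curvatureHolomorphicAt_leg₂_iff (h : H.HasIsolatedCriticalFiber a b n P) (hd : 2 ≤ d)
    (hp : eval ![b, -a] H.B + p * eval ![b, -a] H.A = 0) {q : ℂ} (hq : q ≠ 0) :
    CurvatureHolomorphicAt d H.leg₂ (p, q) ↔ eval ![b, -a] (H.criterionPoly (n + 2) P) = 0 := by
  have hp' : eval ![-a, - -b] H.swap.A + p * eval ![-a, - -b] H.swap.B = 0 := by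
    rwa [neg_neg, eval_swap_A, eval_swap_B]
  rw [← leg₁_swap, h.swap.curvatureHolomorphicAt_leg₁_iff hd hp' hq, criterionPoly_swap, map_neg,
    neg_eq_zero, neg_neg, map_mul, eval_C, eval_swapVars,
    mul_eq_zero_iff_left (pow_ne_zero _ (neg_ne_zero.2 one_ne_zero))]

end HasIsolatedCriticalFiber

theorem dualChart₁_eq_mk_iff {u v w p q : ℂ} (h : ![u, v, w] ≠ 0) :
    dualChart₁ (p, q) = Projectivization.mk ℂ ![u, v, w] h ↔
      v ≠ 0 ∧ u + p * v = 0 ∧ w = q * v := by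
  rw [dualChart₁, Projectivization.mk_eq_mk_iff']
  constructor
  · rintro ⟨c, hc⟩
    have hu : c * u = p := congrFun hc 0
    have hv : c * v = -1 := congrFun hc 1
    have hw : c * w = -q := congrFun hc 2
    refine ⟨?_, by linear_combination u * hv - v * hu, by linear_combination w * hv - v * hw⟩
    rintro rfl
    simp at hv
  · rintro ⟨hv, hp, rfl⟩
    obtain rfl : u = -(p * v) := by linear_combination hp
    exact ⟨-v⁻¹, by ext i; fin_cases i <;> simp [hv, mul_comm v⁻¹]⟩

theorem dualChart₂_eq_mk_iff {u v w p q : ℂ} (h : ![u, v, w] ≠ 0) :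
    dualChart₂ (p, q) = Projectivization.mk ℂ ![u, v, w] h ↔
      u ≠ 0 ∧ v + p * u = 0 ∧ w = q * u := by
  rw [dualChart₂, Projectivization.mk_eq_mk_iff']
  constructor
  · rintro ⟨c, hc⟩
    have hu : c * u = -1 := congrFun hc 0
    have hv : c * v = p := congrFun hc 1
    have hw : c * w = -q := congrFun hc 2
    refine ⟨?_, by linear_combination v * hu - u * hv, by linear_combination w * hu - u * hw⟩
    rintro rfl
    simp at hu
  · rintro ⟨hu, hp, rfl⟩
    obtain rfl : v = -(p * u) := by linear_combination hp
    exact ⟨-u⁻¹, by ext i; fin_cases i <;> simp [hu, mul_comm u⁻¹]⟩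

section GaussImage

variable {d : ℕ} (H : HomogeneousFoliation d) {a b x y : ℂ}

theorem eval_A_eval_B_ne_zero (hv : ![x, y] ≠ 0) (s : ℂ) :
    ![eval ![x, y] H.A, eval ![x, y] H.B, s] ≠ 0 := fun h =>
  H.eval_B_ne_zero_of_eval_A_eq_zero hv (congrFun h 0) (congrFun h 1)

/-- The line `A(x, y) X + B(x, y) Y + s = 0`, parallel to the tangent line of the foliation at
`(x, y)`. -/
noncomputable def parallelLine (hv : ![x, y] ≠ 0) (s : ℂ) : DualPlane :=
  Projectivization.mk ℂ _ (H.eval_A_eval_B_ne_zero hv s)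

theorem tangentLine_coordinates_mul (t x y : ℂ) :
    ![eval ![t * x, t * y] H.A, eval ![t * x, t * y] H.B,
        -(t * x * eval ![t * x, t * y] H.A + t * y * eval ![t * x, t * y] H.B)] =
      t ^ d • ![eval ![x, y] H.A, eval ![x, y] H.B,
        -(t * (x * eval ![x, y] H.A + y * eval ![x, y] H.B))] := by
  rw [eval_pair_mul H.homogeneous_A, eval_pair_mul H.homogeneous_B, Matrix.smul_cons,
    Matrix.smul_cons, Matrix.smul_cons, Matrix.smul_empty, smul_eq_mul, smul_eq_mul, smul_eq_mul]
  congr 3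
  ring

theorem mem_gaussImageOfLine_iff (hd : d ≠ 0) (hv : ![b, -a] ≠ 0)
    (htransverse : b * eval ![b, -a] H.A - a * eval ![b, -a] H.B ≠ 0) (ℓ : DualPlane) :
    ℓ ∈ H.gaussImageOfLine a b ↔ ∃ s, s ≠ 0 ∧ ℓ = H.parallelLine hv s := by
  have hΘ : b * eval ![b, -a] H.A + -a * eval ![b, -a] H.B ≠ 0 := by
    rwa [neg_mul, ← sub_eq_add_neg]
  constructor
  · rintro ⟨x, y, h, hxy, rfl⟩
    obtain ⟨t, rfl, rfl⟩ := exists_smul_pair_of_mul_eq_mul (w₀ := x) (w₁ := y) hv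
      (by linear_combination -hxy)
    have ht : t ≠ 0 := by
      rintro rfl
      rw [tangentLine_coordinates_mul, zero_pow hd, zero_smul] at h
      exact h rfl
    refine ⟨_, neg_ne_zero.2 (mul_ne_zero ht hΘ), ?_⟩
    rw [parallelLine, Projectivization.mk_eq_mk_iff']
    exact ⟨t ^ d, (H.tangentLine_coordinates_mul t b (-a)).symm⟩
  · rintro ⟨s, hs, rfl⟩
    obtain ⟨t, rfl⟩ : ∃ t, s = -(t * (b * eval ![b, -a] H.A + -a * eval ![b, -a] H.B)) :=
      ⟨-s / _, by rw [div_mul_cancel₀ _ hΘ, neg_neg]⟩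
    have ht : t ≠ 0 := left_ne_zero_of_mul (neg_ne_zero.1 hs)
    have hcoord := H.tangentLine_coordinates_mul t b (-a)
    refine ⟨t * b, t * -a, ?_, by ring, ?_⟩
    · rw [hcoord]
      exact smul_ne_zero (pow_ne_zero _ ht) (H.eval_A_eval_B_ne_zero hv _)
    · rw [parallelLine, eq_comm, Projectivization.mk_eq_mk_iff']
      exact ⟨t ^ d, hcoord.symm⟩

theorem parallelLine_injective (hv : ![x, y] ≠ 0) : Function.Injective (H.parallelLine hv) := by
  intro s s' h
  rw [parallelLine, parallelLine, Projectivization.mk_eq_mk_iff'] at h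
  obtain ⟨c, hc⟩ := h
  have hA : c * eval ![x, y] H.A = eval ![x, y] H.A := congrFun hc 0
  have hB : c * eval ![x, y] H.B = eval ![x, y] H.B := congrFun hc 1
  have hs : c * s' = s := congrFun hc 2
  have hc₁ : c = 1 := by
    rcases eq_or_ne (eval ![x, y] H.A) 0 with hA₀ | hA₀
    · exact (mul_eq_right₀ (H.eval_B_ne_zero_of_eval_A_eq_zero hv hA₀)).1 hB
    · exact (mul_eq_right₀ hA₀).1 hA
  rw [← hs, hc₁, one_mul]

theorem infinite_gaussImageOfLine (hd : d ≠ 0) (hv : ![b, -a] ≠ 0)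
    (htransverse : b * eval ![b, -a] H.A - a * eval ![b, -a] H.B ≠ 0) :
    (H.gaussImageOfLine a b).Infinite := by
  refine ((Set.finite_singleton (0 : ℂ)).infinite_compl.image
    (H.parallelLine_injective hv).injOn).mono ?_
  rintro _ ⟨s, hs, rfl⟩
  exact (H.mem_gaussImageOfLine_iff hd hv htransverse _).2 ⟨s, hs, rfl⟩

end GaussImage

namespace HasIsolatedCriticalFiber

variable {d : ℕ} {H : HomogeneousFoliation d} {a b : ℂ} {n : ℕ} {P : MvPolynomial (Fin 2) ℂ}

theorem legCurvatureHolomorphicAt_parallelLine_iff (h : H.HasIsolatedCriticalFiber a b n P)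
    (hd : 2 ≤ d) (hv : ![b, -a] ≠ 0) {s : ℂ} (hs : s ≠ 0) :
    H.LegCurvatureHolomorphicAt (H.parallelLine hv s) ↔
      eval ![b, -a] (H.criterionPoly (n + 2) P) = 0 := by
  constructor
  · rintro ⟨h₁, h₂⟩
    rcases eq_or_ne (eval ![b, -a] H.B) 0 with hB | hB
    · have hA : eval ![b, -a] H.A ≠ 0 := fun hA => H.eval_B_ne_zero_of_eval_A_eq_zero hv hA hB
      refine (h.curvatureHolomorphicAt_leg₂_iff hd (p := 0) (by rw [hB, zero_mul, add_zero])
        (div_ne_zero hs hA)).1 (h₂ _ ((dualChart₂_eq_mk_iff _).2 ⟨hA, ?_, ?_⟩))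
      · rw [hB, zero_mul, add_zero]
      · rw [div_mul_cancel₀ _ hA]
    · have hp : eval ![b, -a] H.A + -eval ![b, -a] H.A / eval ![b, -a] H.B * eval ![b, -a] H.B
          = 0 := by rw [div_mul_cancel₀ _ hB, add_neg_cancel]
      exact (h.curvatureHolomorphicAt_leg₁_iff hd hp (div_ne_zero hs hB)).1
        (h₁ _ ((dualChart₁_eq_mk_iff _).2 ⟨hB, hp, (div_mul_cancel₀ _ hB).symm⟩))
  · intro hQ
    constructor
    · rintro ⟨p, q⟩ hm
      obtain ⟨-, hp, hsq⟩ := (dualChart₁_eq_mk_iff _).1 hm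
      exact (h.curvatureHolomorphicAt_leg₁_iff hd hp (left_ne_zero_of_mul (hsq ▸ hs))).2 hQ
    · rintro ⟨p, q⟩ hm
      obtain ⟨-, hp, hsq⟩ := (dualChart₂_eq_mk_iff _).1 hm
      exact (h.curvatureHolomorphicAt_leg₂_iff hd hp (left_ne_zero_of_mul (hsq ▸ hs))).2 hQ

theorem legCurvatureHolomorphicOn_gaussImageOfLine_iff (h : H.HasIsolatedCriticalFiber a b n P)
    (hd : 2 ≤ d) : H.LegCurvatureHolomorphicOn (H.gaussImageOfLine a b) ↔
      eval ![b, -a] (H.criterionPoly (n + 2) P) = 0 := by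
  have hd₀ : d ≠ 0 := by lia
  have hv : ![b, -a] ≠ 0 := by
    intro hv
    have hb : b = 0 := congrFun hv 0
    have ha : -a = 0 := congrFun hv 1
    exact h.transverse (by rw [hb, neg_eq_zero.1 ha, zero_mul, zero_mul, sub_zero])
  have hpoint : ∀ ℓ ∈ H.gaussImageOfLine a b, H.LegCurvatureHolomorphicAt ℓ ↔
      eval ![b, -a] (H.criterionPoly (n + 2) P) = 0 := by
    intro ℓ hℓ
    obtain ⟨s, hs, rfl⟩ := (H.mem_gaussImageOfLine_iff hd₀ hv h.transverse ℓ).1 hℓ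
    exact h.legCurvatureHolomorphicAt_parallelLine_iff hd hv hs
  refine ⟨fun hfinite => ?_, fun hQ => ?_⟩
  · obtain ⟨ℓ, hℓ, hholomorphic⟩ :=
      (H.infinite_gaussImageOfLine hd₀ hv h.transverse).exists_notMem_finite hfinite
    exact (hpoint ℓ hℓ).1 (not_not.1 fun hnot => hholomorphic ⟨hℓ, hnot⟩)
  · rw [LegCurvatureHolomorphicOn, Set.sep_eq_empty_iff_mem_false.2
      fun ℓ hℓ hnot => hnot ((hpoint ℓ hℓ).2 hQ)]
    exact Set.finite_empty

end HasIsolatedCriticalFiber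

end HomogeneousFoliation

theorem corollary3p6 (d : ℕ) (hd : 3 ≤ d) (H : HomogeneousFoliation d) (a b : ℂ)
    (hab : ![-a, b] ≠ 0) (ν : ℕ)
    (hT : H.IsTransverseInflectionLine a b (ν - 1))
    (hfib : H.nonFixedCriticalPointsInFiber (Projectivization.mk ℂ ![-a, b] hab)
      = {Projectivization.mk ℂ ![-a, b] hab}) :
    ∃ P : MvPolynomial (Fin 2) ℂ, linForm a b ^ ν * P = H.fiberPoly a b ∧
      (H.LegCurvatureHolomorphicOn (H.gaussImageOfLine a b) ↔
        MvPolynomial.eval ![b, -a] (H.criterionPoly ν P) = 0) := by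
  obtain ⟨n, rfl⟩ : ∃ n, ν = n + 2 := ⟨ν - 2, by have := hT.2.1; lia⟩
  obtain ⟨P, hP⟩ := hT.exists_hasIsolatedCriticalFiber (by lia) hab hfib
  exact ⟨P, hP.linForm_pow_mul, hP.legCurvatureHolomorphicOn_gaussImageOfLine_iff (by lia)⟩
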